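/- **Notation.** For points $(n,x,t)$, $(n',x',t')$ (level in $\mathbb N$, position and time in $\mathbb R$) write $(n,t)<(n',t')$ if $n>n'$, or if $n=n'$ and $t<t'$. Let $H^0=\delta$ be the Dirac delta and, for $m\ge1$, $H^m(x)=\frac{x^{m-1}}{(m-1)!}\mathbf 1\{x\ge 0\}$. Let $$p^*_s(x,y)=\frac{\exp\!\big(-\frac{(y-e^{-s}x)^2}{1-e^{-2s}}\big)}{\sqrt{\pi(1-e^{-2s})}},\qquad p_s(x,y)=\frac{e^{-(y-x)^2/s}}{\sqrt{\pi s}}\qquad(s>0),$$ and $p^*_0(x,y)=p_0(x,y)=\delta(x-y)$. The Dyson Brownian minor kernel is $$K^{\mathrm{DBM}}((n,x,t),(n',x',t'))=-\phi^{\mathrm{DBM}}+2^{(n'-n)/2}\frac{2}{(2\pi i)^2}\int_\gamma du\int_\Gamma dv\,\frac{v^{n'}}{u^n}\,\frac{e^{-u^2+2ux+v^2-2vx'}}{e^{-(t'-t)}v-u},$$ where $\gamma$ is a positively oriented circle around $0$ and $\Gamma$ is an upward vertical line to its right with $|u|<|v|$ and $|u|<e^{-(t'-t)}|v|$ for all $u\in\gamma$,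 $v\in\Gamma$ (for instance $|u|=1$ and $\operatorname{Re}v=1+e^{t'-t}$), and $$\phi^{\mathrm{DBM}}=\begin{cases}2^{(n-n')/2}e^{n'(t'-t)}\int_{\mathbb R}H^{n-n'}(x-y)\,p^*_{t'-t}(y,x')\,dy,&(n,t)<(n',t'),\\0,&\text{otherwise.}\end{cases}$$ **Theorem.** Let $a\in(-1,1)$ and $u_\pm=a\pm i\sqrt{1-a^2}$. Define the time-dependent Bead kernel $$K^{\mathrm{Bead}}_a((n,x,t),(n',x',t'))=-\phi^{\mathrm{Bead}}_a+\frac1{2\pi i}\int_{u_-}^{u_+}u^{n'-n}e^{\frac12(t'-t)(u^2-2au)+u(x-x')}\,du,$$ $$\phi^{\mathrm{Bead}}_a=\begin{cases}\int_{\mathbb R}H^{n-n'}(x-y)\,p_{2(t'-t)}\big(y,\,x'+a(t'-t)\big)\,dy,&(n,t)<(n',t'),\\0,&\text{otherwise,}\end{cases}$$ where the contour is the arc of the unit circle from $u_-$ through $1$ to $u_+$. 1. As $N\to\infty$, $$e^{-N\left(\frac{t'}{2N}-\frac{t}{2N}\right)}\,N^{\frac12(n-n')}\,(2N)^{-\frac12}\,K^{\mathrm{DBM}}\Big(\big(N+n,\sqrt{2N}a+\tfrac{x}{\sqrt{2N}},\tfrac{t}{2N}\big),\big(N+n',\sqrt{2N}a+\tfrac{x'}{\sqrt{2N}},\tfrac{t'}{2N}\big)\Big)\longrightarrow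 K^{\mathrm{Bead}}_a((n,x,t),(n',x',t')),$$ uniformly on the intersection of every compact subset of $(\mathbb N\times\mathbb R^2)^2$ ($\mathbb N$ discrete, $\mathbb R$ Euclidean) with the set of pairs such that $n\le n'$ or $t\le t'$. This set contains all pairs of points that lie on a common space-like path. 2. If $a>0$ or $n\le n'$, the contour may be replaced by the straight line segment from $u_-$ to $u_+$. 3. For $t=t'$ the kernel is Boutillier's bead kernel with parameter $a$: with $k=n'-n$, $\xi=\sqrt{1-a^2}\,(x-x')$, and excluding the jump point $n=n'+1$, $x=x'$, $$K^{\mathrm{Bead}}_a((n,x,t),(n',x',t))=\sqrt{1-a^2}\,e^{a(x-x')}\,J_a(k,\xi),$$ $$J_a(k,\xi)=\begin{cases}\frac1{2\pi}\int_{[-1,1]}(a+i\varphi\sqrt{1-a^2})^k e^{i\varphi\xi}\,d\varphi,&k\ge0,\\[2pt]-\frac1{2\pi}\int_{\mathbb R\setminus[-1,1]}(a+i\varphi\sqrt{1-a^2})^k e^{i\varphi\xi}\,d\varphi,&k<0,\end{cases}$$ the last integral being the limit as $R\to\infty$ of the integrals over $1\le|\varphi|\le R$. -/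

import Mathlib

open Filter Topology

noncomputable section

namespace DysonBead

/-- A space-time point `(n, x, t)`: a level, a position and a time. The topology is the product
of the discrete topology on the levels and the Euclidean topologies. -/
abbrev Point : Type := ℕ × ℝ × ℝ

/-- The relation `(n, t) < (n', t')`: either `n > n'`, or `n = n'` and `t < t'`. -/
def Precedes (p p' : Point) : Prop :=
  p'.1 < p.1 ∨ (p.1 = p'.1 ∧ p.2.2 < p'.2.2)

/-- The pairs of points at which the kernels below are given by meaningful formulas: all pairs
except those with `n > n'` and `t > t'`, for which a transition density over a negative time
would be needed. All pairs of points on a common space-like path, in either order, belong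
to this set. -/
def admissible : Set (Point × Point) :=
  {q | q.1.1 ≤ q.2.1 ∨ q.1.2.2 ≤ q.2.2.2}

/-- The `m`-th anti-derivative `H^m` of the Dirac delta function for `m ≥ 1`, that is
`x ^ (m - 1) / (m - 1)!` for `x ≥ 0` and `0` for `x < 0`. The value `0` at order `m = 0` is a
placeholder for the delta function, which is treated separately in `smoothedH`. -/
def deltaAntideriv : ℕ → ℝ → ℝ
  | 0, _ => 0
  | k + 1, x => if 0 ≤ x then x ^ k / (Nat.factorial k : ℝ) else 0

/-- `∫ H^m (x - y) p_s (y, z) dy`, for a family `p` of transition densities and `s ≥ 0`, with the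
usual meaning of the two distributions involved: `H^0` is the delta function at `0`, and
`p_0 (y, z)` is the delta function at `z = y`. (The case `m = 0`, `s = 0` is never used.) -/
def smoothedH (p : ℝ → ℝ → ℝ → ℝ) (m : ℕ) (s x z : ℝ) : ℝ :=
  if s = 0 then deltaAntideriv m (x - z)
  else if m = 0 then p s x z
  else ∫ y : ℝ, deltaAntideriv m (x - y) * p s y z

/-- Transition density of the stationary Ornstein-Uhlenbeck process. -/
def ouDensity (s x y : ℝ) : ℝ :=
  Real.exp (-(y - Real.exp (-s) * x) ^ 2 / (1 - Real.exp (-s) ^ 2)) /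
    Real.sqrt (Real.pi * (1 - Real.exp (-s) ^ 2))

/-- Transition density of Brownian motion whose variance at time `s` is `s / 2`. -/
def bmDensity (s x y : ℝ) : ℝ :=
  1 / Real.sqrt (Real.pi * s) * Real.exp (-(y - x) ^ 2 / s)

/-! ### The kernel of the Dyson Brownian minor process -/

open Classical in
/-- The term `φ` of the kernel of the Dyson Brownian minor process. -/
def dbmPhi : Point → Point → ℝ
  | (n, x, t), (n', x', t') =>
    if Precedes (n, x, t) (n', x', t') then
      (2 : ℝ) ^ (((n : ℝ) - (n' : ℝ)) / 2) * Real.exp ((n' : ℝ) * (t' - t)) *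
        smoothedH ouDensity (n - n') (t' - t) x x'
    else 0

/-- The double contour integral
`∫_γ du ∫_Γ dv (v^n' / u^n) e^(-u²+2ux+v²-2vx') / (e^(-(t'-t)) v - u)`. Here `γ` is the
positively oriented unit circle, and `Γ` is the vertical line `Re v = 1 + e^(t'-t)`, directed
upwards. On these contours `|u| < |v|` and `|u| < e^(-(t'-t)) |v|`, and by Cauchy's theorem the
value is the same for all circles around `0` and vertical lines to their right with these two
properties. -/
def dbmIntegral : Point → Point → ℂ
  | (n, x, t), (n', x', t') =>
    circleIntegral (fun u : ℂ =>
      Complex.I * ∫ y : ℝ,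
        (fun v : ℂ =>
          v ^ n' / u ^ n *
            (Complex.exp (-u ^ 2 + 2 * u * (x : ℂ) + v ^ 2 - 2 * v * (x' : ℂ)) /
              ((Real.exp (-(t' - t)) : ℂ) * v - u)))
          (((1 + Real.exp (t' - t) : ℝ) : ℂ) + (y : ℂ) * Complex.I)) 0 1

/-- The correlation kernel of the Dyson Brownian minor process. -/
def dbmKernel : Point → Point → ℂ
  | (n, x, t), (n', x', t') =>
    -(dbmPhi (n, x, t) (n', x', t') : ℂ) +
      (((2 : ℝ) ^ (((n' : ℝ) - (n : ℝ)) / 2) : ℝ) : ℂ) *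
        (2 / (2 * (Real.pi : ℂ) * Complex.I) ^ 2) *
        dbmIntegral (n, x, t) (n', x', t')

/-- The rescaled point: level `N + n`, position `√(2N) a + x / √(2N)`, time `t / (2N)`. -/
def rescalePoint (a : ℝ) (N : ℕ) : Point → Point
  | (n, x, t) =>
    (N + n, Real.sqrt (2 * N) * a + x / Real.sqrt (2 * N), t / (2 * N))

/-- The kernel of the Dyson Brownian minor process in the bulk scaling around `a √(2N)`, with the
conjugating factors `e^(-N (T' - T))`, `T = t / (2N)`, `T' = t' / (2N)`, and `N^((n - n') / 2)`,
and with the Jacobian `(2N)^(-1/2)`. -/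
def rescaledDbmKernel (a : ℝ) (N : ℕ) : Point → Point → ℂ
  | (n, x, t), (n', x', t') =>
    ((Real.exp (-((N : ℝ) * (t' / (2 * N) - t / (2 * N)))) *
        (N : ℝ) ^ (((n : ℝ) - (n' : ℝ)) / 2) * (2 * (N : ℝ)) ^ (-(1 / 2) : ℝ) : ℝ) : ℂ) *
      dbmKernel (rescalePoint a N (n, x, t)) (rescalePoint a N (n', x', t'))

/-! ### The time-dependent Bead kernel -/

/-- The point `u₊ = a + i √(1 - a²)` of the unit circle. -/
def uPlus (a : ℝ) : ℂ := (a : ℂ) + (Real.sqrt (1 - a ^ 2) : ℂ) * Complex.I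

/-- The point `u₋ = a - i √(1 - a²)` of the unit circle. -/
def uMinus (a : ℝ) : ℂ := (a : ℂ) - (Real.sqrt (1 - a ^ 2) : ℂ) * Complex.I

open Classical in
/-- The heat-kernel term of the time-dependent Bead kernel. -/
def beadPhi (a : ℝ) : Point → Point → ℝ
  | (n, x, t), (n', x', t') =>
    if Precedes (n, x, t) (n', x', t') then
      smoothedH bmDensity (n - n') (2 * (t' - t)) x (x' + a * (t' - t))
    else 0

/-- The integrand `u^(n'-n) e^((t'-t)(u²-2au)/2 + u(x-x'))`. -/
def beadIntegrand (a : ℝ) : Point → Point → ℂ → ℂ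
  | (n, x, t), (n', x', t'), u =>
    u ^ ((n' : ℤ) - (n : ℤ)) *
      Complex.exp (1 / 2 * ((t' - t : ℝ) : ℂ) * (u ^ 2 - 2 * (a : ℂ) * u) + u * ((x - x' : ℝ) : ℂ))

/-- Contour integral of `f` along the arc of the unit circle that runs from `u₋` through `1`
to `u₊`; see `exp_arccos_mul_I` and `exp_neg_arccos_mul_I` for its end points. -/
def arcIntegral (a : ℝ) (f : ℂ → ℂ) : ℂ :=
  ∫ θ in (-Real.arccos a)..(Real.arccos a),
    f (Complex.exp ((θ : ℂ) * Complex.I)) * (Complex.I * Complex.exp ((θ : ℂ) * Complex.I))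

/-- Contour integral of `f` along the straight line segment from `u₋` to `u₊`. -/
def segmentIntegral (a : ℝ) (f : ℂ → ℂ) : ℂ :=
  ∫ r in (0 : ℝ)..1, f (uMinus a + (r : ℂ) * (uPlus a - uMinus a)) * (uPlus a - uMinus a)

/-- The time-dependent Bead kernel with parameter `a`. -/
def beadKernel (a : ℝ) (p p' : Point) : ℂ :=
  -(beadPhi a p p' : ℂ) +
    1 / (2 * (Real.pi : ℂ) * Complex.I) * arcIntegral a (beadIntegrand a p p')

theorem exp_arccos_mul_I {a : ℝ} (ha : a ∈ Set.Ioo (-1 : ℝ) 1) :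
    Complex.exp ((Real.arccos a : ℂ) * Complex.I) = uPlus a := by
  rw [Complex.exp_mul_I, ← Complex.ofReal_cos, ← Complex.ofReal_sin, Real.sin_arccos,
    Real.cos_arccos ha.1.le ha.2.le, uPlus]

theorem exp_neg_arccos_mul_I {a : ℝ} (ha : a ∈ Set.Ioo (-1 : ℝ) 1) :
    Complex.exp (((-Real.arccos a : ℝ) : ℂ) * Complex.I) = uMinus a := by
  rw [Complex.exp_mul_I, ← Complex.ofReal_cos, ← Complex.ofReal_sin, Real.cos_neg, Real.sin_neg,
    Real.sin_arccos, Real.cos_arccos ha.1.le ha.2.le, uMinus]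
  push_cast
  ring

/-- `J` is the value at level difference `k` and position difference `ξ` of Boutillier's bead
kernel with parameter `a`, which is
`(1/2π) ∫_{[-1,1]} (a + iφ√(1-a²))^k e^(iφξ) dφ` for `k ≥ 0` and
`-(1/2π) ∫_{ℝ∖[-1,1]} (a + iφ√(1-a²))^k e^(iφξ) dφ` for `k < 0`. The second integral is only
conditionally convergent for `k = -1`; it is taken as a limit over symmetric intervals. -/
def IsBoutillierValue (a : ℝ) (k : ℤ) (ξ : ℝ) (J : ℂ) : Prop :=
  let g : ℝ → ℂ := fun φ =>
    ((a : ℂ) + (φ : ℂ) * (Real.sqrt (1 - a ^ 2) : ℂ) * Complex.I) ^ k *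
      Complex.exp ((φ : ℂ) * (ξ : ℂ) * Complex.I)
  if 0 ≤ k then
    J = 1 / (2 * (Real.pi : ℂ)) * ∫ φ in (-1 : ℝ)..1, g φ
  else
    Tendsto (fun R : ℝ =>
      -(1 / (2 * (Real.pi : ℂ))) * ((∫ φ in (-R)..(-1), g φ) + ∫ φ in (1 : ℝ)..R, g φ))
      atTop (𝓝 J)

end DysonBead

end

/-!
The rescaled kernel is a double contour integral plus an explicit term, and both are treated
directly.

*The double integral.* Let `τ = (t' - t) / (2N)`. Enlarging the contours by `√(N/2)`, and the line
variable in addition by `e^τ`, gives `∮ dw ∫ dv E(w) F(v) / (v - w)` over the unit circle and a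
vertical line to its right (`rescaledDbmKernel_eq`). Up to bounded factors, `|E(w)|` is
`e^(N (a² + 1/2)) e^(-N (cos θ - a)²)` on the circle, and `|F(v)|` is
`e^(-N (a² + 1/2)) (|v|² e^(1 - |v|²))^(N/2)` on the line `Re v = a`: both contours pass through
the saddle points `u₊` and `u₋` by steepest descent. Moving the line to `Re v = a` produces, for
every `w` to the right of that line, the residue at `v = w`
(`VerticalDecay.norm_circleIntegral_sub_arcIntegral_le`). In the residues, which form an integral
over the arc, the factors of order `e^N` cancel, and the arc integral of the Bead kernel appears
(`circleFactor_mul_lineFactor`, `exists_arcIntegral_sub_le`). What is left is an integral over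
contours that cross at `u₊` and `u₋`. The line integral of `1 / |v - w|` against a decaying
function is at most of order `|cos θ - a|^(-1/2)` (`norm_lineCauchy_le`), which is integrable over
the circle, so the factor `e^(-N (cos θ - a)²)` sends the double integral to zero by dominated
convergence (`exists_norm_doubleIntegral_sub_le`).

*The explicit term.* Before and after the limit it equals, up to a factor tending to `1`, the
function `H^m` smoothed by a Gaussian (`gaussSmooth`), with centers and standard deviations
that differ by `O(1/N)` times the variance. Hence the error is `O(1/N)` uniformly down to
`t' = t`, where the density is singular for `m = 0` and `H^1` is discontinuous
(`exists_gaussSmooth_sub_le`).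

*The other two assertions* follow from the existence of primitives. A function holomorphic off the
origin has a primitive on the slit plane, because `z = e^w` turns it into an entire function
(`exists_primitive_on_slitPlane`); this allows the arc to be replaced by the segment. At equal
times the vertical line through `u₊` and `u₋` carries Boutillier's integrand. For `n ≤ n'` the
segment is used. For `n > n'` the two half-lines complete the arc to an inverse Laplace transform,
whose value is `H^m`: the contour is pushed to the right if `x ≤ x'` and to the left if `x > x'`
(`exists_halfLine_primitive`).
-/

noncomputable section

namespace DysonBead

/-! ### Primitives and contour integrals of functions holomorphic off the origin -/

theorem exists_primitive_of_differentiable {f : ℂ → ℂ} (hf : Differentiable ℂ f) :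
    ∃ F : ℂ → ℂ, ∀ z, HasDerivAt F (f z) z := by
  refine ⟨fun w => Complex.wedgeIntegral 0 w f, fun z => ?_⟩
  have hz : z ∈ Metric.ball (0 : ℂ) (‖z‖ + 1) := by simp
  exact Complex.IsConservativeOn.hasDerivAt_wedgeIntegral hf.continuous.continuousOn hz
    (hf.differentiableOn.isConservativeOn)

/-- Substituting `z = e ^ w` turns `f z dz` into an entire differential. -/
theorem exists_primitive_on_slitPlane {f : ℂ → ℂ} (hf : ∀ z, z ≠ 0 → DifferentiableAt ℂ f z) :
    ∃ F : ℂ → ℂ, ∀ z ∈ Complex.slitPlane, HasDerivAt F (f z) z := by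
  have hd : Differentiable ℂ fun w => f (Complex.exp w) * Complex.exp w := fun w =>
    ((hf _ (Complex.exp_ne_zero w)).comp w Complex.differentiable_exp.differentiableAt).mul
      Complex.differentiable_exp.differentiableAt
  obtain ⟨P, hP⟩ := exists_primitive_of_differentiable hd
  refine ⟨fun z => P (Complex.log z), fun z hz => ?_⟩
  have h0 := Complex.slitPlane_ne_zero hz
  have := (hP (Complex.log z)).comp z (Complex.hasDerivAt_log hz)
  rw [Complex.exp_log h0, mul_assoc, mul_inv_cancel₀ h0, mul_one] at this
  exact this

theorem integral_path_eq_sub {U : Set ℂ} {F f : ℂ → ℂ} (hF : ∀ z ∈ U, HasDerivAt F (f z) z)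
    (hf : ContinuousOn f U) {γ γ' : ℝ → ℂ} {b c : ℝ} (hγ : ∀ t, HasDerivAt γ (γ' t) t)
    (hγ' : Continuous γ') (hU : ∀ t ∈ Set.uIcc b c, γ t ∈ U) :
    ∫ t in b..c, f (γ t) * γ' t = F (γ c) - F (γ b) := by
  have hc : Continuous γ := continuous_iff_continuousAt.2 fun t => (hγ t).continuousAt
  refine intervalIntegral.integral_eq_sub_of_hasDerivAt (f := fun t => F (γ t))
    (fun t ht => ?_) ?_
  · exact (hF _ (hU t ht)).comp t (hγ t)
  · exact ((hf.comp hc.continuousOn hU).mul hγ'.continuousOn).intervalIntegrable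

theorem hasDerivAt_exp_mul_I (θ : ℝ) :
    HasDerivAt (fun t : ℝ => Complex.exp ((t : ℂ) * Complex.I))
      (Complex.I * Complex.exp ((θ : ℂ) * Complex.I)) θ := by
  have h : HasDerivAt (fun t : ℝ => (t : ℂ) * Complex.I) Complex.I θ := by
    simpa using (Complex.ofRealCLM.hasDerivAt (x := θ)).mul_const Complex.I
  simpa [mul_comm] using h.cexp

theorem arcIntegral_eq_sub {a : ℝ} (ha : a ∈ Set.Ioo (-1 : ℝ) 1) {U : Set ℂ} {F f : ℂ → ℂ}
    (hF : ∀ z ∈ U, HasDerivAt F (f z) z) (hf : ContinuousOn f U)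
    (hU : ∀ θ ∈ Set.Icc (-Real.arccos a) (Real.arccos a),
      Complex.exp ((θ : ℂ) * Complex.I) ∈ U) :
    arcIntegral a f = F (uPlus a) - F (uMinus a) := by
  rw [← exp_arccos_mul_I ha, ← exp_neg_arccos_mul_I ha]
  refine integral_path_eq_sub hF hf hasDerivAt_exp_mul_I (by fun_prop) fun t ht => hU t ?_
  rwa [Set.uIcc_of_le (by linarith [Real.arccos_nonneg a])] at ht

theorem segmentIntegral_eq_sub {a : ℝ} {U : Set ℂ} {F f : ℂ → ℂ}
    (hF : ∀ z ∈ U, HasDerivAt F (f z) z) (hf : ContinuousOn f U)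
    (hU : ∀ r : ℝ, uMinus a + (r : ℂ) * (uPlus a - uMinus a) ∈ U) :
    segmentIntegral a f = F (uPlus a) - F (uMinus a) := by
  have h := integral_path_eq_sub hF hf (b := 0) (c := 1)
    (γ := fun r : ℝ => uMinus a + (r : ℂ) * (uPlus a - uMinus a))
    (γ' := fun _ => uPlus a - uMinus a) (fun t => ?_) continuous_const fun t _ => hU t
  · rw [segmentIntegral, h]
    simp
  · simpa using ((Complex.ofRealCLM.hasDerivAt (x := t)).mul_const
      (uPlus a - uMinus a)).const_add (uMinus a)

theorem exp_mul_I_mem_slitPlane {θ : ℝ} (h : |θ| < Real.pi) :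
    Complex.exp ((θ : ℂ) * Complex.I) ∈ Complex.slitPlane := by
  rw [Complex.mem_slitPlane_iff_arg]
  rw [abs_lt] at h
  refine ⟨?_, Complex.exp_ne_zero _⟩
  rw [Complex.arg_exp_mul_I, toIocMod_eq_self _ |>.2 ⟨h.1, by linarith⟩]
  exact h.2.ne

theorem arccos_lt_pi {a : ℝ} (ha : a ∈ Set.Ioo (-1 : ℝ) 1) : Real.arccos a < Real.pi := by
  refine lt_of_le_of_ne (Real.arccos_le_pi a) fun h => ?_
  rw [Real.arccos_eq_pi] at h
  linarith [ha.1]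

theorem arc_subset_slitPlane {a : ℝ} (ha : a ∈ Set.Ioo (-1 : ℝ) 1) {θ : ℝ}
    (hθ : θ ∈ Set.Icc (-Real.arccos a) (Real.arccos a)) :
    Complex.exp ((θ : ℂ) * Complex.I) ∈ Complex.slitPlane :=
  exp_mul_I_mem_slitPlane (lt_of_le_of_lt (abs_le.2 hθ) (arccos_lt_pi ha))

theorem segment_point_eq (a r : ℝ) : uMinus a + (r : ℂ) * (uPlus a - uMinus a) =
    (a : ℂ) + ((2 * r - 1 : ℝ) : ℂ) * (Real.sqrt (1 - a ^ 2) : ℂ) * Complex.I := by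
  simp only [uPlus, uMinus]; push_cast; ring

theorem differentiableAt_beadIntegrand (a : ℝ) (p p' : Point) {u : ℂ}
    (hu : u ≠ 0 ∨ p.1 ≤ p'.1) : DifferentiableAt ℂ (beadIntegrand a p p') u := by
  obtain ⟨n, x, t⟩ := p
  obtain ⟨n', x', t'⟩ := p'
  simp only at hu ⊢
  refine DifferentiableAt.mul ?_ (by fun_prop)
  refine differentiableAt_id.zpow ?_
  rcases hu with hu | hu
  · exact Or.inl hu
  · right; simpa using hu

/-- The arc and the segment have the same end points, and the integrand has a primitive on a
domain containing both: the plane for `n ≤ n'`, the slit plane for `a > 0`. -/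
theorem arcIntegral_eq_segmentIntegral {a : ℝ} (ha : a ∈ Set.Ioo (-1 : ℝ) 1) (p p' : Point)
    (h : 0 < a ∨ p.1 ≤ p'.1) :
    arcIntegral a (beadIntegrand a p p') = segmentIntegral a (beadIntegrand a p p') := by
  rcases h with h | h
  · have hd : ∀ z, z ≠ 0 → DifferentiableAt ℂ (beadIntegrand a p p') z := fun z hz =>
      differentiableAt_beadIntegrand a p p' (Or.inl hz)
    obtain ⟨F, hF⟩ := exists_primitive_on_slitPlane hd
    have hc : ContinuousOn (beadIntegrand a p p') Complex.slitPlane := fun z hz =>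
      (hd z (Complex.slitPlane_ne_zero hz)).continuousAt.continuousWithinAt
    rw [arcIntegral_eq_sub ha hF hc fun θ hθ => arc_subset_slitPlane ha hθ,
      segmentIntegral_eq_sub hF hc fun r => ?_]
    rw [segment_point_eq]
    left
    simpa using h
  · have hd : Differentiable ℂ (beadIntegrand a p p') := fun z =>
      differentiableAt_beadIntegrand a p p' (Or.inr h)
    obtain ⟨F, hF⟩ := exists_primitive_of_differentiable hd
    rw [arcIntegral_eq_sub ha (U := Set.univ) (fun z _ => hF z) hd.continuous.continuousOn (by simp),
      segmentIntegral_eq_sub (U := Set.univ) (fun z _ => hF z) hd.continuous.continuousOn (by simp)]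

/-! ### Boutillier's kernel -/

theorem norm_zpow_le_zpow {k : ℤ} (hk : k ≤ 0) {T : ℝ} (hT : 0 < T) {z : ℂ} (hz : T ≤ ‖z‖) :
    ‖z ^ k‖ ≤ T ^ k := by
  obtain ⟨m, rfl⟩ : ∃ m : ℕ, k = -(m : ℤ) := ⟨k.natAbs, by omega⟩
  rw [norm_zpow, zpow_neg, zpow_neg, zpow_natCast, zpow_natCast]
  gcongr

/-- A primitive of `u ^ k e ^ (ξ u)` on the slit plane has asymptotically equal values at the two
ends of a vertical line, because the contour can be pushed to the right: the increment along the
horizontal lines to `T ± i T` and the vertical line between these points tends to zero. -/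
theorem tendsto_primitive_sub {k : ℤ} {ξ : ℝ} (h : (ξ < 0 ∧ k ≤ -1) ∨ (ξ = 0 ∧ k ≤ -2))
    {F : ℂ → ℂ} (hF : ∀ z ∈ Complex.slitPlane, HasDerivAt F (z ^ k * Complex.exp (z * ξ)) z)
    (a : ℝ) :
    Tendsto (fun T : ℝ => F (a + T * Complex.I) - F (a - T * Complex.I)) atTop (𝓝 0) := by
  have hk : k ≤ 0 := by omega
  have hcont : ContinuousOn (fun z : ℂ => z ^ k * Complex.exp (z * ξ)) Complex.slitPlane := by
    intro z hz
    have h0 := Complex.slitPlane_ne_zero hz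
    exact ((continuousAt_zpow₀ z k (Or.inl h0)).mul (by fun_prop)).continuousWithinAt
  have hdx : ∀ c : ℂ, ∀ t : ℝ, HasDerivAt (fun r : ℝ => (r : ℂ) + c) 1 t := fun c t => by
    simpa using (Complex.ofRealCLM.hasDerivAt (x := t)).add_const c
  have hdy : ∀ c : ℂ, ∀ t : ℝ, HasDerivAt (fun r : ℝ => c + (r : ℂ) * Complex.I) Complex.I t :=
    fun c t => by
      simpa using ((Complex.ofRealCLM.hasDerivAt (x := t)).mul_const Complex.I).const_add c
  have hor : ∀ T s : ℝ, 0 < T → |s| = T → F (T + s * Complex.I) - F (a + s * Complex.I) =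
      ∫ r in a..T, ((r : ℂ) + s * Complex.I) ^ k * Complex.exp (((r : ℂ) + s * Complex.I) * ξ) := by
    intro T s hT hs
    have := integral_path_eq_sub hF hcont (b := a) (c := T) (hdx (s * Complex.I))
      continuous_const (fun t _ => by
        right
        have : s ≠ 0 := by rintro rfl; simp at hs; linarith
        simpa using this)
    simpa using this.symm
  have ver : ∀ T : ℝ, 0 < T → F (T + T * Complex.I) - F (T - T * Complex.I) =
      ∫ r in (-T)..T, (((T : ℂ) + r * Complex.I) ^ k *
        Complex.exp (((T : ℂ) + r * Complex.I) * ξ)) * Complex.I := by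
    intro T hT
    have := integral_path_eq_sub hF hcont (b := -T) (c := T) (hdy (T : ℂ))
      continuous_const (fun t _ => by
        left
        simpa using hT)
    rw [this]
    push_cast
    ring_nf
  have hdec : ∀ T : ℝ, F (a + T * Complex.I) - F (a - T * Complex.I) =
      -(F (T + T * Complex.I) - F (a + T * Complex.I)) + (F (T + T * Complex.I) - F (T - T * Complex.I))
        + (F (T + (-T : ℝ) * Complex.I) - F (a + (-T : ℝ) * Complex.I)) := by
    intro T; push_cast; ring_nf
  have hexp : ∀ r s : ℝ, ‖Complex.exp (((r : ℂ) + s * Complex.I) * ξ)‖ = Real.exp (ξ * r) := by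
    intro r s
    rw [Complex.norm_exp]
    simp [mul_comm]
  have hhn : ∀ r s : ℝ, |s| ≤ ‖(r : ℂ) + s * Complex.I‖ := by
    intro r s
    simpa using Complex.abs_im_le_norm ((r : ℂ) + s * Complex.I)
  have hvn : ∀ r s : ℝ, |r| ≤ ‖(r : ℂ) + s * Complex.I‖ := by
    intro r s
    simpa using Complex.abs_re_le_norm ((r : ℂ) + s * Complex.I)
  have hpt1 : ∀ T r s : ℝ, 0 < T → |s| = T →
      ‖((r : ℂ) + s * Complex.I) ^ k * Complex.exp (((r : ℂ) + s * Complex.I) * ξ)‖ ≤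
        T ^ k * Real.exp (ξ * r) := by
    intro T r s hT hs
    rw [norm_mul, hexp]
    gcongr
    exact norm_zpow_le_zpow hk hT (hs ▸ hhn r s)
  have hpt2 : ∀ T r : ℝ, 0 < T →
      ‖(((T : ℂ) + r * Complex.I) ^ k * Complex.exp (((T : ℂ) + r * Complex.I) * ξ)) *
        Complex.I‖ ≤ T ^ k * Real.exp (ξ * T) := by
    intro T r hT
    rw [norm_mul, norm_mul, hexp, Complex.norm_I, mul_one]
    gcongr
    exact norm_zpow_le_zpow hk hT (by simpa [abs_of_pos hT] using hvn T r)
  have hver : ∀ T : ℝ, 1 ≤ T → ‖F (T + T * Complex.I) - F (T - T * Complex.I)‖ ≤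
      T ^ k * Real.exp (ξ * T) * (2 * T) := by
    intro T hT
    rw [ver T (by linarith)]
    refine (intervalIntegral.norm_integral_le_of_norm_le_const
      (fun r _ => hpt2 T r (by linarith))).trans (le_of_eq ?_)
    rw [abs_of_pos (by linarith)]; ring
  have hh : ∀ T s : ℝ, 1 ≤ T → a ≤ T → |s| = T →
      ‖F (T + s * Complex.I) - F (a + s * Complex.I)‖ ≤
        ∫ r in a..T, T ^ k * Real.exp (ξ * r) := by
    intro T s hT haT hs
    rw [hor T s (by linarith) hs]
    refine intervalIntegral.norm_integral_le_of_norm_le haT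
      (MeasureTheory.ae_of_all _ fun r _ => hpt1 T r s (by linarith) hs) ?_
    exact (by fun_prop : Continuous fun r : ℝ => T ^ k * Real.exp (ξ * r)).intervalIntegrable _ _
  have hbound : ∀ T : ℝ, 1 ≤ T → a ≤ T → ‖F (a + T * Complex.I) - F (a - T * Complex.I)‖ ≤
      2 * (∫ r in a..T, T ^ k * Real.exp (ξ * r)) + T ^ k * Real.exp (ξ * T) * (2 * T) := by
    intro T hT haT
    rw [hdec]
    have h1 := hh T T hT haT (abs_of_pos (by linarith))
    have h2 := hh T (-T) hT haT (by rw [abs_neg, abs_of_pos (by linarith)])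
    have h3 := hver T hT
    refine (norm_add₃_le).trans ?_
    rw [norm_neg]
    linarith
  have hev : ∀ᶠ T : ℝ in atTop, 1 ≤ T ∧ a ≤ T :=
    (eventually_ge_atTop 1).and (eventually_ge_atTop a)
  rcases h with ⟨hξ, hk1⟩ | ⟨rfl, hk2⟩
  · have lim : Tendsto (fun T : ℝ => 2 * (T⁻¹ * (Real.exp (ξ * a) / (-ξ))) +
        2 * Real.exp (ξ * T)) atTop (𝓝 0) := by
      have l1 : Tendsto (fun T : ℝ => Real.exp (ξ * T)) atTop (𝓝 0) :=
        Real.tendsto_exp_atBot.comp (tendsto_id.const_mul_atTop_of_neg hξ)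
      have := ((tendsto_inv_atTop_zero (𝕜 := ℝ)).mul_const (Real.exp (ξ * a) / (-ξ))).const_mul 2
        |>.add (l1.const_mul 2)
      simpa using this
    refine squeeze_zero_norm' ?_ lim
    filter_upwards [hev] with T ⟨hT, haT⟩
    refine (hbound T hT haT).trans ?_
    have hTk : T ^ k ≤ T⁻¹ := by
      rw [← zpow_neg_one]; exact zpow_le_zpow_right₀ hT hk1
    have hint : ∫ r in a..T, T ^ k * Real.exp (ξ * r) ≤ T⁻¹ * (Real.exp (ξ * a) / (-ξ)) := by
      have he : ∫ r in a..T, Real.exp (ξ * r) = (Real.exp (ξ * T) - Real.exp (ξ * a)) / ξ := by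
        rw [intervalIntegral.integral_comp_mul_left (fun r => Real.exp r) hξ.ne, integral_exp]
        simp [div_eq_inv_mul]
      rw [intervalIntegral.integral_const_mul, he]
      have hne : (Real.exp (ξ * T) - Real.exp (ξ * a)) / ξ ≤ Real.exp (ξ * a) / (-ξ) := by
        rw [div_neg, ← neg_div]
        exact div_le_div_of_nonpos_of_le hξ.le (by linarith [Real.exp_pos (ξ * T)])
      have : 0 ≤ (Real.exp (ξ * T) - Real.exp (ξ * a)) / ξ := by
        apply div_nonneg_of_nonpos _ hξ.le
        have : Real.exp (ξ * T) ≤ Real.exp (ξ * a) := Real.exp_le_exp.2 (by nlinarith)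
        linarith
      exact mul_le_mul hTk hne this (by positivity)
    have hv : T ^ k * Real.exp (ξ * T) * (2 * T) ≤ 2 * Real.exp (ξ * T) := by
      calc T ^ k * Real.exp (ξ * T) * (2 * T) ≤ T⁻¹ * Real.exp (ξ * T) * (2 * T) := by gcongr
        _ = 2 * Real.exp (ξ * T) := by field_simp
    linarith
  · have lim : Tendsto (fun T : ℝ => 2 * ((1 + |a|) * T⁻¹) + 2 * T⁻¹) atTop (𝓝 0) := by
      have := (((tendsto_inv_atTop_zero (𝕜 := ℝ)).const_mul (1 + |a|)).const_mul 2).add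
        ((tendsto_inv_atTop_zero (𝕜 := ℝ)).const_mul 2)
      simpa using this
    refine squeeze_zero_norm' ?_ lim
    filter_upwards [hev] with T ⟨hT, haT⟩
    refine (hbound T hT haT).trans ?_
    have hTk : T ^ k ≤ T⁻¹ * T⁻¹ := by
      have : T⁻¹ * T⁻¹ = T ^ (-2 : ℤ) := by
        rw [zpow_neg, ← mul_inv]; norm_cast; rw [sq]
      rw [this]; exact zpow_le_zpow_right₀ hT hk2
    have hTk0 : 0 ≤ T ^ k := by positivity
    have hTT : T⁻¹ * T = 1 := inv_mul_cancel₀ (by linarith)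
    have hTi : 0 < T⁻¹ := by positivity
    simp only [zero_mul, Real.exp_zero, mul_one, intervalIntegral.integral_const, smul_eq_mul]
    have h1 : (T - a) * T ^ k ≤ (1 + |a|) * T⁻¹ := by
      calc (T - a) * T ^ k ≤ (T + |a| * T) * (T⁻¹ * T⁻¹) := by
            gcongr
            nlinarith [neg_abs_le a, abs_nonneg a]
        _ = (1 + |a|) * T⁻¹ * (T⁻¹ * T) := by ring
        _ = _ := by rw [hTT, mul_one]
    have h2 : T ^ k * (2 * T) ≤ 2 * T⁻¹ := by
      calc T ^ k * (2 * T) ≤ T⁻¹ * T⁻¹ * (2 * T) := by gcongr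
        _ = 2 * T⁻¹ * (T⁻¹ * T) := by ring
        _ = _ := by rw [hTT, mul_one]
    linarith

theorem circleIntegral_eq_integral_exp (f : ℂ → ℂ) (c : ℝ) :
    circleIntegral f 0 1 = ∫ θ in c..(c + 2 * Real.pi),
      f (Complex.exp ((θ : ℂ) * Complex.I)) * (Complex.I * Complex.exp ((θ : ℂ) * Complex.I)) := by
  have hp : Function.Periodic (fun θ : ℝ => f (Complex.exp ((θ : ℂ) * Complex.I)) *
      (Complex.I * Complex.exp ((θ : ℂ) * Complex.I))) (2 * Real.pi) := by
    intro θ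
    have : Complex.exp (((θ + 2 * Real.pi : ℝ) : ℂ) * Complex.I) =
        Complex.exp ((θ : ℂ) * Complex.I) := by
      push_cast
      rw [add_mul, Complex.exp_periodic]
    simp only [this]
  rw [hp.intervalIntegral_add_eq c 0, zero_add, circleIntegral]
  refine intervalIntegral.integral_congr fun θ _ => ?_
  simp only [deriv_circleMap, circleMap, Complex.ofReal_one, one_mul, zero_add, smul_eq_mul]
  ring

/-- The Taylor coefficient of `e ^ (ξ u)`, as a residue. -/
theorem circleIntegral_zpow_mul_exp (j : ℕ) (ξ : ℝ) :
    circleIntegral (fun u : ℂ => u ^ (-((j : ℤ) + 1)) * Complex.exp (u * ξ)) 0 1 =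
      2 * Real.pi * Complex.I * ((ξ ^ j / (Nat.factorial j : ℝ) : ℝ) : ℂ) := by
  have hd : DifferentiableOn ℂ (fun u : ℂ => Complex.exp (u * ξ)) (Metric.closedBall 0 1) := by
    fun_prop
  have h := hd.circleIntegral_one_div_sub_center_pow_smul (by norm_num) j
  have hi : iteratedDeriv j (fun u : ℂ => Complex.exp (u * ξ)) 0 = (ξ : ℂ) ^ j := by
    have : (fun u : ℂ => Complex.exp (u * ξ)) = fun u : ℂ => Complex.exp ((ξ : ℂ) * u) := by
      funext u; rw [mul_comm]
    rw [this, iteratedDeriv_cexp_const_mul]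
    simp
  rw [hi] at h
  have he : (fun u : ℂ => u ^ (-((j : ℤ) + 1)) * Complex.exp (u * ξ)) =
      fun u : ℂ => (1 / (u - 0) ^ (j + 1)) • Complex.exp (u * ξ) := by
    funext u
    rw [sub_zero, zpow_neg, one_div, smul_eq_mul]
    norm_cast
  rw [he, h, smul_eq_mul]
  push_cast
  ring

theorem arcIntegral_add_leftArc {a : ℝ} {f : ℂ → ℂ} (hf : ContinuousOn f {0}ᶜ) :
    arcIntegral a f + (∫ θ in (Real.arccos a)..(2 * Real.pi - Real.arccos a),
      f (Complex.exp ((θ : ℂ) * Complex.I)) * (Complex.I * Complex.exp ((θ : ℂ) * Complex.I))) =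
      circleIntegral f 0 1 := by
  have hc : Continuous fun θ : ℝ => f (Complex.exp ((θ : ℂ) * Complex.I)) *
      (Complex.I * Complex.exp ((θ : ℂ) * Complex.I)) := by
    refine Continuous.mul ?_ (by fun_prop)
    exact hf.comp_continuous (by fun_prop) fun θ => by simp [Complex.exp_ne_zero]
  rw [arcIntegral, intervalIntegral.integral_add_adjacent_intervals
    (hc.intervalIntegrable _ _) (hc.intervalIntegrable _ _),
    circleIntegral_eq_integral_exp f (-Real.arccos a)]
  congr 1
  ring

/-- Inverse Laplace transform of a negative power, with the contour bent along the arc of the unit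
circle from `u₋` through `1` to `u₊`: there is an antiderivative along the two vertical half-lines
from `u₊` and `u₋` whose increment over them accounts for the difference between the arc integral
and the residue `H^m(ξ)`. For `ξ ≤ 0` the contour is pushed to the right, for `ξ > 0` to the
left, where the residue at the origin is collected. -/
theorem exists_halfLine_primitive {a : ℝ} (ha : a ∈ Set.Ioo (-1 : ℝ) 1) {m : ℕ} (hm : 1 ≤ m)
    {ξ : ℝ} (hξ : m = 1 → ξ ≠ 0) :
    ∃ G : ℂ → ℂ, (∀ z : ℂ, z.im ≠ 0 → HasDerivAt G (z ^ (-(m : ℤ)) * Complex.exp (z * ξ)) z) ∧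
      G (uPlus a) - G (uMinus a) = arcIntegral a (fun z => z ^ (-(m : ℤ)) * Complex.exp (z * ξ)) -
        2 * Real.pi * Complex.I * (deltaAntideriv m ξ : ℂ) ∧
      Tendsto (fun T : ℝ => G (a + T * Complex.I) - G (a - T * Complex.I)) atTop (𝓝 0) := by
  obtain ⟨j, rfl⟩ : ∃ j, m = j + 1 := ⟨m - 1, by omega⟩
  have hd : ∀ η : ℝ, ∀ z : ℂ, z ≠ 0 →
      DifferentiableAt ℂ (fun z : ℂ => z ^ (-((j + 1 : ℕ) : ℤ)) * Complex.exp (z * η)) z :=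
    fun η z hz => (differentiableAt_id.zpow (Or.inl hz)).mul (by fun_prop)
  have hc : ∀ η : ℝ, ContinuousOn
      (fun z : ℂ => z ^ (-((j + 1 : ℕ) : ℤ)) * Complex.exp (z * η)) {0}ᶜ := fun η z hz =>
    (hd η z hz).continuousAt.continuousWithinAt
  have hslit : Complex.slitPlane ⊆ {0}ᶜ := fun z hz => Complex.slitPlane_ne_zero hz
  rcases le_or_gt ξ 0 with h0 | h0
  · obtain ⟨F, hF⟩ := exists_primitive_on_slitPlane (hd ξ)
    refine ⟨F, fun z hz => hF z (Or.inr hz), ?_, tendsto_primitive_sub ?_ hF a⟩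
    · rw [arcIntegral_eq_sub ha hF ((hc ξ).mono hslit) fun θ hθ => arc_subset_slitPlane ha hθ]
      have : deltaAntideriv (j + 1) ξ = 0 := by
        simp only [deltaAntideriv]
        split_ifs with h
        · have hz : ξ = 0 := le_antisymm h0 h
          have hj : j ≠ 0 := fun hj => hξ (by omega) hz
          simp [hz, hj]
        · rfl
      simp [this]
    · rcases h0.lt_or_eq with h | h
      · left; exact ⟨h, by omega⟩
      · right; exact ⟨h, by have : j ≠ 0 := fun hj => hξ (by omega) h
                            omega⟩
  · obtain ⟨F, hF⟩ := exists_primitive_on_slitPlane (hd (-ξ))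
    set s : ℂ := (-1 : ℂ) ^ j with hs
    have hss : s * s = 1 := by rw [hs, ← mul_pow]; simp
    have hG : ∀ z : ℂ, -z ∈ Complex.slitPlane → HasDerivAt (fun z => s * F (-z))
        (z ^ (-((j + 1 : ℕ) : ℤ)) * Complex.exp (z * ξ)) z := by
      intro z hz
      have h1 := ((hF (-z) hz).comp z (hasDerivAt_neg z)).const_mul s
      convert! h1 using 1
      have h2 : (-z) ^ (-((j + 1 : ℕ) : ℤ)) = -s * z ^ (-((j + 1 : ℕ) : ℤ)) := by
        rw [zpow_neg, zpow_neg, zpow_natCast, zpow_natCast, neg_pow z, mul_inv, pow_succ,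
          mul_neg_one, ← hs, inv_neg, inv_eq_of_mul_eq_one_left hss]
      rw [h2]
      have h3 : -z * ((-ξ : ℝ) : ℂ) = z * ξ := by push_cast; ring
      rw [h3]
      linear_combination (-(z ^ (-((j + 1 : ℕ) : ℤ)) * Complex.exp (z * ξ))) * hss
    refine ⟨fun z => s * F (-z), fun z hz => hG z (Or.inr (by simpa using hz)), ?_, ?_⟩
    · have hpath := integral_path_eq_sub (U := {z | -z ∈ Complex.slitPlane}) hG
        ((hc ξ).mono fun z hz => by simpa using Complex.slitPlane_ne_zero hz)
        (b := Real.arccos a) (c := 2 * Real.pi - Real.arccos a)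
        hasDerivAt_exp_mul_I (by fun_prop) (fun t ht => by
          have hα := arccos_lt_pi ha
          have hα0 : 0 < Real.arccos a := Real.arccos_pos.2 ha.2
          rw [Set.uIcc_of_le (by linarith)] at ht
          have : -Complex.exp ((t : ℂ) * Complex.I) =
              Complex.exp (((t - Real.pi : ℝ) : ℂ) * Complex.I) := by
            push_cast
            rw [sub_mul, Complex.exp_sub, Complex.exp_pi_mul_I]
            ring
          rw [Set.mem_ofPred_eq, this]
          apply exp_mul_I_mem_slitPlane
          rw [abs_lt]
          constructor <;> linarith [ht.1, ht.2])
      have hend : Complex.exp (((2 * Real.pi - Real.arccos a : ℝ) : ℂ) * Complex.I) =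
          uMinus a := by
        rw [← exp_neg_arccos_mul_I ha]
        push_cast
        rw [sub_mul, Complex.exp_sub, Complex.exp_two_pi_mul_I, neg_mul, Complex.exp_neg, one_div]
      rw [hend, exp_arccos_mul_I ha] at hpath
      have hsum := arcIntegral_add_leftArc (a := a) (hc ξ)
      rw [hpath] at hsum
      have hres := circleIntegral_zpow_mul_exp j ξ
      have hH : deltaAntideriv (j + 1) ξ = ξ ^ j / (Nat.factorial j : ℝ) := by
        simp [deltaAntideriv, h0.le]
      rw [hH, ← hres]
      push_cast at hsum ⊢
      linear_combination -hsum
    · have h1 := (tendsto_primitive_sub (Or.inl ⟨by linarith, by omega⟩) hF (-a)).const_mul (-s)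
      rw [mul_zero] at h1
      refine h1.congr fun T => ?_
      push_cast
      ring_nf

theorem beadIntegrand_equal_times (a : ℝ) (n n' : ℕ) (x x' t : ℝ) :
    beadIntegrand a (n, x, t) (n', x', t) =
      fun u => u ^ ((n' : ℤ) - n) * Complex.exp (u * ((x - x' : ℝ) : ℂ)) := by
  funext u
  simp [beadIntegrand]

/-- On the vertical line through `u₊` and `u₋` the integrand is the one of Boutillier's kernel. -/
theorem integrand_on_line (a b ξ φ : ℝ) (k : ℤ) :
    (((a : ℂ) + (φ : ℂ) * (b : ℂ) * Complex.I) ^ k *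
      Complex.exp (((a : ℂ) + (φ : ℂ) * (b : ℂ) * Complex.I) * ξ)) * (b * Complex.I) =
    (b * Complex.I * Complex.exp (a * ξ)) *
      (((a : ℂ) + (φ : ℂ) * (b : ℂ) * Complex.I) ^ k *
        Complex.exp ((φ : ℂ) * ((b * ξ : ℝ) : ℂ) * Complex.I)) := by
  rw [add_mul, Complex.exp_add]
  push_cast
  ring_nf

theorem boutillier_of_nonneg {a : ℝ} (ha : a ∈ Set.Ioo (-1 : ℝ) 1) {n n' : ℕ} (h : n ≤ n')
    (x x' t : ℝ) :
    beadKernel a (n, x, t) (n', x', t) =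
      ((Real.sqrt (1 - a ^ 2) * Real.exp (a * (x - x')) : ℝ) : ℂ) *
        (1 / (2 * (Real.pi : ℂ)) * ∫ φ in (-1 : ℝ)..1,
          ((a : ℂ) + (φ : ℂ) * (Real.sqrt (1 - a ^ 2) : ℂ) * Complex.I) ^ ((n' : ℤ) - n) *
            Complex.exp ((φ : ℂ) * ((Real.sqrt (1 - a ^ 2) * (x - x') : ℝ) : ℂ) * Complex.I)) := by
  have hphi : beadPhi a (n, x, t) (n', x', t) = 0 := by
    have : ¬ Precedes (n, x, t) (n', x', t) := by
      simp [Precedes]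
      omega
    simp [beadPhi, this]
  rw [beadKernel, hphi, arcIntegral_eq_segmentIntegral ha _ _ (Or.inr h),
    beadIntegrand_equal_times]
  set b := Real.sqrt (1 - a ^ 2) with hb
  set g : ℝ → ℂ := fun φ => ((a : ℂ) + (φ : ℂ) * (b : ℂ) * Complex.I) ^ ((n' : ℤ) - n) *
    Complex.exp ((φ : ℂ) * ((b * (x - x') : ℝ) : ℂ) * Complex.I) with hg
  have hseg : segmentIntegral a
      (fun u => u ^ ((n' : ℤ) - n) * Complex.exp (u * ((x - x' : ℝ) : ℂ))) =
      (b * Complex.I * Complex.exp (a * ((x - x' : ℝ) : ℂ))) * ∫ φ in (-1 : ℝ)..1, g φ := by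
    have hpt : ∀ r : ℝ, ((uMinus a + (r : ℂ) * (uPlus a - uMinus a)) ^ ((n' : ℤ) - n) *
        Complex.exp ((uMinus a + (r : ℂ) * (uPlus a - uMinus a)) * ((x - x' : ℝ) : ℂ))) *
        (uPlus a - uMinus a) =
        (b * Complex.I * Complex.exp (a * ((x - x' : ℝ) : ℂ))) * (2 * g (2 * r - 1)) := by
      intro r
      have hdiff : uPlus a - uMinus a = 2 * (b * Complex.I) := by
        simp only [uPlus, uMinus]; ring
      have := integrand_on_line a b (x - x') (2 * r - 1) ((n' : ℤ) - n)
      rw [segment_point_eq, hdiff, ← hb]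
      simp only [hg]
      linear_combination 2 * this
    rw [segmentIntegral]
    simp only [hpt]
    rw [intervalIntegral.integral_const_mul, intervalIntegral.integral_const_mul,
      intervalIntegral.integral_comp_mul_sub g (two_ne_zero)]
    norm_num
    left
    ring
  rw [hseg]
  have hI := Complex.I_ne_zero
  have hpi : (Real.pi : ℂ) ≠ 0 := by exact_mod_cast Real.pi_ne_zero
  push_cast
  field_simp
  ring

theorem boutillier_of_neg {a : ℝ} (ha : a ∈ Set.Ioo (-1 : ℝ) 1) {n n' : ℕ} (h : n' < n)
    (x x' t : ℝ) (hx : n = n' + 1 → x ≠ x') :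
    Tendsto (fun R : ℝ => -(1 / (2 * (Real.pi : ℂ))) *
      ((∫ φ in (-R)..(-1),
        ((a : ℂ) + (φ : ℂ) * (Real.sqrt (1 - a ^ 2) : ℂ) * Complex.I) ^ ((n' : ℤ) - n) *
          Complex.exp ((φ : ℂ) * ((Real.sqrt (1 - a ^ 2) * (x - x') : ℝ) : ℂ) * Complex.I)) +
      ∫ φ in (1 : ℝ)..R,
        ((a : ℂ) + (φ : ℂ) * (Real.sqrt (1 - a ^ 2) : ℂ) * Complex.I) ^ ((n' : ℤ) - n) *
          Complex.exp ((φ : ℂ) * ((Real.sqrt (1 - a ^ 2) * (x - x') : ℝ) : ℂ) * Complex.I)))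
      atTop (𝓝 (beadKernel a (n, x, t) (n', x', t) /
        ((Real.sqrt (1 - a ^ 2) * Real.exp (a * (x - x')) : ℝ) : ℂ))) := by
  have hb0 : 0 < Real.sqrt (1 - a ^ 2) := Real.sqrt_pos.2 (by nlinarith [ha.1, ha.2])
  obtain ⟨m, rfl⟩ : ∃ m, n = n' + m := ⟨n - n', by omega⟩
  obtain ⟨G, hG, hend, hlim⟩ := exists_halfLine_primitive ha (m := m) (ξ := x - x')
    (by omega) (fun hm => sub_ne_zero.2 (hx (by omega)))
  have hphi : beadPhi a (n' + m, x, t) (n', x', t) = deltaAntideriv m (x - x') := by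
    have : Precedes (n' + m, x, t) (n', x', t) := Or.inl h
    simp [beadPhi, this, smoothedH]
  have hk : (n' : ℤ) - ((n' + m : ℕ) : ℤ) = -(m : ℤ) := by push_cast; ring
  rw [beadKernel, hphi, beadIntegrand_equal_times, hk]
  set b := Real.sqrt (1 - a ^ 2) with hb
  set κ : ℂ := b * Complex.I * Complex.exp (a * ((x - x' : ℝ) : ℂ)) with hκ
  have hbc : (b : ℂ) ≠ 0 := by exact_mod_cast hb0.ne'
  have hκ0 : κ ≠ 0 := by
    simp [hκ, hb0.ne', Complex.exp_ne_zero]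
  have hline : ∀ c d : ℝ, (0 < c ∧ 0 < d ∨ c < 0 ∧ d < 0) → κ * (∫ φ in c..d,
      ((a : ℂ) + (φ : ℂ) * (b : ℂ) * Complex.I) ^ (-(m : ℤ)) *
        Complex.exp ((φ : ℂ) * ((b * (x - x') : ℝ) : ℂ) * Complex.I)) =
      G ((a : ℂ) + (d : ℂ) * (b : ℂ) * Complex.I) - G ((a : ℂ) + (c : ℂ) * (b : ℂ) * Complex.I) := by
    intro c d hcd
    rw [← intervalIntegral.integral_const_mul]
    simp only [hκ, ← integrand_on_line]
    refine integral_path_eq_sub (U := {z : ℂ | z.im ≠ 0})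
      (F := G) (f := fun z => z ^ (-(m : ℤ)) * Complex.exp (z * ((x - x' : ℝ) : ℂ)))
      (γ := fun φ : ℝ => (a : ℂ) + (φ : ℂ) * (b : ℂ) * Complex.I)
      (γ' := fun _ => b * Complex.I) hG ?_ ?_ continuous_const ?_
    · intro z hz
      have h0 : z ≠ 0 := by rintro rfl; exact hz rfl
      exact ((continuousAt_zpow₀ z _ (Or.inl h0)).mul (by fun_prop)).continuousWithinAt
    · intro t
      simpa using (((Complex.ofRealCLM.hasDerivAt (x := t)).mul_const (b : ℂ)).mul_const
        Complex.I).const_add (a : ℂ)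
    · intro t ht
      have ht0 : t ≠ 0 := by
        rintro rfl
        rw [Set.mem_uIcc] at ht
        rcases hcd with h | h <;> rcases ht with ht | ht <;> linarith [h.1, h.2, ht.1, ht.2]
      simp [ht0, hb0.ne']
  have hlim' : Tendsto (fun R : ℝ => -(1 / (2 * (Real.pi : ℂ))) * (κ⁻¹ *
      ((G (a + ((R * b : ℝ) : ℂ) * Complex.I) - G (a - ((R * b : ℝ) : ℂ) * Complex.I)) -
        (G (uPlus a) - G (uMinus a))))) atTop
      (𝓝 (-(1 / (2 * (Real.pi : ℂ))) * (κ⁻¹ * (0 - (G (uPlus a) - G (uMinus a)))))) :=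
    (((hlim.comp (tendsto_id.atTop_mul_const hb0)).sub_const _).const_mul _).const_mul _
  have hval : -(1 / (2 * (Real.pi : ℂ))) * (κ⁻¹ * (0 - (G (uPlus a) - G (uMinus a)))) =
      (-(deltaAntideriv m (x - x') : ℂ) + 1 / (2 * (Real.pi : ℂ) * Complex.I) *
        arcIntegral a (fun u => u ^ (-(m : ℤ)) * Complex.exp (u * ((x - x' : ℝ) : ℂ)))) /
        ((b * Real.exp (a * (x - x')) : ℝ) : ℂ) := by
    rw [hend, hκ]
    have hI := Complex.I_ne_zero
    have hpi : (Real.pi : ℂ) ≠ 0 := by exact_mod_cast Real.pi_ne_zero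
    have he := Complex.exp_ne_zero (a * ((x - x' : ℝ) : ℂ))
    push_cast at he ⊢
    field_simp
    ring
  rw [← hval]
  refine hlim'.congr' ?_
  filter_upwards [eventually_gt_atTop 0] with R hR
  congr 1
  rw [inv_mul_eq_iff_eq_mul₀ hκ0, mul_add, hline (-R) (-1) (Or.inr ⟨by linarith, by norm_num⟩),
    hline 1 R (Or.inl ⟨one_pos, hR⟩)]
  simp only [uPlus, uMinus, ← hb]
  push_cast
  ring_nf

theorem beadKernel_eq_boutillier {a : ℝ} (ha : a ∈ Set.Ioo (-1 : ℝ) 1) (n n' : ℕ) (x x' t : ℝ)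
    (hx : n = n' + 1 → x ≠ x') :
    ∃ J : ℂ, IsBoutillierValue a ((n' : ℤ) - (n : ℤ)) (Real.sqrt (1 - a ^ 2) * (x - x')) J ∧
      beadKernel a (n, x, t) (n', x', t) =
        ((Real.sqrt (1 - a ^ 2) * Real.exp (a * (x - x')) : ℝ) : ℂ) * J := by
  rcases le_or_gt n n' with h | h
  · refine ⟨_, ?_, boutillier_of_nonneg ha h x x' t⟩
    have hk : (0 : ℤ) ≤ (n' : ℤ) - n := by omega
    simp only [IsBoutillierValue, hk, if_true]
  · refine ⟨_, ?_, (mul_div_cancel₀ _ ?_).symm⟩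
    · have hk : ¬ (0 : ℤ) ≤ (n' : ℤ) - n := by omega
      simp only [IsBoutillierValue, hk, if_false]
      exact boutillier_of_neg ha h x x' t hx
    · have hb0 : 0 < Real.sqrt (1 - a ^ 2) := Real.sqrt_pos.2 (by nlinarith [ha.1, ha.2])
      exact_mod_cast (by positivity : Real.sqrt (1 - a ^ 2) * Real.exp (a * (x - x')) ≠ 0)

/-! ### Cauchy integrals along vertical lines -/

/-- An entire function that decays along vertical lines like `1 / (1 + (Im v)²)`, uniformly in
every vertical strip of finite width. -/
structure VerticalDecay (F : ℂ → ℂ) : Prop where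
  differentiable : Differentiable ℂ F
  bound : ∀ K : ℝ, ∃ C : ℝ, ∀ v : ℂ, |v.re| ≤ K → ‖F v‖ ≤ C * (1 + v.im ^ 2)⁻¹

/-- The Cauchy integral `∫ F(v) / (v - w) dy` of `F` along the vertical line `v = c + i y`. -/
def lineCauchy (F : ℂ → ℂ) (c : ℝ) (w : ℂ) : ℂ :=
  ∫ y : ℝ, F ((c : ℂ) + y * Complex.I) / ((c : ℂ) + y * Complex.I - w)

theorem tendsto_vertical_sub {G : ℂ → ℂ} {α β : ℝ}
    (hd : ∀ v : ℂ, v.re ∈ Set.uIcc α β → DifferentiableAt ℂ G v) {C T₀ : ℝ}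
    (hb : ∀ v : ℂ, v.re ∈ Set.uIcc α β → T₀ ≤ |v.im| → ‖G v‖ ≤ C / |v.im|) :
    Tendsto (fun T : ℝ => (∫ y in (-T)..T, G ((β : ℂ) + y * Complex.I)) -
      ∫ y in (-T)..T, G ((α : ℂ) + y * Complex.I)) atTop (𝓝 0) := by
  have key : ∀ T : ℝ, Complex.I * ((∫ y in (-T)..T, G ((β : ℂ) + y * Complex.I)) -
      ∫ y in (-T)..T, G ((α : ℂ) + y * Complex.I)) =
      (∫ x in α..β, G ((x : ℂ) + T * Complex.I)) -
        ∫ x in α..β, G ((x : ℂ) + ((-T : ℝ) : ℂ) * Complex.I) := by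
    intro T
    have h := Complex.integral_boundary_rect_eq_zero_of_differentiableOn G
      ⟨α, -T⟩ ⟨β, T⟩ (fun v hv => (hd v hv.1).differentiableWithinAt)
    simp only [smul_eq_mul] at h
    linear_combination h
  have hh : ∀ s : ℝ, ∀ T : ℝ, |s| = T → 0 < T → T₀ ≤ T →
      ‖∫ x in α..β, G ((x : ℂ) + s * Complex.I)‖ ≤ C / T * |β - α| := by
    intro s T hs hT hT0
    refine intervalIntegral.norm_integral_le_of_norm_le_const fun x hx => ?_
    have := hb ((x : ℂ) + s * Complex.I) (by simpa using Set.uIoc_subset_uIcc hx)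
      (by simpa [hs] using hT0)
    simpa [hs] using this
  have lim : Tendsto (fun T : ℝ => 2 * (C / T * |β - α|)) atTop (𝓝 0) := by
    have := ((tendsto_const_nhds (x := C)).div_atTop tendsto_id).mul_const |β - α| |>.const_mul 2
    simpa using this
  refine squeeze_zero_norm' ?_ lim
  filter_upwards [eventually_gt_atTop 0, eventually_ge_atTop T₀] with T hT hT0
  have h1 := hh T T (abs_of_pos hT) hT hT0
  have h2 := hh (-T) T (by rw [abs_neg, abs_of_pos hT]) hT hT0
  have h3 := congrArg norm (key T)
  rw [norm_mul, Complex.norm_I, one_mul] at h3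
  rw [h3]
  exact (norm_sub_le _ _).trans (by linarith)

theorem abs_re_sub_le_norm_line (c y : ℝ) (w : ℂ) :
    |c - w.re| ≤ ‖(c : ℂ) + y * Complex.I - w‖ := by
  simpa using Complex.abs_re_le_norm ((c : ℂ) + y * Complex.I - w)

theorem line_sub_ne_zero {c : ℝ} {w : ℂ} (h : w.re ≠ c) (y : ℝ) :
    (c : ℂ) + y * Complex.I - w ≠ 0 := by
  intro h0
  have := abs_re_sub_le_norm_line c y w
  rw [h0, norm_zero] at this
  exact h (sub_eq_zero.1 (abs_eq_zero.1 (le_antisymm this (abs_nonneg _)))).symm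

theorem VerticalDecay.line_bound {F : ℂ → ℂ} (hF : VerticalDecay F) (c : ℝ) :
    ∃ C : ℝ, 0 ≤ C ∧ ∀ y : ℝ, ‖F ((c : ℂ) + y * Complex.I)‖ ≤ C * (1 + y ^ 2)⁻¹ := by
  obtain ⟨C, hC⟩ := hF.bound |c|
  have h : ∀ y : ℝ, ‖F ((c : ℂ) + y * Complex.I)‖ ≤ C * (1 + y ^ 2)⁻¹ := fun y => by
    simpa using hC ((c : ℂ) + y * Complex.I) (by simp)
  refine ⟨C, ?_, h⟩
  have := (norm_nonneg _).trans (h 0)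
  simpa using this

theorem VerticalDecay.continuous_line {F : ℂ → ℂ} (hF : VerticalDecay F) (c : ℝ) :
    Continuous fun y : ℝ => F ((c : ℂ) + y * Complex.I) :=
  hF.differentiable.continuous.comp (by fun_prop)

theorem VerticalDecay.continuous_cauchy {F : ℂ → ℂ} (hF : VerticalDecay F) {c : ℝ} {w : ℂ}
    (h : w.re ≠ c) :
    Continuous fun y : ℝ => F ((c : ℂ) + y * Complex.I) / ((c : ℂ) + y * Complex.I - w) :=
  (hF.continuous_line c).div (by fun_prop) (line_sub_ne_zero h)

theorem VerticalDecay.integrable_cauchy {F : ℂ → ℂ} (hF : VerticalDecay F) {c : ℝ} {w : ℂ}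
    (h : w.re ≠ c) :
    MeasureTheory.Integrable
      fun y : ℝ => F ((c : ℂ) + y * Complex.I) / ((c : ℂ) + y * Complex.I - w) := by
  obtain ⟨C, hC0, hC⟩ := hF.line_bound c
  have hpos : 0 < |c - w.re| := abs_pos.2 (sub_ne_zero.2 h.symm)
  refine (integrable_inv_one_add_sq.const_mul (C / |c - w.re|)).mono'
    (hF.continuous_cauchy h).aestronglyMeasurable (MeasureTheory.ae_of_all _ fun y => ?_)
  rw [norm_div]
  calc _ ≤ C * (1 + y ^ 2)⁻¹ / |c - w.re| := by
        gcongr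
        · exact hC y
        · exact abs_re_sub_le_norm_line c y w
    _ = _ := by ring

theorem VerticalDecay.tendsto_cauchy {F : ℂ → ℂ} (hF : VerticalDecay F) {c : ℝ} {w : ℂ}
    (h : w.re ≠ c) :
    Tendsto (fun T : ℝ => ∫ y in (-T)..T,
      F ((c : ℂ) + y * Complex.I) / ((c : ℂ) + y * Complex.I - w)) atTop
      (𝓝 (lineCauchy F c w)) :=
  MeasureTheory.intervalIntegral_tendsto_integral (hF.integrable_cauchy h) tendsto_neg_atTop_atBot
    tendsto_id

theorem exists_bound_uIcc (α β : ℝ) : ∃ K : ℝ, ∀ x ∈ Set.uIcc α β, |x| ≤ K := by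
  refine ⟨max |α| |β|, fun x hx => ?_⟩
  rw [Set.mem_uIcc] at hx
  rw [abs_le]
  have := neg_abs_le α; have := neg_abs_le β; have := le_abs_self α; have := le_abs_self β
  have := le_max_left |α| |β|; have := le_max_right |α| |β|
  rcases hx with h | h <;> constructor <;> linarith [h.1, h.2]

theorem half_abs_im_le_norm_sub {v w : ℂ} (h : 2 * |w.im| ≤ |v.im|) :
    |v.im| / 2 ≤ ‖v - w‖ := by
  have h1 := Complex.abs_im_le_norm (v - w)
  rw [Complex.sub_im] at h1
  have h2 := abs_sub_abs_le_abs_sub v.im w.im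
  linarith

/-- The bound `‖F v - b‖ / ‖v - w‖ = O(1 / |Im v|)` in vertical strips. -/
theorem VerticalDecay.exists_bound_div {F : ℂ → ℂ} (hF : VerticalDecay F) (w b : ℂ) (α β : ℝ) :
    ∃ C : ℝ, ∀ v : ℂ, v.re ∈ Set.uIcc α β → 2 * |w.im| + 1 ≤ |v.im| →
      ‖(F v - b) / (v - w)‖ ≤ C / |v.im| := by
  obtain ⟨K, hK⟩ := exists_bound_uIcc α β
  obtain ⟨C, hC⟩ := hF.bound K
  refine ⟨2 * (|C| + ‖b‖), fun v hv hT => ?_⟩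
  have him : 0 < |v.im| := by linarith [abs_nonneg w.im]
  have hvw := half_abs_im_le_norm_sub (v := v) (w := w) (by linarith)
  have h1 : ‖F v - b‖ ≤ |C| + ‖b‖ := by
    refine (norm_sub_le _ _).trans (add_le_add_left ?_ _)
    refine (hC v (hK _ hv)).trans ?_
    have : (1 + v.im ^ 2)⁻¹ ≤ 1 := inv_le_one_of_one_le₀ (by nlinarith [sq_nonneg v.im])
    calc C * (1 + v.im ^ 2)⁻¹ ≤ |C| * (1 + v.im ^ 2)⁻¹ := by
          gcongr
          exact le_abs_self C
      _ ≤ |C| * 1 := by gcongr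
      _ = |C| := mul_one _
  rw [norm_div]
  calc ‖F v - b‖ / ‖v - w‖ ≤ (|C| + ‖b‖) / (|v.im| / 2) := by gcongr
    _ = _ := by field_simp

/-- The line may be shifted as long as it does not cross the pole. -/
theorem VerticalDecay.lineCauchy_eq {F : ℂ → ℂ} (hF : VerticalDecay F) {α β : ℝ} {w : ℂ}
    (h : w.re ∉ Set.uIcc α β) : lineCauchy F β w = lineCauchy F α w := by
  have hα : w.re ≠ α := by rintro h0; exact h (h0 ▸ Set.left_mem_uIcc)
  have hβ : w.re ≠ β := by rintro h0; exact h (h0 ▸ Set.right_mem_uIcc)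
  obtain ⟨C, hC⟩ := hF.exists_bound_div w 0 α β
  have h0 := tendsto_vertical_sub (G := fun v => F v / (v - w)) (α := α) (β := β)
    (fun v hv => by
      refine (hF.differentiable v).div (by fun_prop) ?_
      rw [sub_ne_zero]
      rintro rfl
      exact h hv)
    (fun v hv hT => by simpa using hC v hv hT)
  exact sub_eq_zero.1
    (tendsto_nhds_unique ((hF.tendsto_cauchy hβ).sub (hF.tendsto_cauchy hα)) h0)

theorem tendsto_integral_inv_of_pos {p : ℝ} (hp : 0 < p) (q : ℝ) :
    Tendsto (fun T : ℝ => ∫ y in (-T)..T, ((p : ℂ) + ((y - q : ℝ) : ℂ) * Complex.I)⁻¹) atTop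
      (𝓝 (Real.pi : ℂ)) := by
  have hder : ∀ y : ℝ, HasDerivAt
      (fun y : ℝ => ((Real.arctan ((y - q) / p) : ℝ) : ℂ) -
        ((1 / 2 * Real.log (p ^ 2 + (y - q) ^ 2) : ℝ) : ℂ) * Complex.I)
      ((p : ℂ) + ((y - q : ℝ) : ℂ) * Complex.I)⁻¹ y := by
    intro y
    have hpos : 0 < p ^ 2 + (y - q) ^ 2 := by positivity
    have h1 : HasDerivAt (fun y : ℝ => Real.arctan ((y - q) / p))
        (p / (p ^ 2 + (y - q) ^ 2)) y := by
      have := (((hasDerivAt_id y).sub_const q).div_const p).arctan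
      convert! this using 1
      simp only [id]
      field_simp
    have h2 : HasDerivAt (fun y : ℝ => 1 / 2 * Real.log (p ^ 2 + (y - q) ^ 2))
        ((y - q) / (p ^ 2 + (y - q) ^ 2)) y := by
      have := (((((hasDerivAt_id y).sub_const q).pow 2).const_add (p ^ 2)).log hpos.ne').const_mul
        (1 / 2)
      convert! this using 1
      simp only [id, Pi.pow_apply]
      field_simp
      norm_num
      ring
    have h3 := h1.ofReal_comp.sub (h2.ofReal_comp.mul_const Complex.I)
    convert! h3 using 1
    have hposc : (p : ℂ) ^ 2 + ((y : ℂ) - q) ^ 2 ≠ 0 := by exact_mod_cast hpos.ne'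
    have hne : (p : ℂ) + ((y : ℂ) - q) * Complex.I ≠ 0 := by
      intro h
      apply hposc
      linear_combination ((p : ℂ) - ((y : ℂ) - q) * Complex.I) * h +
        ((y : ℂ) - q) ^ 2 * Complex.I_sq
    push_cast
    rw [inv_eq_iff_eq_inv, eq_comm, inv_eq_iff_eq_inv, eq_comm, inv_eq_of_mul_eq_one_right]
    field_simp
    linear_combination -((y : ℂ) - q) ^ 2 * Complex.I_sq
  have hint : ∀ T : ℝ, ∫ y in (-T)..T, ((p : ℂ) + ((y - q : ℝ) : ℂ) * Complex.I)⁻¹ =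
      ((Real.arctan ((T - q) / p) - Real.arctan ((-T - q) / p) : ℝ) : ℂ) -
        ((1 / 2 * Real.log ((p ^ 2 + (T - q) ^ 2) / (p ^ 2 + (-T - q) ^ 2)) : ℝ) : ℂ) *
          Complex.I := by
    intro T
    rw [intervalIntegral.integral_eq_sub_of_hasDerivAt (fun y _ => hder y)]
    · rw [Real.log_div (by positivity) (by positivity)]
      push_cast
      ring
    · refine Continuous.intervalIntegrable (Continuous.inv₀ (by fun_prop) fun y h => ?_) _ _
      have := congrArg Complex.re h
      simp at this
      linarith
  have hat : Tendsto (fun T : ℝ => Real.arctan ((T - q) / p) - Real.arctan ((-T - q) / p)) atTop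
      (𝓝 (Real.pi / 2 - -(Real.pi / 2))) := by
    refine Tendsto.sub ?_ ?_
    · refine (tendsto_nhds_of_tendsto_nhdsWithin Real.tendsto_arctan_atTop).comp ?_
      exact (tendsto_atTop_add_const_right _ (-q) tendsto_id).atTop_div_const hp
    · refine (tendsto_nhds_of_tendsto_nhdsWithin Real.tendsto_arctan_atBot).comp ?_
      exact (tendsto_atBot_add_const_right _ (-q) tendsto_neg_atTop_atBot).atBot_div_const hp
  have hlog : Tendsto (fun T : ℝ =>
      1 / 2 * Real.log ((p ^ 2 + (T - q) ^ 2) / (p ^ 2 + (-T - q) ^ 2))) atTop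
      (𝓝 (1 / 2 * Real.log ((0 + (1 - 0) ^ 2) / (0 + (-1 - 0) ^ 2)))) := by
    have hi : Tendsto (fun T : ℝ => T⁻¹) atTop (𝓝 0) := tendsto_inv_atTop_zero
    have h1 : Tendsto (fun T : ℝ => q * T⁻¹) atTop (𝓝 0) := by simpa using hi.const_mul q
    have h2 : Tendsto (fun T : ℝ => (p * T⁻¹) ^ 2) atTop (𝓝 0) := by
      simpa using (hi.const_mul p).pow 2
    have h3 : Tendsto (fun T : ℝ => ((p * T⁻¹) ^ 2 + (1 - q * T⁻¹) ^ 2) /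
        ((p * T⁻¹) ^ 2 + (-1 - q * T⁻¹) ^ 2)) atTop
        (𝓝 ((0 + (1 - 0) ^ 2) / (0 + (-1 - 0) ^ 2))) :=
      (h2.add ((h1.const_sub 1).pow 2)).div (h2.add ((h1.const_sub (-1)).pow 2)) (by norm_num)
    refine Tendsto.const_mul _ (Tendsto.log ?_ (by norm_num))
    refine h3.congr' ?_
    filter_upwards [eventually_gt_atTop 0] with T hT
    have : p ^ 2 + (-T - q) ^ 2 ≠ 0 := by positivity
    have : (p * T⁻¹) ^ 2 + (-1 - q * T⁻¹) ^ 2 ≠ 0 := by positivity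
    field_simp
  have := ((Complex.continuous_ofReal.tendsto _).comp hat).sub
    (((Complex.continuous_ofReal.tendsto _).comp hlog).mul_const Complex.I)
  simp only [hint]
  convert! this using 2
  norm_num

theorem tendsto_integral_inv_of_neg {p : ℝ} (hp : p < 0) (q : ℝ) :
    Tendsto (fun T : ℝ => ∫ y in (-T)..T, ((p : ℂ) + ((y - q : ℝ) : ℂ) * Complex.I)⁻¹) atTop
      (𝓝 (-Real.pi : ℂ)) := by
  have h := (tendsto_integral_inv_of_pos (neg_pos.2 hp) (-q)).neg
  refine h.congr fun T => ?_
  rw [← intervalIntegral.integral_neg]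
  have := intervalIntegral.integral_comp_neg (a := -T) (b := T)
    (fun y : ℝ => ((p : ℂ) + ((y - q : ℝ) : ℂ) * Complex.I)⁻¹)
  rw [neg_neg] at this
  rw [← this]
  refine intervalIntegral.integral_congr fun y _ => ?_
  rw [← inv_neg]
  congr 1
  push_cast
  ring

/-- Residue theorem for the strip between two vertical lines. -/
theorem VerticalDecay.lineCauchy_sub {F : ℂ → ℂ} (hF : VerticalDecay F) {α β : ℝ} {w : ℂ}
    (hα : α < w.re) (hβ : w.re < β) :
    lineCauchy F β w - lineCauchy F α w = 2 * Real.pi * F w := by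
  obtain ⟨C, hC⟩ := hF.exists_bound_div w (F w) α β
  have hds : Differentiable ℂ (dslope F w) := by
    rw [← differentiableOn_univ, Complex.differentiableOn_dslope univ_mem]
    exact hF.differentiable.differentiableOn
  have hne : ∀ {v : ℂ}, v ≠ w → dslope F w v = (F v - F w) / (v - w) := fun {v} hv => by
    rw [dslope_of_ne _ hv, slope_def_field]
  have h0 := tendsto_vertical_sub (G := dslope F w) (α := α) (β := β) (fun v _ => hds v)
    (C := C) (T₀ := 2 * |w.im| + 1)
    (fun v hv hT => by
      rw [hne]
      · exact hC v hv hT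
      · rintro rfl
        linarith [abs_nonneg v.im])
  have hsplit : ∀ c : ℝ, w.re ≠ c → ∀ T : ℝ, ∫ y in (-T)..T, dslope F w ((c : ℂ) + y * Complex.I) =
      (∫ y in (-T)..T, F ((c : ℂ) + y * Complex.I) / ((c : ℂ) + y * Complex.I - w)) -
        F w * ∫ y in (-T)..T, (((c - w.re : ℝ) : ℂ) + ((y - w.im : ℝ) : ℂ) * Complex.I)⁻¹ := by
    intro c hc T
    have heq : ∀ y : ℝ, ((c - w.re : ℝ) : ℂ) + ((y - w.im : ℝ) : ℂ) * Complex.I =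
        (c : ℂ) + y * Complex.I - w := by
      intro y
      apply Complex.ext <;> simp
    simp only [heq]
    rw [← intervalIntegral.integral_const_mul, ← intervalIntegral.integral_sub]
    · refine intervalIntegral.integral_congr fun y _ => ?_
      rw [hne (sub_ne_zero.1 (line_sub_ne_zero hc y))]
      ring
    · exact (hF.continuous_cauchy hc).intervalIntegrable _ _
    · exact (continuous_const.mul (Continuous.inv₀ (by fun_prop)
        (line_sub_ne_zero hc))).intervalIntegrable _ _
  simp only [hsplit β hβ.ne, hsplit α hα.ne'] at h0
  have h1 := ((hF.tendsto_cauchy hβ.ne).sub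
    ((tendsto_integral_inv_of_pos (sub_pos.2 hβ) w.im).const_mul (F w))).sub
    ((hF.tendsto_cauchy hα.ne').sub
      ((tendsto_integral_inv_of_neg (sub_neg.2 hα) w.im).const_mul (F w)))
  have h2 := tendsto_nhds_unique h1 h0
  linear_combination h2

/-- The Cauchy integral is holomorphic to the left of the line. -/
theorem VerticalDecay.differentiableAt_lineCauchy {F : ℂ → ℂ} (hF : VerticalDecay F) {c : ℝ}
    {w : ℂ} (h : w.re < c) : DifferentiableAt ℂ (lineCauchy F c) w := by
  obtain ⟨C, hC0, hC⟩ := hF.line_bound c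
  set δ := (c - w.re) / 2 with hδ
  have hδ0 : 0 < δ := by rw [hδ]; linarith
  have hre : ∀ z ∈ Metric.ball w δ, δ ≤ |c - z.re| := by
    intro z hz
    have h1 := (Complex.abs_re_le_norm (z - w)).trans (mem_ball_iff_norm.1 hz).le
    rw [Complex.sub_re, abs_le] at h1
    rw [abs_of_pos (by linarith)]
    linarith
  have hne : ∀ z ∈ Metric.ball w δ, z.re ≠ c := by
    intro z hz h0
    have := hre z hz
    rw [h0, sub_self, abs_zero] at this
    linarith
  refine (hasDerivAt_integral_of_dominated_loc_of_deriv_le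
    (F' := fun z (y : ℝ) => F ((c : ℂ) + y * Complex.I) / ((c : ℂ) + y * Complex.I - z) ^ 2)
    (bound := fun y => C / δ ^ 2 * (1 + y ^ 2)⁻¹) (Metric.ball_mem_nhds w hδ0)
    ?_ (hF.integrable_cauchy h.ne) ?_ ?_ (integrable_inv_one_add_sq.const_mul _) ?_).2.differentiableAt
  · filter_upwards [Metric.ball_mem_nhds w hδ0] with z hz
    exact (hF.continuous_cauchy (hne z hz)).aestronglyMeasurable
  · exact ((hF.continuous_line c).div (by fun_prop)
      fun y => pow_ne_zero 2 (line_sub_ne_zero h.ne y)).aestronglyMeasurable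
  · refine MeasureTheory.ae_of_all _ fun y z hz => ?_
    rw [norm_div, norm_pow]
    calc _ ≤ C * (1 + y ^ 2)⁻¹ / δ ^ 2 := by
          gcongr
          · exact hC y
          · exact (hre z hz).trans (abs_re_sub_le_norm_line c y z)
      _ = _ := by ring
  · refine MeasureTheory.ae_of_all _ fun y z hz => ?_
    have h0 := line_sub_ne_zero (hne z hz) y
    have := ((hasDerivAt_id z).const_sub ((c : ℂ) + y * Complex.I)).inv h0
    have := this.const_mul (F ((c : ℂ) + y * Complex.I))
    simp only [id, neg_neg] at this
    convert! this using 1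
    field_simp

/-! ### Double contour integrals over a circle and a vertical line -/

theorem re_le_of_mem_sphere {ρ : ℝ} {u : ℂ} (hu : ‖u‖ ≤ ρ) : u.re ≤ ρ :=
  (Complex.re_le_norm u).trans hu

theorem VerticalDecay.circleIntegral_line_shift {F : ℂ → ℂ} (hF : VerticalDecay F) (g : ℂ → ℂ)
    {ρ c c' : ℝ} (hρ : 0 ≤ ρ) (hc : ρ < c) (hc' : ρ < c') :
    circleIntegral (fun u => g u * lineCauchy F c u) 0 ρ =
      circleIntegral (fun u => g u * lineCauchy F c' u) 0 ρ := by
  refine circleIntegral.integral_congr hρ fun u hu => ?_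
  have hu' : u.re ≤ ρ := re_le_of_mem_sphere (by simpa using (mem_sphere_zero_iff_norm.1 hu).le)
  rw [hF.lineCauchy_eq (α := c') (β := c)]
  rw [Set.mem_uIcc]
  rintro (h | h) <;> linarith [h.1, h.2]

theorem VerticalDecay.circleIntegral_circle_shift {F : ℂ → ℂ} (hF : VerticalDecay F) {g : ℂ → ℂ}
    (hg : ∀ z, z ≠ 0 → DifferentiableAt ℂ g z) {ρ ρ' c : ℝ} (hρ : 0 < ρ) (hρρ' : ρ ≤ ρ')
    (hc : ρ' < c) :
    circleIntegral (fun u => g u * lineCauchy F c u) 0 ρ' =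
      circleIntegral (fun u => g u * lineCauchy F c u) 0 ρ := by
  have hd : ∀ u : ℂ, ρ ≤ ‖u‖ → ‖u‖ ≤ ρ' →
      DifferentiableAt ℂ (fun u => g u * lineCauchy F c u) u := by
    intro u h1 h2
    refine (hg u ?_).mul (hF.differentiableAt_lineCauchy ?_)
    · rintro rfl
      rw [norm_zero] at h1
      linarith
    · linarith [re_le_of_mem_sphere h2]
  refine Complex.circleIntegral_eq_of_differentiable_on_annulus_off_countable hρ hρρ'
    Set.countable_empty (fun u hu => ?_) (fun u hu => ?_)
  · simp only [Set.mem_sdiff, mem_closedBall_zero_iff, mem_ball_zero_iff, not_lt] at hu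
    exact (hd u hu.2 hu.1).continuousAt.continuousWithinAt
  · simp only [Set.mem_sdiff, mem_closedBall_zero_iff, mem_ball_zero_iff, not_le] at hu
    exact hd u hu.1.2.le hu.1.1.le

theorem lineCauchy_scale (F : ℂ → ℂ) {r : ℝ} (hr : 0 < r) (c : ℝ) (w : ℂ) :
    lineCauchy F (r * c) (r * w) = lineCauchy (fun v => F (r * v)) c w := by
  have hrc : (r : ℂ) ≠ 0 := by exact_mod_cast hr.ne'
  have h := MeasureTheory.Measure.integral_comp_mul_left
    (fun y : ℝ => F (((r * c : ℝ) : ℂ) + y * Complex.I) /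
      (((r * c : ℝ) : ℂ) + y * Complex.I - r * w)) r
  rw [abs_of_pos (inv_pos.2 hr)] at h
  have h2 : lineCauchy F (r * c) (r * w) = (r : ℂ) * ∫ y : ℝ,
      F (((r * c : ℝ) : ℂ) + ((r * y : ℝ) : ℂ) * Complex.I) /
        (((r * c : ℝ) : ℂ) + ((r * y : ℝ) : ℂ) * Complex.I - r * w) := by
    rw [h, lineCauchy, Complex.real_smul]
    push_cast
    rw [← mul_assoc, mul_inv_cancel₀ hrc, one_mul]
  rw [h2, lineCauchy, ← MeasureTheory.integral_const_mul]
  refine MeasureTheory.integral_congr_ae (MeasureTheory.ae_of_all _ fun y => ?_)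
  have e : ((r * c : ℝ) : ℂ) + ((r * y : ℝ) : ℂ) * Complex.I = r * ((c : ℂ) + y * Complex.I) := by
    push_cast; ring
  simp only [e]
  rw [← mul_sub, mul_div_assoc', mul_div_mul_left _ _ hrc]

theorem circleIntegral_scale (f : ℂ → ℂ) (r : ℝ) :
    circleIntegral f 0 r = r * circleIntegral (fun w => f (r * w)) 0 1 := by
  simp only [circleIntegral]
  rw [← intervalIntegral.integral_const_mul]
  refine intervalIntegral.integral_congr fun θ _ => ?_
  simp only [deriv_circleMap, circleMap, Complex.ofReal_one, one_mul, zero_add, smul_eq_mul]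
  ring

theorem lt_cos_of_abs_lt_arccos {a θ : ℝ} (ha : a ∈ Set.Ioo (-1 : ℝ) 1)
    (h : |θ| < Real.arccos a) : a < Real.cos θ := by
  rw [← Real.cos_abs θ]
  calc a = Real.cos (Real.arccos a) := (Real.cos_arccos ha.1.le ha.2.le).symm
    _ < _ := Real.cos_lt_cos_of_nonneg_of_le_pi (abs_nonneg θ) (Real.arccos_le_pi a) h

theorem cos_lt_of_arccos_lt_abs {a θ : ℝ} (ha : a ∈ Set.Ioo (-1 : ℝ) 1)
    (h : Real.arccos a < |θ|) (hθ : |θ| ≤ Real.pi) : Real.cos θ < a := by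
  rw [← Real.cos_abs θ]
  calc Real.cos |θ| < Real.cos (Real.arccos a) :=
        Real.cos_lt_cos_of_nonneg_of_le_pi (Real.arccos_nonneg a) hθ h
    _ = a := Real.cos_arccos ha.1.le ha.2.le

theorem exp_mul_I_re (θ : ℝ) : (Complex.exp ((θ : ℂ) * Complex.I)).re = Real.cos θ :=
  Complex.exp_ofReal_mul_I_re θ

/-- Moving the vertical line into the unit circle, to the abscissa `a`, produces the residues along
the arc of the circle to the right of the line; what remains is an integral over crossing
contours. -/
theorem VerticalDecay.norm_circleIntegral_sub_arcIntegral_le {F : ℂ → ℂ} (hF : VerticalDecay F)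
    {g : ℂ → ℂ} (hg : ∀ z, z ≠ 0 → DifferentiableAt ℂ g z) {a c : ℝ}
    (ha : a ∈ Set.Ioo (-1 : ℝ) 1) (hc : 1 < c) {B : ℝ → ℝ}
    (hB : IntervalIntegrable B MeasureTheory.volume (-Real.pi) Real.pi)
    (hbound : ∀ θ : ℝ, Real.cos θ ≠ a → ‖g (Complex.exp ((θ : ℂ) * Complex.I)) *
      lineCauchy F a (Complex.exp ((θ : ℂ) * Complex.I))‖ ≤ B θ) :
    ‖circleIntegral (fun u => g u * lineCauchy F c u) 0 1 -
      2 * Real.pi * arcIntegral a (fun u => g u * F u)‖ ≤ ∫ θ in (-Real.pi)..Real.pi, B θ := by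
  set e : ℝ → ℂ := fun θ => Complex.exp ((θ : ℂ) * Complex.I) with he
  set α := Real.arccos a with hα
  have hαpi : α < Real.pi := arccos_lt_pi ha
  have hα0 : 0 < α := Real.arccos_pos.2 ha.2
  have hec : Continuous e := by fun_prop
  have he0 : ∀ θ, e θ ≠ 0 := fun θ => Complex.exp_ne_zero _
  have hgc : Continuous fun θ => g (e θ) := continuous_iff_continuousAt.2 fun θ =>
    (hg _ (he0 θ)).continuousAt.comp hec.continuousAt
  have hFc : Continuous fun θ => F (e θ) := hF.differentiable.continuous.comp hec
  have hLc : Continuous fun θ => lineCauchy F c (e θ) := continuous_iff_continuousAt.2 fun θ => by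
    refine (hF.differentiableAt_lineCauchy ?_).continuousAt.comp hec.continuousAt
    simp only [he, exp_mul_I_re]
    linarith [Real.cos_le_one θ]
  set k : ℝ → ℂ := fun θ => g (e θ) * lineCauchy F c (e θ) * (Complex.I * e θ) with hk
  have hkc : Continuous k := (hgc.mul hLc).mul (continuous_const.mul hec)
  set h : ℝ → ℂ := fun θ => g (e θ) * F (e θ) * (Complex.I * e θ) with hh
  have hhc : Continuous h := (hgc.mul hFc).mul (continuous_const.mul hec)
  have hcirc : circleIntegral (fun u => g u * lineCauchy F c u) 0 1 =
      ∫ θ in (-Real.pi)..Real.pi, k θ := by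
    rw [circleIntegral_eq_integral_exp _ (-Real.pi)]
    simp only [hk]
    congr 1
    ring
  have hsplit : (∫ θ in (-Real.pi)..Real.pi, k θ) - 2 * Real.pi * ∫ θ in (-α)..α, h θ =
      (∫ θ in (-Real.pi)..(-α), k θ) + (∫ θ in (-α)..α, (k θ - 2 * Real.pi * h θ)) +
        ∫ θ in α..Real.pi, k θ := by
    rw [intervalIntegral.integral_sub (hkc.intervalIntegrable _ _)
      ((hhc.const_mul _).intervalIntegrable _ _), intervalIntegral.integral_const_mul,
      ← intervalIntegral.integral_add_adjacent_intervals (b := α) (hkc.intervalIntegrable _ _)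
        (hkc.intervalIntegrable _ _),
      ← intervalIntegral.integral_add_adjacent_intervals (b := -α) (hkc.intervalIntegrable _ _)
        (hkc.intervalIntegrable (-α) α)]
    ring
  have harc : arcIntegral a (fun u => g u * F u) = ∫ θ in (-α)..α, h θ := rfl
  have hnI : ∀ θ, ‖Complex.I * e θ‖ = 1 := fun θ => by
    rw [norm_mul, Complex.norm_I, one_mul]
    exact Complex.norm_exp_ofReal_mul_I θ
  have hout : ∀ θ : ℝ, α < |θ| → |θ| ≤ Real.pi → ‖k θ‖ ≤ B θ := by
    intro θ h1 h2
    have hcos : Real.cos θ < a := cos_lt_of_arccos_lt_abs ha h1 h2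
    have : lineCauchy F c (e θ) = lineCauchy F a (e θ) := by
      apply hF.lineCauchy_eq
      rw [Set.uIcc_of_le (by linarith [ha.2])]
      simp only [he, exp_mul_I_re, Set.mem_Icc, not_and]
      intro h3
      linarith
    simp only [hk]
    rw [norm_mul, hnI, mul_one, this]
    exact hbound θ hcos.ne
  have hin : ∀ θ : ℝ, |θ| < α → ‖k θ - 2 * Real.pi * h θ‖ ≤ B θ := by
    intro θ h1
    have hcos : a < Real.cos θ := lt_cos_of_abs_lt_arccos ha h1
    have hj := hF.lineCauchy_sub (α := a) (β := c) (w := e θ)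
      (by simpa only [he, exp_mul_I_re] using hcos)
      (by simp only [he, exp_mul_I_re]; linarith [Real.cos_le_one θ])
    have : k θ - 2 * Real.pi * h θ = g (e θ) * lineCauchy F a (e θ) * (Complex.I * e θ) := by
      simp only [hk, hh]
      linear_combination (g (e θ) * (Complex.I * e θ)) * hj
    rw [this, norm_mul, hnI, mul_one]
    exact hbound θ hcos.ne'
  have hpt : ∀ z : ℝ, ∀ᵐ θ : ℝ, θ ≠ z := fun z => by
    simp [MeasureTheory.ae_iff]
  have hsub : ∀ {x y : ℝ}, -Real.pi ≤ x → x ≤ y → y ≤ Real.pi →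
      IntervalIntegrable B MeasureTheory.volume x y := fun {x y} h1 h2 h3 =>
    hB.mono_set (by
      rw [Set.uIcc_of_le h2, Set.uIcc_of_le (by linarith)]
      exact Set.Icc_subset_Icc h1 h3)
  have b1 : ‖∫ θ in (-Real.pi)..(-α), k θ‖ ≤ ∫ θ in (-Real.pi)..(-α), B θ := by
    refine intervalIntegral.norm_integral_le_of_norm_le (by linarith) ?_
      (hsub le_rfl (by linarith) (by linarith))
    filter_upwards [hpt (-α)] with θ hθ hm
    have : θ < -α := lt_of_le_of_ne hm.2 hθ
    refine hout θ ?_ ?_ <;> rw [abs_of_neg (by linarith)] <;> linarith [hm.1]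
  have b2 : ‖∫ θ in (-α)..α, (k θ - 2 * Real.pi * h θ)‖ ≤ ∫ θ in (-α)..α, B θ := by
    refine intervalIntegral.norm_integral_le_of_norm_le (by linarith) ?_
      (hsub (by linarith) (by linarith) (by linarith))
    filter_upwards [hpt α] with θ hθ hm
    exact hin θ (abs_lt.2 ⟨hm.1, lt_of_le_of_ne hm.2 hθ⟩)
  have b3 : ‖∫ θ in α..Real.pi, k θ‖ ≤ ∫ θ in α..Real.pi, B θ := by
    refine intervalIntegral.norm_integral_le_of_norm_le (by linarith) ?_
      (hsub (by linarith) (by linarith) le_rfl)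
    refine MeasureTheory.ae_of_all _ fun θ hm => ?_
    refine hout θ ?_ ?_ <;> rw [abs_of_pos (by linarith [hm.1])] <;> linarith [hm.1, hm.2]
  rw [hcirc, harc, hsplit, ← intervalIntegral.integral_add_adjacent_intervals (b := α)
    (hsub le_rfl (by linarith) (by linarith)) (hsub (by linarith) (by linarith) le_rfl),
    ← intervalIntegral.integral_add_adjacent_intervals (b := -α)
    (hsub le_rfl (by linarith) (by linarith)) (hsub (by linarith) (by linarith) (by linarith))]
  exact norm_add₃_le.trans (by linarith)

theorem integrable_poisson {δ : ℝ} (hδ : 0 < δ) (q : ℝ) :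
    MeasureTheory.Integrable (fun y : ℝ => δ / (δ ^ 2 + (y - q) ^ 2)) ∧
      ∫ y : ℝ, δ / (δ ^ 2 + (y - q) ^ 2) = Real.pi := by
  have he : (fun y : ℝ => δ / (δ ^ 2 + (y - q) ^ 2)) =
      fun y => (fun z : ℝ => δ⁻¹ * (1 + (z / δ) ^ 2)⁻¹) (y - q) := by
    funext y
    field_simp
  rw [he]
  constructor
  · exact ((integrable_inv_one_add_sq.comp_div hδ.ne').const_mul δ⁻¹).comp_sub_right q
  · rw [MeasureTheory.integral_sub_right_eq_self (fun z : ℝ => δ⁻¹ * (1 + (z / δ) ^ 2)⁻¹),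
      MeasureTheory.integral_const_mul,
      MeasureTheory.Measure.integral_comp_div (fun z : ℝ => (1 + z ^ 2)⁻¹),
      integral_univ_inv_one_add_sq, abs_of_pos hδ, smul_eq_mul, ← mul_assoc,
      inv_mul_cancel₀ hδ.ne', one_mul]

/-- A Cauchy integral over a line at distance `δ` from the pole is at most of order `δ^(-1/2)`.
With `n = |v - w|` this rests on `1 / n ≤ (1 + δ / n²) / (2 √δ)`, where `δ / n²` is a Poisson
kernel. -/
theorem norm_lineCauchy_le {F : ℂ → ℂ} {a C : ℝ} (hC0 : 0 ≤ C)
    (hC : ∀ y : ℝ, ‖F ((a : ℂ) + y * Complex.I)‖ ≤ C * (1 + y ^ 2)⁻¹) {w : ℂ} (hw : w.re ≠ a) :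
    ‖lineCauchy F a w‖ ≤ C * Real.pi * (Real.sqrt |w.re - a|)⁻¹ := by
  set δ := |w.re - a| with hδ
  have hδ0 : 0 < δ := abs_pos.2 (sub_ne_zero.2 hw)
  obtain ⟨hp1, hp2⟩ := integrable_poisson hδ0 w.im
  have hsq : 0 < Real.sqrt δ := Real.sqrt_pos.2 hδ0
  have hint : MeasureTheory.Integrable (fun y : ℝ => C * (Real.sqrt δ)⁻¹ * (1 / 2) *
      ((1 + y ^ 2)⁻¹ + δ / (δ ^ 2 + (y - w.im) ^ 2))) :=
    (integrable_inv_one_add_sq.add hp1).const_mul _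
  have hval : ∫ y : ℝ, C * (Real.sqrt δ)⁻¹ * (1 / 2) *
      ((1 + y ^ 2)⁻¹ + δ / (δ ^ 2 + (y - w.im) ^ 2)) = C * Real.pi * (Real.sqrt δ)⁻¹ := by
    rw [MeasureTheory.integral_const_mul, MeasureTheory.integral_add integrable_inv_one_add_sq hp1,
      hp2, integral_univ_inv_one_add_sq]
    ring
  rw [← hval]
  refine MeasureTheory.norm_integral_le_of_norm_le hint (MeasureTheory.ae_of_all _ fun y => ?_)
  set m := ‖(a : ℂ) + y * Complex.I - w‖ with hm
  have hm2 : m ^ 2 = δ ^ 2 + (y - w.im) ^ 2 := by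
    rw [hm, ← Complex.normSq_eq_norm_sq, Complex.normSq_apply, hδ, sq_abs]
    simp
    ring
  have hm0 : 0 < m := by
    have : 0 < m ^ 2 := by rw [hm2]; positivity
    exact lt_of_le_of_ne (norm_nonneg _) fun h => by rw [← h] at this; simp at this
  have hkey : 1 / m ≤ (Real.sqrt δ)⁻¹ * (1 / 2) * (1 + δ / m ^ 2) := by
    have h1 : 0 ≤ (1 - Real.sqrt δ / m) ^ 2 := sq_nonneg _
    have h2 : (1 - Real.sqrt δ / m) ^ 2 = 1 - 2 * (Real.sqrt δ * (1 / m)) + δ / m ^ 2 := by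
      rw [sub_sq, div_pow, Real.sq_sqrt hδ0.le]; ring
    rw [h2] at h1
    calc 1 / m = (Real.sqrt δ)⁻¹ * (Real.sqrt δ * (1 / m)) := by
          rw [← mul_assoc, inv_mul_cancel₀ hsq.ne', one_mul]
      _ ≤ (Real.sqrt δ)⁻¹ * ((1 / 2) * (1 + δ / m ^ 2)) :=
          mul_le_mul_of_nonneg_left (by linarith) (by positivity)
      _ = _ := by ring
  have hy1 : (1 + y ^ 2)⁻¹ ≤ 1 := inv_le_one_of_one_le₀ (by nlinarith [sq_nonneg y])
  have hy0 : 0 < (1 + y ^ 2)⁻¹ := by positivity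
  rw [norm_div, ← hm2]
  calc ‖F ((a : ℂ) + y * Complex.I)‖ / m ≤ C * (1 + y ^ 2)⁻¹ * (1 / m) := by
        rw [div_eq_mul_one_div]
        gcongr
        exact hC y
    _ ≤ C * (1 + y ^ 2)⁻¹ * ((Real.sqrt δ)⁻¹ * (1 / 2) * (1 + δ / m ^ 2)) := by gcongr
    _ = C * (Real.sqrt δ)⁻¹ * (1 / 2) * ((1 + y ^ 2)⁻¹ + (1 + y ^ 2)⁻¹ * (δ / m ^ 2)) := by ring
    _ ≤ C * (Real.sqrt δ)⁻¹ * (1 / 2) * ((1 + y ^ 2)⁻¹ + 1 * (δ / m ^ 2)) := by gcongr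
    _ = _ := by rw [one_mul]

/-! ### The singular integral over the circle -/

theorem intervalIntegrable_inv_sqrt_abs (b c : ℝ) :
    IntervalIntegrable (fun x : ℝ => (Real.sqrt |x|)⁻¹) MeasureTheory.volume b c := by
  have hpos : ∀ d : ℝ, 0 ≤ d →
      IntervalIntegrable (fun x : ℝ => (Real.sqrt |x|)⁻¹) MeasureTheory.volume 0 d := by
    intro d hd
    refine (intervalIntegral.intervalIntegrable_rpow' (a := 0) (b := d) (r := -(1 / 2))
      (by norm_num)).congr fun x hx => ?_
    rw [Set.uIoc_of_le hd] at hx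
    rw [abs_of_pos hx.1, Real.sqrt_eq_rpow, Real.rpow_neg hx.1.le]
  have hall : ∀ d : ℝ,
      IntervalIntegrable (fun x : ℝ => (Real.sqrt |x|)⁻¹) MeasureTheory.volume 0 d := by
    intro d
    rcases le_total 0 d with hd | hd
    · exact hpos d hd
    · have := ((IntervalIntegrable.iff_comp_neg (by simp)).1 (hpos (-d) (by linarith)))
      simpa using this
  exact (hall b).symm.trans (hall c)

theorem abs_cos_sub_cos_ge {α θ : ℝ} (hα : α ∈ Set.Ioo 0 Real.pi)
    (hθ : θ ∈ Set.Icc 0 Real.pi) :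
    2 * (min α (Real.pi - α) / Real.pi) / Real.pi * |θ - α| ≤ |Real.cos θ - Real.cos α| := by
  have hpi := Real.pi_pos
  have h1 : |θ - α| / Real.pi ≤ |Real.sin ((θ - α) / 2)| := by
    have h := Real.mul_abs_le_abs_sin (x := (θ - α) / 2) (by
      rw [abs_le]; constructor <;> linarith [hα.1, hα.2, hθ.1, hθ.2])
    rw [abs_div, abs_two] at h
    calc |θ - α| / Real.pi = 2 / Real.pi * (|θ - α| / 2) := by ring
      _ ≤ _ := h
  have h2 : min α (Real.pi - α) / Real.pi ≤ |Real.sin ((θ + α) / 2)| := by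
    refine le_trans ?_ (le_abs_self _)
    rcases le_total ((θ + α) / 2) (Real.pi / 2) with h | h
    · refine le_trans ?_ (Real.mul_le_sin (by linarith [hα.1, hθ.1]) h)
      calc min α (Real.pi - α) / Real.pi ≤ (θ + α) / Real.pi := by
            gcongr
            exact (min_le_left _ _).trans (by linarith [hθ.1])
        _ = _ := by ring
    · rw [← Real.sin_pi_sub]
      refine le_trans ?_ (Real.mul_le_sin (by linarith [hα.2, hθ.2]) (by linarith))
      calc min α (Real.pi - α) / Real.pi ≤ (2 * Real.pi - θ - α) / Real.pi := by
            gcongr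
            exact (min_le_right _ _).trans (by linarith [hθ.2])
        _ = _ := by ring
  rw [Real.cos_sub_cos, abs_mul, abs_mul, abs_neg, abs_two]
  have h0 : 0 ≤ min α (Real.pi - α) := le_min hα.1.le (by linarith [hα.2])
  calc 2 * (min α (Real.pi - α) / Real.pi) / Real.pi * |θ - α|
      = 2 * (min α (Real.pi - α) / Real.pi) * (|θ - α| / Real.pi) := by ring
    _ ≤ _ := by gcongr

theorem intervalIntegrable_inv_sqrt_cos_sub {a : ℝ} (ha : a ∈ Set.Ioo (-1 : ℝ) 1) :
    IntervalIntegrable (fun θ : ℝ => (Real.sqrt |Real.cos θ - a|)⁻¹) MeasureTheory.volume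
      (-Real.pi) Real.pi := by
  set α := Real.arccos a with hαdef
  have hα : α ∈ Set.Ioo 0 Real.pi := ⟨Real.arccos_pos.2 ha.2, arccos_lt_pi ha⟩
  have hcos : Real.cos α = a := Real.cos_arccos ha.1.le ha.2.le
  have hpi := Real.pi_pos
  set κ := 2 * (min α (Real.pi - α) / Real.pi) / Real.pi with hκ
  have hκ0 : 0 < κ := by
    have : 0 < min α (Real.pi - α) := lt_min hα.1 (by linarith [hα.2])
    positivity
  have hmeas : Measurable fun θ : ℝ => (Real.sqrt |Real.cos θ - a|)⁻¹ := by fun_prop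
  have hpos : IntervalIntegrable (fun θ : ℝ => (Real.sqrt |Real.cos θ - a|)⁻¹)
      MeasureTheory.volume 0 Real.pi := by
    have h := ((intervalIntegrable_inv_sqrt_abs (0 - α) (Real.pi - α)).comp_sub_right α).const_mul
      (Real.sqrt κ)⁻¹
    simp only [sub_add_cancel] at h
    refine h.mono_fun hmeas.aestronglyMeasurable ?_
    refine (MeasureTheory.ae_restrict_iff' measurableSet_uIoc).2 ?_
    have hne : ∀ᵐ θ : ℝ, θ ≠ α := by simp [MeasureTheory.ae_iff]
    filter_upwards [hne] with θ hθα hθ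
    rw [Set.uIoc_of_le hpi.le] at hθ
    have hb := abs_cos_sub_cos_ge hα (Set.Ioc_subset_Icc_self hθ)
    rw [hcos, ← hκ] at hb
    have h0 : 0 < |θ - α| := abs_pos.2 (sub_ne_zero.2 hθα)
    rw [Real.norm_of_nonneg (by positivity), Real.norm_of_nonneg (by positivity), ← mul_inv,
      ← Real.sqrt_mul hκ0.le]
    gcongr
  have hneg := (IntervalIntegrable.iff_comp_neg (by simp)).1 hpos
  simp only [Real.cos_neg, neg_zero] at hneg
  exact hneg.symm.trans hpos

theorem intervalIntegrable_exp_mul_inv_sqrt {a : ℝ} (ha : a ∈ Set.Ioo (-1 : ℝ) 1) (N : ℕ) :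
    IntervalIntegrable (fun θ : ℝ => Real.exp (-(N * (Real.cos θ - a) ^ 2)) *
      (Real.sqrt |Real.cos θ - a|)⁻¹) MeasureTheory.volume (-Real.pi) Real.pi :=
  (intervalIntegrable_inv_sqrt_cos_sub ha).continuousOn_mul (by fun_prop)

theorem tendsto_integral_exp_mul_inv_sqrt {a : ℝ} (ha : a ∈ Set.Ioo (-1 : ℝ) 1) :
    Tendsto (fun N : ℕ => ∫ θ in (-Real.pi)..Real.pi, Real.exp (-(N * (Real.cos θ - a) ^ 2)) *
      (Real.sqrt |Real.cos θ - a|)⁻¹) atTop (𝓝 0) := by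
  have h0 : (0 : ℝ) = ∫ θ in (-Real.pi)..Real.pi, (0 : ℝ) := by simp
  rw [h0]
  refine intervalIntegral.tendsto_integral_filter_of_dominated_convergence _
    (Eventually.of_forall fun N => ?_) (Eventually.of_forall fun N => ?_)
    (intervalIntegrable_inv_sqrt_cos_sub ha) ?_
  · exact (by fun_prop : Measurable _).aestronglyMeasurable
  · refine MeasureTheory.ae_of_all _ fun θ _ => ?_
    rw [Real.norm_of_nonneg (by positivity)]
    refine mul_le_of_le_one_left (by positivity) ?_
    rw [Real.exp_le_one_iff]
    have : (0 : ℝ) ≤ N * (Real.cos θ - a) ^ 2 := by positivity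
    linarith
  · refine MeasureTheory.ae_of_all _ fun θ _ => ?_
    rcases eq_or_ne (Real.cos θ) a with h | h
    · simp [h]
    · have hp : 0 < (Real.cos θ - a) ^ 2 := by
        have := sub_ne_zero.2 h
        positivity
      have h1 : Tendsto (fun N : ℕ => -(N * (Real.cos θ - a) ^ 2)) atTop atBot :=
        tendsto_neg_atTop_atBot.comp (tendsto_natCast_atTop_atTop.atTop_mul_const hp)
      simpa using (Real.tendsto_exp_atBot.comp h1).mul_const (Real.sqrt |Real.cos θ - a|)⁻¹

/-! ### The integrand of the Dyson Brownian minor kernel on the steepest descent contours -/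

theorem norm_exp_quadratic (A B : ℝ) (v : ℂ) :
    ‖Complex.exp ((A : ℂ) * v ^ 2 + (B : ℂ) * v)‖ =
      Real.exp (A * (v.re ^ 2 - v.im ^ 2) + B * v.re) := by
  rw [Complex.norm_exp]
  congr 1
  simp [sq]

theorem one_add_sq_le_exp (y : ℝ) : 1 + y ^ 2 ≤ 2 * Real.exp |y| := by
  have h := Real.quadratic_le_exp_of_nonneg (abs_nonneg y)
  rw [sq_abs] at h
  linarith [abs_nonneg y]

theorem pow_le_factorial_mul_exp {x : ℝ} (hx : 0 ≤ x) (k : ℕ) :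
    x ^ k ≤ (Nat.factorial k : ℝ) * Real.exp x := by
  have h := Real.pow_div_factorial_le_exp x hx k
  rwa [div_le_iff₀' (by positivity)] at h

theorem verticalDecay_pow_mul_exp (k : ℕ) {A : ℝ} (hA : 0 < A) (B : ℝ) :
    VerticalDecay fun v => v ^ k * Complex.exp ((A : ℂ) * v ^ 2 + (B : ℂ) * v) := by
  refine ⟨by fun_prop, fun K => ⟨(Nat.factorial k : ℝ) * Real.exp K *
    Real.exp (A * K ^ 2 + |B| * K) * 2 * Real.exp A⁻¹, fun v hv => ?_⟩⟩
  have hK : 0 ≤ K := (abs_nonneg _).trans hv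
  set y := v.im with hy
  have hnv : ‖v‖ ≤ K + |y| := (Complex.norm_le_abs_re_add_abs_im v).trans (by linarith)
  have h1 : ‖v‖ ^ k ≤ (Nat.factorial k : ℝ) * (Real.exp K * Real.exp |y|) := by
    rw [← Real.exp_add]
    calc ‖v‖ ^ k ≤ (K + |y|) ^ k := by gcongr
      _ ≤ _ := pow_le_factorial_mul_exp (by positivity) k
  have h2 : A * (v.re ^ 2 - y ^ 2) + B * v.re ≤ (A * K ^ 2 + |B| * K) - A * y ^ 2 := by
    have e1 : v.re ^ 2 ≤ K ^ 2 := sq_le_sq' (by linarith [(abs_le.1 hv).1]) (abs_le.1 hv).2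
    have e2 : B * v.re ≤ |B| * K := by
      calc B * v.re ≤ |B * v.re| := le_abs_self _
        _ = |B| * |v.re| := abs_mul _ _
        _ ≤ _ := by gcongr
    nlinarith
  have h3 : Real.exp |y| * Real.exp |y| * Real.exp (-(A * y ^ 2)) ≤ Real.exp A⁻¹ := by
    rw [← Real.exp_add, ← Real.exp_add, Real.exp_le_exp]
    have e : 0 ≤ A * (|y| - A⁻¹) ^ 2 := by positivity
    have e2 : A * (|y| - A⁻¹) ^ 2 = A * y ^ 2 - 2 * |y| + A⁻¹ := by
      rw [sub_sq, sq_abs]; field_simp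
    linarith
  rw [norm_mul, norm_pow, norm_exp_quadratic, ← div_eq_mul_inv, le_div_iff₀ (by positivity)]
  calc ‖v‖ ^ k * Real.exp (A * (v.re ^ 2 - y ^ 2) + B * v.re) * (1 + y ^ 2)
      ≤ ((Nat.factorial k : ℝ) * (Real.exp K * Real.exp |y|)) *
        Real.exp ((A * K ^ 2 + |B| * K) - A * y ^ 2) * (2 * Real.exp |y|) := by
        gcongr
        exact one_add_sq_le_exp y
    _ = (Nat.factorial k : ℝ) * Real.exp K * Real.exp (A * K ^ 2 + |B| * K) * 2 *
        (Real.exp |y| * Real.exp |y| * Real.exp (-(A * y ^ 2))) := by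
        rw [sub_eq_add_neg, Real.exp_add]; ring
    _ ≤ _ := by gcongr

/-- The factor of the rescaled integrand that depends on the circle variable, up to a constant. -/
def circleFactor (a : ℝ) (N n : ℕ) (x : ℝ) (w : ℂ) : ℂ :=
  Complex.exp (((-(N / 2) : ℝ) : ℂ) * w ^ 2 + ((2 * N * a + x : ℝ) : ℂ) * w) / w ^ (N + n)

/-- The factor of the rescaled integrand that depends on the line variable, up to a constant. The
variable is scaled by `e^τ`, so that the denominator of the rescaled integrand is `v - w`. -/
def lineFactor (a : ℝ) (N n' : ℕ) (τ x' : ℝ) (v : ℂ) : ℂ :=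
  ((Real.exp (τ * (1 + n')) : ℝ) : ℂ) * (v ^ (N + n') *
    Complex.exp (((N * Real.exp (2 * τ) / 2 : ℝ) : ℂ) * v ^ 2 +
      ((-(Real.exp τ * (2 * N * a + x')) : ℝ) : ℂ) * v))

theorem VerticalDecay.const_mul {F : ℂ → ℂ} (hF : VerticalDecay F) (b : ℂ) :
    VerticalDecay fun v => b * F v := by
  refine ⟨hF.differentiable.const_mul b, fun K => ?_⟩
  obtain ⟨C, hC⟩ := hF.bound K
  refine ⟨‖b‖ * C, fun v hv => ?_⟩
  rw [norm_mul, mul_assoc]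
  exact mul_le_mul_of_nonneg_left (hC v hv) (norm_nonneg b)

theorem verticalDecay_lineFactor (a : ℝ) {N : ℕ} (hN : 0 < N) (n' : ℕ) (τ x' : ℝ) :
    VerticalDecay (lineFactor a N n' τ x') := by
  have hN' : (0 : ℝ) < N := by exact_mod_cast hN
  exact (verticalDecay_pow_mul_exp (N + n') (by positivity) _).const_mul _

theorem differentiableAt_circleFactor (a : ℝ) (N n : ℕ) (x : ℝ) {w : ℂ} (hw : w ≠ 0) :
    DifferentiableAt ℂ (circleFactor a N n x) w :=
  DifferentiableAt.div (by fun_prop) (by fun_prop) (pow_ne_zero _ hw)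

/-- On the unit circle the modulus is largest at `u₊` and `u₋`, where `cos θ = a`. -/
theorem norm_circleFactor_le (a : ℝ) (N n : ℕ) {x M : ℝ} (hx : |x| ≤ M) (θ : ℝ) :
    ‖circleFactor a N n x (Complex.exp ((θ : ℂ) * Complex.I))‖ ≤
      Real.exp (N * (a ^ 2 + 1 / 2)) * Real.exp M * Real.exp (-(N * (Real.cos θ - a) ^ 2)) := by
  rw [circleFactor, norm_div, norm_pow, Complex.norm_exp_ofReal_mul_I, one_pow, div_one,
    norm_exp_quadratic, exp_mul_I_re, Complex.exp_ofReal_mul_I_im, ← Real.exp_add, ← Real.exp_add,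
    Real.exp_le_exp, Real.sin_sq]
  have : x * Real.cos θ ≤ M := by
    calc x * Real.cos θ ≤ |x * Real.cos θ| := le_abs_self _
      _ = |x| * |Real.cos θ| := abs_mul _ _
      _ ≤ |x| * 1 := by gcongr; exact Real.abs_cos_le_one θ
      _ ≤ M := by linarith
  nlinarith

theorem mul_exp_half_le_one {ρ : ℝ} (hρ : 0 ≤ ρ) : ρ * Real.exp ((1 - ρ ^ 2) / 2) ≤ 1 := by
  have h1 : (ρ * Real.exp ((1 - ρ ^ 2) / 2)) ^ 2 ≤ 1 ^ 2 := by
    have h2 : ρ ^ 2 ≤ Real.exp (ρ ^ 2 - 1) := by linarith [Real.add_one_le_exp (ρ ^ 2 - 1)]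
    have h3 : Real.exp ((1 - ρ ^ 2) / 2) ^ 2 = Real.exp (-(ρ ^ 2 - 1)) := by
      rw [← Real.exp_nat_mul]
      congr 1
      push_cast
      ring
    rw [mul_pow, h3, one_pow, Real.exp_neg, ← div_eq_mul_inv]
    exact div_le_one_of_le₀ h2 (Real.exp_pos _).le
  exact (sq_le_sq₀ (by positivity) zero_le_one).1 h1

theorem pow_mul_pow_le_exp {ρ : ℝ} (hρ0 : 0 ≤ ρ) {N₀ N : ℕ} (hN : N₀ ≤ N) (j : ℕ) :
    (ρ * Real.exp ((1 - ρ ^ 2) / 2)) ^ N * ρ ^ j ≤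
      (Nat.factorial (N₀ + j) : ℝ) * Real.exp 1 * Real.exp (N₀ / 2) *
        Real.exp (ρ ^ 2 - N₀ / 2 * ρ ^ 2) := by
  have hρ1 : ρ ≤ 1 + ρ ^ 2 := by nlinarith [sq_nonneg (ρ - 1)]
  calc (ρ * Real.exp ((1 - ρ ^ 2) / 2)) ^ N * ρ ^ j
      ≤ (ρ * Real.exp ((1 - ρ ^ 2) / 2)) ^ N₀ * ρ ^ j :=
        mul_le_mul_of_nonneg_right
          (pow_le_pow_of_le_one (by positivity) (mul_exp_half_le_one hρ0) hN) (by positivity)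
    _ = ρ ^ (N₀ + j) * Real.exp (N₀ * ((1 - ρ ^ 2) / 2)) := by
        rw [mul_pow, ← Real.exp_nat_mul, pow_add]; ring
    _ ≤ (1 + ρ ^ 2) ^ (N₀ + j) * Real.exp (N₀ * ((1 - ρ ^ 2) / 2)) := by gcongr
    _ ≤ ((Nat.factorial (N₀ + j) : ℝ) * Real.exp (1 + ρ ^ 2)) *
        Real.exp (N₀ * ((1 - ρ ^ 2) / 2)) := by
        gcongr
        exact pow_le_factorial_mul_exp (by positivity) _
    _ = _ := by
        rw [mul_assoc, mul_assoc, mul_assoc, ← Real.exp_add, ← Real.exp_add, ← Real.exp_add]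
        congr 2
        ring

/-- On the vertical line with abscissa `a` the modulus of the `N`-th power is largest at `u₊` and
`u₋`, where `|v| = 1`, because `|v|² e^(1 - |v|²) ≤ 1`. A fixed number of the `N` factors controls
the remaining ones. -/
theorem exists_norm_lineFactor_le {a : ℝ} (ha : a ∈ Set.Ioo (-1 : ℝ) 1) (n' : ℕ) {M : ℝ}
    (hM : 0 ≤ M) :
    ∃ C : ℝ, 0 ≤ C ∧ ∃ N₀ : ℕ, ∀ N : ℕ, N₀ ≤ N → ∀ s x' : ℝ, |s| ≤ M → |x'| ≤ M → ∀ y : ℝ,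
      ‖lineFactor a N n' (s / (2 * N)) x' ((a : ℂ) + y * Complex.I)‖ ≤
        Real.exp (-(N * (a ^ 2 + 1 / 2))) * C * (1 + y ^ 2)⁻¹ := by
  obtain ⟨N₀, hN₀⟩ := exists_nat_ge (2 * M + 4)
  refine ⟨Real.exp (1 + n') * Real.exp (3 * M + Real.exp 1 * M) *
    ((Nat.factorial (N₀ + n') : ℝ) * Real.exp 1 * Real.exp (N₀ / 2)), by positivity, N₀,
    fun N hN s x' hs hx' y => ?_⟩
  have hNr : (N₀ : ℝ) ≤ N := by exact_mod_cast hN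
  have hN0 : (0 : ℝ) < N := by linarith
  have ha2 : a ^ 2 ≤ 1 := by nlinarith [ha.1, ha.2]
  have ha1 : |a| ≤ 1 := abs_le.2 ⟨ha.1.le, ha.2.le⟩
  set τ := s / (2 * N) with hτ
  have hτN : 2 * N * |τ| ≤ M := by
    rw [hτ, abs_div, abs_of_pos (by positivity : (0 : ℝ) < 2 * N), mul_div_cancel₀ _ (by positivity)]
    exact hs
  have hτ1 : 2 * |τ| ≤ 1 := by
    have : 2 * |τ| * N ≤ 1 * N := by linarith
    exact le_of_mul_le_mul_right this hN0
  have hτ2 : τ ≤ 1 := by linarith [le_abs_self τ, abs_nonneg τ]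
  have hs1 : |N * (Real.exp (2 * τ) - 1)| ≤ 2 * M := by
    have := Real.abs_exp_sub_one_le (x := 2 * τ) (by rwa [abs_mul, abs_two])
    rw [abs_mul, abs_two] at this
    rw [abs_mul, abs_of_pos hN0]
    nlinarith
  have hs2 : |2 * N * (Real.exp τ - 1)| ≤ 2 * M := by
    have := Real.abs_exp_sub_one_le (x := τ) (by linarith [abs_nonneg τ])
    rw [abs_mul, abs_of_pos (by positivity : (0 : ℝ) < 2 * N)]
    nlinarith
  set v : ℂ := (a : ℂ) + y * Complex.I with hv
  set ρ := ‖v‖ with hρ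
  have hρ0 : 0 ≤ ρ := norm_nonneg _
  have hρ2 : ρ ^ 2 = a ^ 2 + y ^ 2 := by
    rw [hρ, ← Complex.normSq_eq_norm_sq, Complex.normSq_apply]; simp [hv, sq]
  have hre : v.re = a := by simp [hv]
  have him : v.im = y := by simp [hv]
  set γ := ρ * Real.exp ((1 - ρ ^ 2) / 2) with hγ
  -- the exact modulus, with the part of order `N` in the exponent collected in `γ`
  have hnorm : ‖lineFactor a N n' τ x' v‖ = Real.exp (-(N * (a ^ 2 + 1 / 2))) *
      (Real.exp (τ * (1 + n')) * (γ ^ N * ρ ^ n') *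
        Real.exp (N * (Real.exp (2 * τ) - 1) / 2 * (a ^ 2 - y ^ 2) -
          2 * N * (Real.exp τ - 1) * a ^ 2 - Real.exp τ * x' * a)) := by
    rw [lineFactor, norm_mul, norm_mul, norm_pow, norm_exp_quadratic, hre, him, ← hρ,
      Complex.norm_real, Real.norm_of_nonneg (Real.exp_pos _).le, hγ, mul_pow, ← Real.exp_nat_mul,
      pow_add]
    have : Real.exp (N * Real.exp (2 * τ) / 2 * (a ^ 2 - y ^ 2) +
        -(Real.exp τ * (2 * N * a + x')) * a) =
        Real.exp (-(N * (a ^ 2 + 1 / 2))) * Real.exp (N * ((1 - ρ ^ 2) / 2)) *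
        Real.exp (N * (Real.exp (2 * τ) - 1) / 2 * (a ^ 2 - y ^ 2) -
          2 * N * (Real.exp τ - 1) * a ^ 2 - Real.exp τ * x' * a) := by
      rw [← Real.exp_add, ← Real.exp_add, hρ2]
      congr 1
      ring
    rw [this]
    ring
  have e1 : Real.exp (τ * (1 + n')) ≤ Real.exp (1 + n') := by
    rw [Real.exp_le_exp]
    have : (0 : ℝ) ≤ 1 + n' := by positivity
    nlinarith
  have e2 : N * (Real.exp (2 * τ) - 1) / 2 * (a ^ 2 - y ^ 2) -
      2 * N * (Real.exp τ - 1) * a ^ 2 - Real.exp τ * x' * a ≤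
      (3 * M + Real.exp 1 * M) + M * ρ ^ 2 := by
    have f1 : N * (Real.exp (2 * τ) - 1) / 2 * (a ^ 2 - y ^ 2) ≤ M * ρ ^ 2 + M := by
      have : |a ^ 2 - y ^ 2| ≤ ρ ^ 2 := by
        rw [hρ2, abs_le]; constructor <;> nlinarith [sq_nonneg a, sq_nonneg y]
      calc _ ≤ |N * (Real.exp (2 * τ) - 1) / 2 * (a ^ 2 - y ^ 2)| := le_abs_self _
        _ = |N * (Real.exp (2 * τ) - 1)| / 2 * |a ^ 2 - y ^ 2| := by
          rw [abs_mul, abs_div, abs_two]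
        _ ≤ 2 * M / 2 * ρ ^ 2 := by gcongr
        _ ≤ _ := by linarith
    have f2 : -(2 * N * (Real.exp τ - 1) * a ^ 2) ≤ 2 * M := by
      calc _ ≤ |2 * N * (Real.exp τ - 1) * a ^ 2| := neg_le_abs _
        _ = |2 * N * (Real.exp τ - 1)| * a ^ 2 := by rw [abs_mul, abs_of_nonneg (sq_nonneg a)]
        _ ≤ 2 * M * 1 := by gcongr
        _ = _ := mul_one _
    have f3 : -(Real.exp τ * x' * a) ≤ Real.exp 1 * M := by
      calc _ ≤ |Real.exp τ * x' * a| := neg_le_abs _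
        _ = Real.exp τ * |x'| * |a| := by rw [abs_mul, abs_mul, abs_of_pos (Real.exp_pos _)]
        _ ≤ Real.exp 1 * M * 1 := by gcongr
        _ = _ := mul_one _
    linarith
  have e3 : γ ^ N * ρ ^ n' ≤ (Nat.factorial (N₀ + n') : ℝ) * Real.exp 1 * Real.exp (N₀ / 2) *
      Real.exp (ρ ^ 2 - N₀ / 2 * ρ ^ 2) := by
    exact pow_mul_pow_le_exp hρ0 hN n'
  have e4 : Real.exp (ρ ^ 2 - N₀ / 2 * ρ ^ 2) * Real.exp (M * ρ ^ 2) ≤ (1 + y ^ 2)⁻¹ := by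
    rw [← Real.exp_add]
    calc _ ≤ Real.exp (-ρ ^ 2) := by
          rw [Real.exp_le_exp]
          have := mul_le_mul_of_nonneg_right hN₀ (sq_nonneg ρ)
          linarith
      _ = (Real.exp (ρ ^ 2))⁻¹ := Real.exp_neg _
      _ ≤ (1 + y ^ 2)⁻¹ := by
          refine inv_anti₀ (by positivity) ?_
          linarith [Real.add_one_le_exp (ρ ^ 2), sq_nonneg a]
  rw [hnorm, mul_assoc (Real.exp (-(N * (a ^ 2 + 1 / 2))))]
  refine mul_le_mul_of_nonneg_left ?_ (Real.exp_pos _).le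
  calc _ ≤ Real.exp (1 + n') * ((Nat.factorial (N₀ + n') : ℝ) * Real.exp 1 * Real.exp (N₀ / 2) *
        Real.exp (ρ ^ 2 - N₀ / 2 * ρ ^ 2)) *
        Real.exp ((3 * M + Real.exp 1 * M) + M * ρ ^ 2) := by gcongr
    _ = Real.exp (1 + n') * Real.exp (3 * M + Real.exp 1 * M) *
        ((Nat.factorial (N₀ + n') : ℝ) * Real.exp 1 * Real.exp (N₀ / 2)) *
        (Real.exp (ρ ^ 2 - N₀ / 2 * ρ ^ 2) * Real.exp (M * ρ ^ 2)) := by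
        rw [Real.exp_add (3 * M + Real.exp 1 * M)]; ring
    _ ≤ _ := by gcongr

/-- The double integral over the crossing contours is negligible, so that only the residues along
the arc survive. -/
theorem exists_norm_doubleIntegral_sub_le {a : ℝ} (ha : a ∈ Set.Ioo (-1 : ℝ) 1) (n n' : ℕ) {M : ℝ}
    (hM : 0 ≤ M) :
    ∃ η : ℕ → ℝ, Tendsto η atTop (𝓝 0) ∧ ∀ᶠ N : ℕ in atTop, ∀ s x x' : ℝ, |s| ≤ M → |x| ≤ M →
      |x'| ≤ M →
      ‖circleIntegral (fun u => circleFactor a N n x u *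
          lineCauchy (lineFactor a N n' (s / (2 * N)) x') 2 u) 0 1 -
        2 * Real.pi * arcIntegral a (fun u => circleFactor a N n x u *
          lineFactor a N n' (s / (2 * N)) x' u)‖ ≤ η N := by
  obtain ⟨C, hC0, N₀, hC⟩ := exists_norm_lineFactor_le ha n' hM
  refine ⟨fun N => Real.exp M * C * Real.pi * ∫ θ in (-Real.pi)..Real.pi,
    Real.exp (-(N * (Real.cos θ - a) ^ 2)) * (Real.sqrt |Real.cos θ - a|)⁻¹, ?_, ?_⟩
  · simpa using (tendsto_integral_exp_mul_inv_sqrt ha).const_mul (Real.exp M * C * Real.pi)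
  filter_upwards [eventually_ge_atTop N₀, eventually_gt_atTop 0] with N hN hN0 s x x' hs hx hx'
  rw [← intervalIntegral.integral_const_mul]
  refine (verticalDecay_lineFactor a hN0 n' _ x').norm_circleIntegral_sub_arcIntegral_le
    (fun z hz => differentiableAt_circleFactor a N n x hz) ha (by norm_num)
    ((intervalIntegrable_exp_mul_inv_sqrt ha N).const_mul _) fun θ hθ => ?_
  have h1 := norm_circleFactor_le a N n hx θ
  have h2 := norm_lineCauchy_le (by positivity) (hC N hN s x' hs hx')
    (w := Complex.exp ((θ : ℂ) * Complex.I)) (by rwa [exp_mul_I_re])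
  rw [exp_mul_I_re] at h2
  rw [norm_mul]
  calc _ ≤ (Real.exp (N * (a ^ 2 + 1 / 2)) * Real.exp M *
        Real.exp (-(N * (Real.cos θ - a) ^ 2))) *
        (Real.exp (-(N * (a ^ 2 + 1 / 2))) * C * Real.pi * (Real.sqrt |Real.cos θ - a|)⁻¹) := by
        gcongr
    _ = (Real.exp (N * (a ^ 2 + 1 / 2)) * Real.exp (-(N * (a ^ 2 + 1 / 2)))) *
        (Real.exp M * C * Real.pi * (Real.exp (-(N * (Real.cos θ - a) ^ 2)) *
          (Real.sqrt |Real.cos θ - a|)⁻¹)) := by ring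
    _ = _ := by rw [← Real.exp_add, add_neg_cancel, Real.exp_zero, one_mul]

/-! ### Rescaling the double contour integral -/

theorem dbmIntegral_eq (m m' : ℕ) (X X' T T' : ℝ) :
    dbmIntegral (m, X, T) (m', X', T') =
      Complex.I * ((Real.exp (T' - T) : ℝ) : ℂ) *
        circleIntegral (fun u => Complex.exp (-u ^ 2 + 2 * u * X) / u ^ m *
          lineCauchy (fun v => (((Real.exp (T' - T) : ℝ) : ℂ) * v) ^ m' *
            Complex.exp ((((Real.exp (T' - T) : ℝ) : ℂ) * v) ^ 2 -
              2 * (((Real.exp (T' - T) : ℝ) : ℂ) * v) * X')) (1 + Real.exp (-(T' - T))) u) 0 1 := by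
  set τ := T' - T with hτ
  have hE : 0 < Real.exp τ := Real.exp_pos τ
  have hEE : ((Real.exp τ : ℝ) : ℂ) * ((Real.exp (-τ) : ℝ) : ℂ) = 1 := by
    rw [← Complex.ofReal_mul, ← Real.exp_add, add_neg_cancel, Real.exp_zero, Complex.ofReal_one]
  have hE0 : ((Real.exp τ : ℝ) : ℂ) ≠ 0 := by exact_mod_cast hE.ne'
  rw [dbmIntegral, ← smul_eq_mul, ← circleIntegral.integral_smul]
  refine circleIntegral.integral_congr zero_le_one fun u _ => ?_
  rw [← hτ]
  set f : ℂ → ℂ := fun v => v ^ m' / u ^ m *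
    (Complex.exp (-u ^ 2 + 2 * u * X + v ^ 2 - 2 * v * X') /
      (((Real.exp (-τ) : ℝ) : ℂ) * v - u)) with hf
  have h := MeasureTheory.Measure.integral_comp_mul_left
    (fun y : ℝ => f (((1 + Real.exp τ : ℝ) : ℂ) + (y : ℂ) * Complex.I)) (Real.exp τ)
  rw [abs_of_pos (inv_pos.2 hE), Complex.real_smul] at h
  have h2 : (∫ y : ℝ, f (((1 + Real.exp τ : ℝ) : ℂ) + (y : ℂ) * Complex.I)) =
      ((Real.exp τ : ℝ) : ℂ) * ∫ y : ℝ,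
        f (((1 + Real.exp τ : ℝ) : ℂ) + ((Real.exp τ * y : ℝ) : ℂ) * Complex.I) := by
    rw [h, Complex.ofReal_inv, ← mul_assoc, mul_inv_cancel₀ hE0, one_mul]
  change Complex.I * (∫ y : ℝ, f (((1 + Real.exp τ : ℝ) : ℂ) + (y : ℂ) * Complex.I)) = _
  rw [h2, smul_eq_mul, lineCauchy, mul_assoc]
  congr 2
  rw [← MeasureTheory.integral_const_mul]
  refine MeasureTheory.integral_congr_ae (MeasureTheory.ae_of_all _ fun y => ?_)
  have e : ((1 + Real.exp τ : ℝ) : ℂ) + ((Real.exp τ * y : ℝ) : ℂ) * Complex.I =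
      ((Real.exp τ : ℝ) : ℂ) * (((1 + Real.exp (-τ) : ℝ) : ℂ) + y * Complex.I) := by
    rw [mul_add, ← Complex.ofReal_mul, mul_add, mul_one, ← Real.exp_add, add_neg_cancel,
      Real.exp_zero, add_comm (Real.exp τ) 1]
    push_cast
    ring
  set z : ℂ := ((1 + Real.exp (-τ) : ℝ) : ℂ) + y * Complex.I with hz
  simp only [e, hf]
  have e2 : ((Real.exp (-τ) : ℝ) : ℂ) * (((Real.exp τ : ℝ) : ℂ) * z) - u = z - u := by
    rw [← mul_assoc, mul_comm ((Real.exp (-τ) : ℝ) : ℂ), hEE, one_mul]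
  rw [e2, add_sub_assoc, Complex.exp_add]
  ring

theorem lineCauchy_const_mul (b : ℂ) (F : ℂ → ℂ) (c : ℝ) (w : ℂ) :
    lineCauchy (fun v => b * F v) c w = b * lineCauchy F c w := by
  simp only [lineCauchy, mul_div_assoc, MeasureTheory.integral_const_mul]

theorem half_mul_self {N : ℕ} : Real.sqrt (N / 2) * Real.sqrt (N / 2) = N / 2 :=
  Real.mul_self_sqrt (by positivity)

theorem two_mul_sqrt_mul_position (a : ℝ) {N : ℕ} (hN : 0 < N) (x : ℝ) :
    2 * Real.sqrt (N / 2) * (Real.sqrt (2 * N) * a + x / Real.sqrt (2 * N)) = 2 * N * a + x := by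
  have hN' : (0 : ℝ) < N := by exact_mod_cast hN
  have h3 : 0 < Real.sqrt (2 * N) := Real.sqrt_pos.2 (by positivity)
  have h2 : 2 * Real.sqrt (N / 2) = Real.sqrt (2 * N) := by
    rw [eq_comm, Real.sqrt_eq_iff_mul_self_eq (by positivity) (by positivity)]
    linear_combination -4 * half_mul_self (N := N)
  rw [h2]
  field_simp
  rw [Real.sq_sqrt (by positivity)]

theorem circleFactor_scale (a : ℝ) {N : ℕ} (hN : 0 < N) (n : ℕ) (x : ℝ) (w : ℂ) :
    Complex.exp (-(((Real.sqrt (N / 2) : ℝ) : ℂ) * w) ^ 2 +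
        2 * (((Real.sqrt (N / 2) : ℝ) : ℂ) * w) *
          ((Real.sqrt (2 * N) * a + x / Real.sqrt (2 * N) : ℝ) : ℂ)) /
        (((Real.sqrt (N / 2) : ℝ) : ℂ) * w) ^ (N + n) =
      (((Real.sqrt (N / 2) ^ (N + n))⁻¹ : ℝ) : ℂ) * circleFactor a N n x w := by
  have hN' : (0 : ℝ) < N := by exact_mod_cast hN
  have h1 := congrArg (fun z : ℝ => (z : ℂ)) (half_mul_self (N := N))
  have h5 := congrArg (fun z : ℝ => (z : ℂ)) (two_mul_sqrt_mul_position a hN x)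
  simp only [Complex.ofReal_mul, Complex.ofReal_ofNat, Complex.ofReal_div] at h1 h5
  have he : -(((Real.sqrt (N / 2) : ℝ) : ℂ) * w) ^ 2 + 2 * (((Real.sqrt (N / 2) : ℝ) : ℂ) * w) *
      ((Real.sqrt (2 * N) * a + x / Real.sqrt (2 * N) : ℝ) : ℂ) =
      ((-(N / 2) : ℝ) : ℂ) * w ^ 2 + ((2 * N * a + x : ℝ) : ℂ) * w := by
    simp only [Complex.ofReal_neg, Complex.ofReal_div, Complex.ofReal_ofNat]
    linear_combination (-w ^ 2) * h1 + w * h5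
  rw [he, circleFactor, mul_pow, Complex.ofReal_inv, Complex.ofReal_pow]
  field_simp

theorem lineFactor_scale (a : ℝ) {N : ℕ} (hN : 0 < N) (n' : ℕ) (τ x' : ℝ) (v : ℂ) :
    (((Real.exp τ : ℝ) : ℂ) * (((Real.sqrt (N / 2) : ℝ) : ℂ) * v)) ^ (N + n') *
        Complex.exp ((((Real.exp τ : ℝ) : ℂ) * (((Real.sqrt (N / 2) : ℝ) : ℂ) * v)) ^ 2 -
          2 * (((Real.exp τ : ℝ) : ℂ) * (((Real.sqrt (N / 2) : ℝ) : ℂ) * v)) *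
            ((Real.sqrt (2 * N) * a + x' / Real.sqrt (2 * N) : ℝ) : ℂ)) =
      (((Real.exp τ * Real.sqrt (N / 2)) ^ (N + n') * Real.exp (-(τ * (1 + n'))) : ℝ) : ℂ) *
        lineFactor a N n' τ x' v := by
  have hN' : (0 : ℝ) < N := by exact_mod_cast hN
  have h1 := congrArg (fun z : ℝ => (z : ℂ)) (half_mul_self (N := N))
  have h5 := congrArg (fun z : ℝ => (z : ℂ)) (two_mul_sqrt_mul_position a hN x')
  simp only [Complex.ofReal_mul, Complex.ofReal_ofNat, Complex.ofReal_div] at h1 h5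
  have h6 : ((Real.exp (2 * τ) : ℝ) : ℂ) = ((Real.exp τ : ℝ) : ℂ) * ((Real.exp τ : ℝ) : ℂ) := by
    rw [← Complex.ofReal_mul, ← Real.exp_add, ← two_mul]
  have he : (((Real.exp τ : ℝ) : ℂ) * (((Real.sqrt (N / 2) : ℝ) : ℂ) * v)) ^ 2 -
      2 * (((Real.exp τ : ℝ) : ℂ) * (((Real.sqrt (N / 2) : ℝ) : ℂ) * v)) *
        ((Real.sqrt (2 * N) * a + x' / Real.sqrt (2 * N) : ℝ) : ℂ) =
      ((N * Real.exp (2 * τ) / 2 : ℝ) : ℂ) * v ^ 2 +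
        ((-(Real.exp τ * (2 * N * a + x')) : ℝ) : ℂ) * v := by
    simp only [Complex.ofReal_neg, Complex.ofReal_div, Complex.ofReal_ofNat, Complex.ofReal_mul, h6]
    linear_combination ((Real.exp τ : ℂ) * v) ^ 2 * h1 - (Real.exp τ : ℂ) * v * h5
  have h7 : ((Real.exp (-(τ * (1 + n'))) : ℝ) : ℂ) * ((Real.exp (τ * (1 + n')) : ℝ) : ℂ) = 1 := by
    rw [← Complex.ofReal_mul, ← Real.exp_add, neg_add_cancel, Real.exp_zero, Complex.ofReal_one]
  rw [he, lineFactor]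
  simp only [mul_pow, Complex.ofReal_mul, Complex.ofReal_pow]
  linear_combination (-((Real.exp τ : ℂ) ^ (N + n') * (Real.sqrt (N / 2) : ℂ) ^ (N + n') *
    (v ^ (N + n') * Complex.exp (((N * Real.exp (2 * τ) / 2 : ℝ) : ℂ) * v ^ 2 +
      ((-(Real.exp τ * (2 * N * a + x')) : ℝ) : ℂ) * v)))) * h7

theorem scalar_identity {N : ℕ} (hN : 0 < N) (n n' : ℕ) (τ : ℝ) :
    Real.exp (-(N * τ)) * (N : ℝ) ^ (((n : ℝ) - (n' : ℝ)) / 2) * (2 * (N : ℝ)) ^ (-(1 / 2) : ℝ) *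
      (2 : ℝ) ^ ((((N + n' : ℕ) : ℝ) - ((N + n : ℕ) : ℝ)) / 2) * 2 * Real.exp τ *
      Real.sqrt (N / 2) * (Real.sqrt (N / 2) ^ (N + n))⁻¹ *
      ((Real.exp τ * Real.sqrt (N / 2)) ^ (N + n') * Real.exp (-(τ * (1 + n')))) = 1 := by
  have hN' : (0 : ℝ) < N := by exact_mod_cast hN
  obtain ⟨L, hL⟩ : ∃ L, (N : ℝ) = Real.exp L := ⟨Real.log N, (Real.exp_log hN').symm⟩
  obtain ⟨l, hl⟩ : ∃ l, (2 : ℝ) = Real.exp l := ⟨Real.log 2, (Real.exp_log two_pos).symm⟩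
  have hs : Real.sqrt (N / 2) = Real.exp ((L - l) / 2) := by
    rw [Real.sqrt_eq_iff_mul_self_eq (by positivity) (by positivity), ← Real.exp_add, hL]
    rw [add_halves, Real.exp_sub, ← hl]
  have h1 : (N : ℝ) ^ (((n : ℝ) - (n' : ℝ)) / 2) = Real.exp (L * (((n : ℝ) - (n' : ℝ)) / 2)) := by
    rw [Real.exp_mul, ← hL]
  have h2 : (2 * (N : ℝ)) ^ (-(1 / 2) : ℝ) = Real.exp ((l + L) * (-(1 / 2))) := by
    rw [Real.exp_mul, Real.exp_add, ← hL, ← hl]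
  have h3 : (2 : ℝ) ^ ((((N + n' : ℕ) : ℝ) - ((N + n : ℕ) : ℝ)) / 2) =
      Real.exp (l * (((n' : ℝ) - n) / 2)) := by
    rw [Real.exp_mul, ← hl]
    congr 1
    push_cast
    ring
  have h4 : Real.exp (-(N * τ)) * Real.exp (L * (((n : ℝ) - (n' : ℝ)) / 2)) *
      Real.exp ((l + L) * (-(1 / 2))) * Real.exp (l * (((n' : ℝ) - n) / 2)) * Real.exp l *
      Real.exp τ * Real.exp ((L - l) / 2) * (Real.exp ((L - l) / 2) ^ (N + n))⁻¹ *
      ((Real.exp τ * Real.exp ((L - l) / 2)) ^ (N + n') * Real.exp (-(τ * (1 + n')))) = 1 := by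
    simp only [← Real.exp_add, ← Real.exp_nat_mul, ← Real.exp_neg]
    rw [Real.exp_eq_one_iff]
    push_cast
    ring
  rw [h1, h2, h3, hs]
  rw [← hl] at h4
  exact h4

/-- The rescaled kernel, with the contours enlarged by the factor `√(N/2)`. -/
theorem rescaledDbmKernel_eq (a : ℝ) {N : ℕ} (hN : 2 ≤ N) (n n' : ℕ) (x x' t t' : ℝ) :
    rescaledDbmKernel a N (n, x, t) (n', x', t') =
      -((Real.exp (-((N : ℝ) * (t' / (2 * N) - t / (2 * N)))) *
        (N : ℝ) ^ (((n : ℝ) - (n' : ℝ)) / 2) * (2 * (N : ℝ)) ^ (-(1 / 2) : ℝ) *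
        dbmPhi (rescalePoint a N (n, x, t)) (rescalePoint a N (n', x', t')) : ℝ) : ℂ) +
      1 / (2 * (Real.pi : ℂ) * Complex.I) * (1 / (2 * (Real.pi : ℂ))) *
        circleIntegral (fun u => circleFactor a N n x u *
          lineCauchy (lineFactor a N n' ((t' - t) / (2 * N)) x') 2 u) 0 1 := by
  have hN0 : 0 < N := by omega
  have hN' : (0 : ℝ) < N := by exact_mod_cast hN0
  have hτ : t' / (2 * N) - t / (2 * N) = (t' - t) / (2 * N) := by ring
  have hr1 : 1 ≤ Real.sqrt (N / 2) := by
    rw [Real.one_le_sqrt, le_div_iff₀ two_pos, one_mul]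
    exact_mod_cast hN
  have hr0 : 0 < Real.sqrt (N / 2) := by linarith
  have hscal := scalar_identity hN0 n n' ((t' - t) / (2 * N))
  have hdbm := dbmIntegral_eq (N + n) (N + n') (Real.sqrt (2 * N) * a + x / Real.sqrt (2 * N))
    (Real.sqrt (2 * N) * a + x' / Real.sqrt (2 * N)) (t / (2 * N)) (t' / (2 * N))
  simp only [rescaledDbmKernel, rescalePoint, dbmKernel]
  rw [hτ] at hdbm ⊢
  set τ := (t' - t) / (2 * N) with hτdef
  set r := Real.sqrt (N / 2) with hr
  set X := Real.sqrt (2 * N) * a + x / Real.sqrt (2 * N) with hX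
  set X' := Real.sqrt (2 * N) * a + x' / Real.sqrt (2 * N) with hX'
  set F : ℂ → ℂ := fun v => (((Real.exp τ : ℝ) : ℂ) * v) ^ (N + n') *
    Complex.exp ((((Real.exp τ : ℝ) : ℂ) * v) ^ 2 -
      2 * (((Real.exp τ : ℝ) : ℂ) * v) * X') with hF
  set g : ℂ → ℂ := fun u => Complex.exp (-u ^ 2 + 2 * u * X) / u ^ (N + n) with hg
  have hFd : VerticalDecay F := by
    have h := (verticalDecay_pow_mul_exp (N + n') (A := Real.exp τ ^ 2) (by positivity)
      (-(2 * Real.exp τ * X'))).const_mul (((Real.exp τ : ℝ) : ℂ) ^ (N + n'))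
    convert! h using 2 with v
    simp only [hF]
    rw [mul_pow, mul_assoc]
    congr 3
    push_cast
    ring
  have hgd : ∀ z, z ≠ 0 → DifferentiableAt ℂ g z := fun z hz =>
    DifferentiableAt.div (by fun_prop) (by fun_prop) (pow_ne_zero _ hz)
  have hint : circleIntegral (fun u => g u * lineCauchy F (1 + Real.exp (-τ)) u) 0 1 =
      r * ((((r ^ (N + n))⁻¹ : ℝ) : ℂ) *
        (((Real.exp τ * r) ^ (N + n') * Real.exp (-(τ * (1 + n'))) : ℝ) : ℂ)) *
        circleIntegral (fun u => circleFactor a N n x u *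
          lineCauchy (lineFactor a N n' τ x') 2 u) 0 1 := by
    rw [hFd.circleIntegral_line_shift g zero_le_one (c' := r * 2)
      (by linarith [Real.exp_pos (-τ)]) (by linarith),
      ← hFd.circleIntegral_circle_shift hgd zero_lt_one hr1 (by linarith),
      circleIntegral_scale, mul_assoc]
    congr 1
    rw [← smul_eq_mul (a := (Complex.ofReal _ * _)), ← circleIntegral.integral_smul]
    refine circleIntegral.integral_congr zero_le_one fun w _ => ?_
    have h1 : g (r * w) = (((r ^ (N + n))⁻¹ : ℝ) : ℂ) * circleFactor a N n x w :=
      circleFactor_scale a hN0 n x w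
    have h2 : (fun v : ℂ => F (r * v)) = fun v =>
        (((Real.exp τ * r) ^ (N + n') * Real.exp (-(τ * (1 + n'))) : ℝ) : ℂ) *
          lineFactor a N n' τ x' v := funext fun v => lineFactor_scale a hN0 n' τ x' v
    change g (r * w) * lineCauchy F (r * 2) (r * w) = _
    rw [lineCauchy_scale F hr0, h1, h2, lineCauchy_const_mul, smul_eq_mul]
    ring
  rw [hint] at hdbm
  rw [hdbm]
  set D := circleIntegral (fun u => circleFactor a N n x u *
    lineCauchy (lineFactor a N n' τ x') 2 u) 0 1 with hD
  have hscalC := congrArg (fun z : ℝ => (z : ℂ)) hscal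
  have hI := Complex.I_ne_zero
  have hpi : (Real.pi : ℂ) ≠ 0 := by exact_mod_cast Real.pi_ne_zero
  have hc : (2 : ℂ) / (2 * (Real.pi : ℂ) * Complex.I) ^ 2 * Complex.I =
      1 / (2 * (Real.pi : ℂ) * Complex.I) * (1 / (2 * (Real.pi : ℂ))) * 2 := by
    field_simp
  rw [mul_add, mul_neg, ← Complex.ofReal_mul]
  congr 1
  simp only [Complex.ofReal_mul, Complex.ofReal_one, Complex.ofReal_ofNat] at hscalC ⊢
  linear_combination (1 / (2 * (Real.pi : ℂ) * Complex.I) * (1 / (2 * (Real.pi : ℂ))) * D) *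
    hscalC + (((Real.exp (-(N * τ)) : ℝ) : ℂ) * (((N : ℝ) ^ (((n : ℝ) - (n' : ℝ)) / 2) : ℝ) : ℂ) *
      (((2 * (N : ℝ)) ^ (-(1 / 2) : ℝ) : ℝ) : ℂ) *
      (((2 : ℝ) ^ ((((N + n' : ℕ) : ℝ) - ((N + n : ℕ) : ℝ)) / 2) : ℝ) : ℂ) *
      ((Real.exp τ : ℝ) : ℂ) * (r : ℂ) * (((r ^ (N + n))⁻¹ : ℝ) : ℂ) *
      ((((Real.exp τ * r) ^ (N + n') : ℝ) : ℂ) * ((Real.exp (-(τ * (1 + n'))) : ℝ) : ℂ)) * D) * hc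

/-! ### Convergence of the residues along the arc -/

/-- On the diagonal the factors of order `e^N` cancel. -/
theorem circleFactor_mul_lineFactor (a : ℝ) (N n n' : ℕ) (τ x x' t t' : ℝ)
    (hτ : 2 * N * τ = t' - t) {w : ℂ} (hw : w ≠ 0) :
    circleFactor a N n x w * lineFactor a N n' τ x' w =
      beadIntegrand a (n, x, t) (n', x', t') w *
        Complex.exp (((τ * (1 + n') : ℝ) : ℂ) +
          ((N / 2 * (Real.exp (2 * τ) - 1 - 2 * τ) : ℝ) : ℂ) * w ^ 2 -
          ((2 * N * a * (Real.exp τ - 1 - τ) + (Real.exp τ - 1) * x' : ℝ) : ℂ) * w) := by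
  have hp : w ^ (N + n') / w ^ (N + n) = w ^ ((n' : ℤ) - (n : ℤ)) := by
    rw [zpow_sub₀ hw, zpow_natCast, zpow_natCast, pow_add, pow_add,
      mul_div_mul_left _ _ (pow_ne_zero _ hw)]
  have e : circleFactor a N n x w * lineFactor a N n' τ x' w =
      w ^ (N + n') / w ^ (N + n) * (((Real.exp (τ * (1 + n')) : ℝ) : ℂ) *
        (Complex.exp (((-(N / 2) : ℝ) : ℂ) * w ^ 2 + ((2 * N * a + x : ℝ) : ℂ) * w) *
        Complex.exp (((N * Real.exp (2 * τ) / 2 : ℝ) : ℂ) * w ^ 2 +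
          ((-(Real.exp τ * (2 * N * a + x')) : ℝ) : ℂ) * w))) := by
    rw [circleFactor, lineFactor]
    ring
  rw [e, hp, beadIntegrand, mul_assoc (w ^ _), Complex.ofReal_exp, ← Complex.exp_add, ← Complex.exp_add,
    ← Complex.exp_add, ← hτ]
  congr 2
  push_cast
  ring

theorem exists_arcIntegral_sub_le {a : ℝ} (ha : a ∈ Set.Ioo (-1 : ℝ) 1) (n n' : ℕ) {M : ℝ}
    (hM : 0 ≤ M) :
    ∃ η : ℕ → ℝ, Tendsto η atTop (𝓝 0) ∧ ∀ᶠ N : ℕ in atTop, ∀ x x' t t' : ℝ, |t' - t| ≤ M →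
      |x| ≤ M → |x'| ≤ M →
      ‖arcIntegral a (fun u => circleFactor a N n x u *
          lineFactor a N n' ((t' - t) / (2 * N)) x' u) -
        arcIntegral a (beadIntegrand a (n, x, t) (n', x', t'))‖ ≤ η N := by
  set D : ℝ := M / 2 * (1 + n' + 4 * M) with hD
  have hD0 : 0 ≤ D := by positivity
  refine ⟨fun N => Real.exp (4 * M) * (2 * (D / N)) * (2 * Real.arccos a), ?_, ?_⟩
  · have h : Tendsto (fun N : ℕ => D / (N : ℝ)) atTop (𝓝 0) :=
      tendsto_const_nhds.div_atTop tendsto_natCast_atTop_atTop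
    simpa using ((h.const_mul 2).const_mul (Real.exp (4 * M))).mul_const (2 * Real.arccos a)
  obtain ⟨N₀, hN₀⟩ := exists_nat_ge (D + M + 1)
  filter_upwards [eventually_ge_atTop N₀] with N hN x x' t t' ht hx hx'
  have hNr : D + M + 1 ≤ N := hN₀.trans (by exact_mod_cast hN)
  have hN0 : (0 : ℝ) < N := by linarith
  have ha1 : |a| ≤ 1 := abs_le.2 ⟨ha.1.le, ha.2.le⟩
  set τ := (t' - t) / (2 * N) with hτ
  have hτN : 2 * N * τ = t' - t := by rw [hτ]; field_simp
  have hτs : 2 * N * |τ| ≤ M := by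
    rw [← abs_of_pos (by positivity : (0 : ℝ) < 2 * N), ← abs_mul, hτN]
    exact ht
  have hτ1 : 2 * |τ| ≤ 1 := by
    have : 2 * |τ| * N ≤ 1 * N := by linarith
    exact le_of_mul_le_mul_right this hN0
  have hτ0 := abs_nonneg τ
  have hτD : |τ| * (1 + n' + 4 * M) ≤ D / N := by
    rw [le_div_iff₀ hN0, hD]
    have : (0 : ℝ) ≤ 1 + n' + 4 * M := by positivity
    nlinarith
  have hcont1 : ContinuousOn (fun u => circleFactor a N n x u * lineFactor a N n' τ x' u) {0}ᶜ :=
    fun z hz => ((differentiableAt_circleFactor a N n x hz).mul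
      ((verticalDecay_lineFactor a (by exact_mod_cast hN0) n' τ x').differentiable
        z)).continuousAt.continuousWithinAt
  have hcont2 : ContinuousOn (beadIntegrand a (n, x, t) (n', x', t')) {0}ᶜ :=
    fun z hz => (differentiableAt_beadIntegrand a _ _ (Or.inl hz)).continuousAt.continuousWithinAt
  have hint : ∀ {f : ℂ → ℂ}, ContinuousOn f {0}ᶜ → IntervalIntegrable
      (fun θ : ℝ => f (Complex.exp ((θ : ℂ) * Complex.I)) *
        (Complex.I * Complex.exp ((θ : ℂ) * Complex.I))) MeasureTheory.volume
      (-Real.arccos a) (Real.arccos a) := fun {f} hf => by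
    refine Continuous.intervalIntegrable (Continuous.mul ?_ (by fun_prop)) _ _
    exact hf.comp_continuous (by fun_prop) fun θ => by simp [Complex.exp_ne_zero]
  rw [arcIntegral, arcIntegral, ← intervalIntegral.integral_sub (hint hcont1) (hint hcont2)]
  refine (intervalIntegral.norm_integral_le_of_norm_le_const
    (C := Real.exp (4 * M) * (2 * (D / N))) fun θ _ => ?_).trans (le_of_eq ?_)
  · set w := Complex.exp ((θ : ℂ) * Complex.I) with hw
    have hw0 : w ≠ 0 := Complex.exp_ne_zero _
    have hw1 : ‖w‖ = 1 := Complex.norm_exp_ofReal_mul_I θ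
    rw [circleFactor_mul_lineFactor a N n n' τ x x' t t' hτN hw0, ← sub_mul, norm_mul, norm_mul,
      Complex.norm_I, hw1, one_mul, mul_one]
    set E : ℂ := ((τ * (1 + n') : ℝ) : ℂ) +
      ((N / 2 * (Real.exp (2 * τ) - 1 - 2 * τ) : ℝ) : ℂ) * w ^ 2 -
      ((2 * N * a * (Real.exp τ - 1 - τ) + (Real.exp τ - 1) * x' : ℝ) : ℂ) * w with hE
    have hEn : ‖E‖ ≤ D / N := by
      refine le_trans ?_ hτD
      have h1 : |τ * (1 + n')| = |τ| * (1 + n') := by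
        rw [abs_mul, abs_of_nonneg (by positivity : (0 : ℝ) ≤ 1 + n')]
      have h2 : |N / 2 * (Real.exp (2 * τ) - 1 - 2 * τ)| ≤ |τ| * M := by
        have := Real.abs_exp_sub_one_sub_id_le (x := 2 * τ) (by rwa [abs_mul, abs_two])
        rw [abs_mul, abs_of_pos (by positivity : (0 : ℝ) < N / 2)]
        calc _ ≤ N / 2 * (2 * τ) ^ 2 := by gcongr
          _ = |τ| * (2 * N * |τ|) := by rw [mul_pow, ← sq_abs τ]; ring
          _ ≤ _ := by gcongr
      have h3 : |2 * N * a * (Real.exp τ - 1 - τ) + (Real.exp τ - 1) * x'| ≤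
          |τ| * M + 2 * |τ| * M := by
        have e1 := Real.abs_exp_sub_one_sub_id_le (x := τ) (by linarith)
        have e2 := Real.abs_exp_sub_one_le (x := τ) (by linarith)
        refine (abs_add_le _ _).trans (add_le_add ?_ ?_)
        · rw [abs_mul, abs_mul, abs_of_pos (by positivity : (0 : ℝ) < 2 * N)]
          calc _ ≤ 2 * N * 1 * τ ^ 2 := by gcongr
            _ = |τ| * (2 * N * |τ|) := by rw [← sq_abs τ]; ring
            _ ≤ _ := by gcongr
        · rw [abs_mul]
          gcongr
      calc ‖E‖ ≤ ‖((τ * (1 + n') : ℝ) : ℂ)‖ +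
            ‖((N / 2 * (Real.exp (2 * τ) - 1 - 2 * τ) : ℝ) : ℂ) * w ^ 2‖ +
            ‖((2 * N * a * (Real.exp τ - 1 - τ) + (Real.exp τ - 1) * x' : ℝ) : ℂ) * w‖ :=
            (norm_sub_le _ _).trans (add_le_add_left (norm_add_le _ _) _)
        _ = |τ * (1 + n')| + |N / 2 * (Real.exp (2 * τ) - 1 - 2 * τ)| +
            |2 * N * a * (Real.exp τ - 1 - τ) + (Real.exp τ - 1) * x'| := by
            rw [norm_mul, norm_mul, norm_pow, hw1, one_pow, mul_one, mul_one, Complex.norm_real,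
              Complex.norm_real, Complex.norm_real, Real.norm_eq_abs, Real.norm_eq_abs,
              Real.norm_eq_abs]
        _ ≤ _ := by linarith
    have hE1 : ‖E‖ ≤ 1 := hEn.trans (by rw [div_le_one hN0]; linarith)
    have hexp : ‖Complex.exp E - 1‖ ≤ 2 * (D / N) :=
      (Complex.norm_exp_sub_one_le hE1).trans (by linarith)
    have hb : ‖beadIntegrand a (n, x, t) (n', x', t') w‖ ≤ Real.exp (4 * M) := by
      rw [beadIntegrand, norm_mul, norm_zpow, hw1, one_zpow, one_mul]
      refine (Complex.norm_exp_le_exp_norm _).trans (Real.exp_le_exp.2 ?_)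
      have e1 : ‖w ^ 2 - 2 * (a : ℂ) * w‖ ≤ 3 := by
        refine (norm_sub_le _ _).trans ?_
        rw [norm_pow, norm_mul, norm_mul, hw1, Complex.norm_real, Real.norm_eq_abs]
        norm_num
        linarith
      have e2 : |x - x'| ≤ 2 * M := (abs_sub _ _).trans (by linarith)
      refine (norm_add_le _ _).trans ?_
      rw [norm_mul, norm_mul, norm_mul, hw1, Complex.norm_real, Complex.norm_real,
        Real.norm_eq_abs, Real.norm_eq_abs]
      norm_num
      have e3 : |t' - t| * ‖w ^ 2 - 2 * (a : ℂ) * w‖ ≤ M * 3 := by gcongr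
      linarith
    have : beadIntegrand a (n, x, t) (n', x', t') w * Complex.exp E -
        beadIntegrand a (n, x, t) (n', x', t') w =
        beadIntegrand a (n, x, t) (n', x', t') w * (Complex.exp E - 1) := by ring
    rw [this, norm_mul]
    gcongr
  · rw [abs_of_nonneg (by linarith [Real.arccos_nonneg a])]
    ring

/-! ### Gaussian smoothing of the antiderivatives of the delta function -/

/-- The function `H^m` smoothed by a centered Gaussian with variance `b² / 2`, evaluated at `d`.
For `m = 0` this is the Gaussian density itself, and for `m ≥ 1`, `b = 0` it is `H^m(d)`. -/
def gaussSmooth (m : ℕ) (d b : ℝ) : ℝ :=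
  if m = 0 then Real.exp (-(d / b) ^ 2) / (Real.sqrt Real.pi * b)
  else (∫ ξ : ℝ, deltaAntideriv m (d + b * ξ) * Real.exp (-ξ ^ 2)) / Real.sqrt Real.pi

theorem gaussSmooth_succ (k : ℕ) (d b : ℝ) : gaussSmooth (k + 1) d b =
    (∫ ξ : ℝ, deltaAntideriv (k + 1) (d + b * ξ) * Real.exp (-ξ ^ 2)) / Real.sqrt Real.pi := by
  simp [gaussSmooth]

theorem integral_exp_neg_sq : ∫ ξ : ℝ, Real.exp (-ξ ^ 2) = Real.sqrt Real.pi := by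
  have := integral_gaussian 1
  simpa using this

theorem integral_mul_gaussian (h : ℝ → ℝ) {b : ℝ} (hb : 0 < b) (c : ℝ) :
    ∫ y : ℝ, h y * Real.exp (-((y - c) / b) ^ 2) =
      b * ∫ ξ : ℝ, h (c - b * ξ) * Real.exp (-ξ ^ 2) := by
  have h1 := MeasureTheory.Measure.integral_comp_mul_left
    (fun z : ℝ => h (c - z) * Real.exp (-(z / b) ^ 2)) b
  have h2 := MeasureTheory.integral_sub_left_eq_self
    (fun z : ℝ => h (c - z) * Real.exp (-(z / b) ^ 2)) MeasureTheory.volume c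
  rw [← h2, abs_of_pos (inv_pos.2 hb), smul_eq_mul] at h1
  have h3 : ∀ z : ℝ, h (c - b * z) * Real.exp (-(b * z / b) ^ 2) =
      h (c - b * z) * Real.exp (-z ^ 2) := fun z => by rw [mul_div_cancel_left₀ z hb.ne']
  simp only [h3] at h1
  rw [h1, ← mul_assoc, mul_inv_cancel₀ hb.ne', one_mul]
  refine MeasureTheory.integral_congr_ae (MeasureTheory.ae_of_all _ fun y => ?_)
  simp only [sub_sub_cancel]
  rw [← neg_sub, neg_div, neg_sq]

/-- Smoothing by a Gaussian density with center `c`, written as a function of the first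
variable. -/
theorem integral_deltaAntideriv_mul_gaussian (k : ℕ) {b : ℝ} (hb : 0 < b) (x c : ℝ) :
    ∫ y : ℝ, deltaAntideriv (k + 1) (x - y) *
      (Real.exp (-((y - c) / b) ^ 2) / (Real.sqrt Real.pi * b)) =
      gaussSmooth (k + 1) (x - c) b := by
  have h := integral_mul_gaussian (fun y => deltaAntideriv (k + 1) (x - y)) hb c
  have e : ∀ y : ℝ, deltaAntideriv (k + 1) (x - y) *
      (Real.exp (-((y - c) / b) ^ 2) / (Real.sqrt Real.pi * b)) =
      (Real.sqrt Real.pi * b)⁻¹ * (deltaAntideriv (k + 1) (x - y) *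
        Real.exp (-((y - c) / b) ^ 2)) := fun y => by ring
  simp only [e]
  rw [MeasureTheory.integral_const_mul, h, gaussSmooth_succ]
  have e2 : ∀ ξ : ℝ, x - (c - b * ξ) = x - c + b * ξ := fun ξ => by ring
  simp only [e2]
  field_simp

theorem gaussSmooth_zero_right (k : ℕ) (d : ℝ) :
    gaussSmooth (k + 1) d 0 = deltaAntideriv (k + 1) d := by
  have hpi : 0 < Real.sqrt Real.pi := Real.sqrt_pos.2 Real.pi_pos
  simp only [gaussSmooth_succ, zero_mul, add_zero]
  rw [MeasureTheory.integral_const_mul, integral_exp_neg_sq, mul_div_assoc, div_self hpi.ne',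
    mul_one]

theorem smoothedH_bmDensity {m : ℕ} {s : ℝ} (hs : 0 ≤ s) (hm : m = 0 → 0 < s) (x z : ℝ) :
    smoothedH bmDensity m s x z = gaussSmooth m (x - z) (Real.sqrt s) := by
  rcases hs.eq_or_lt with h0 | h0
  · obtain ⟨k, rfl⟩ : ∃ k, m = k + 1 := Nat.exists_eq_succ_of_ne_zero fun h => by
      linarith [hm h]
    rw [← h0, Real.sqrt_zero, gaussSmooth_zero_right]
    simp [smoothedH]
  · have hden : ∀ y : ℝ, bmDensity s y z =
        Real.exp (-((y - z) / Real.sqrt s) ^ 2) / (Real.sqrt Real.pi * Real.sqrt s) := by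
      intro y
      rw [bmDensity, Real.sqrt_mul Real.pi_pos.le, div_pow, Real.sq_sqrt h0.le, neg_div,
        ← neg_sub z y, neg_sq]
      ring
    rw [smoothedH, if_neg h0.ne']
    cases m with
    | zero => simp [hden, gaussSmooth]
    | succ k =>
      rw [if_neg (Nat.succ_ne_zero k)]
      simp only [hden]
      exact integral_deltaAntideriv_mul_gaussian k (Real.sqrt_pos.2 h0) x z

theorem smoothedH_ouDensity {m : ℕ} {τ : ℝ} (hτ : 0 ≤ τ) (hm : m = 0 → 0 < τ) (x z : ℝ) :
    smoothedH ouDensity m τ x z = Real.exp τ *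
      gaussSmooth m (x - Real.exp τ * z) (Real.sqrt (Real.exp (2 * τ) - 1)) := by
  rcases hτ.eq_or_lt with h0 | h0
  · obtain ⟨k, rfl⟩ : ∃ k, m = k + 1 := Nat.exists_eq_succ_of_ne_zero fun h => by
      linarith [hm h]
    rw [← h0]
    simp [smoothedH, gaussSmooth_zero_right]
  · have hE : 0 < Real.exp τ := Real.exp_pos τ
    have hEE : Real.exp τ * Real.exp (-τ) = 1 := by
      rw [← Real.exp_add, add_neg_cancel, Real.exp_zero]
    have h2 : 0 < Real.exp (2 * τ) - 1 := by
      have := Real.add_one_lt_exp (x := 2 * τ) (by positivity)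
      linarith
    have h3 : 1 - Real.exp (-τ) ^ 2 = (Real.exp (2 * τ) - 1) / Real.exp τ ^ 2 := by
      have e1 : Real.exp (2 * τ) = Real.exp τ ^ 2 := by rw [← Real.exp_nat_mul]; norm_num
      have e2 : Real.exp (-τ) = (Real.exp τ)⁻¹ := Real.exp_neg τ
      rw [e1, e2]
      field_simp
    have hden : ∀ y : ℝ, ouDensity τ y z = Real.exp τ *
        (Real.exp (-((y - Real.exp τ * z) / Real.sqrt (Real.exp (2 * τ) - 1)) ^ 2) /
          (Real.sqrt Real.pi * Real.sqrt (Real.exp (2 * τ) - 1))) := by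
      intro y
      have e3 : z - Real.exp (-τ) * y = -(y - Real.exp τ * z) / Real.exp τ := by
        rw [eq_div_iff hE.ne']
        linear_combination -y * hEE
      rw [ouDensity, h3, e3, Real.sqrt_mul Real.pi_pos.le, Real.sqrt_div h2.le,
        Real.sqrt_sq hE.le, div_pow, div_pow, Real.sq_sqrt h2.le, neg_sq]
      have hs : Real.sqrt (Real.exp (2 * τ) - 1) ≠ 0 := (Real.sqrt_pos.2 h2).ne'
      have e4 : -((y - Real.exp τ * z) ^ 2 / Real.exp τ ^ 2) /
          ((Real.exp (2 * τ) - 1) / Real.exp τ ^ 2) =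
          -((y - Real.exp τ * z) ^ 2 / (Real.exp (2 * τ) - 1)) := by
        field_simp
      rw [e4]
      field_simp
    rw [smoothedH, if_neg h0.ne']
    cases m with
    | zero => simp [hden, gaussSmooth]
    | succ k =>
      rw [if_neg (Nat.succ_ne_zero k)]
      simp only [hden, mul_left_comm (deltaAntideriv _ _)]
      rw [MeasureTheory.integral_const_mul,
        integral_deltaAntideriv_mul_gaussian k (Real.sqrt_pos.2 h2) x (Real.exp τ * z)]

theorem deltaAntideriv_mul (k : ℕ) {r : ℝ} (hr : 0 < r) (x : ℝ) :
    deltaAntideriv (k + 1) (r * x) = r ^ k * deltaAntideriv (k + 1) x := by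
  simp only [deltaAntideriv, mul_nonneg_iff_of_pos_left hr]
  split_ifs
  · rw [mul_pow, mul_div_assoc]
  · simp

theorem gaussSmooth_scale (m : ℕ) {r : ℝ} (hr : 0 < r) (d b : ℝ) :
    gaussSmooth m (r * d) (r * b) = r ^ ((m : ℤ) - 1) * gaussSmooth m d b := by
  cases m with
  | zero =>
    simp only [gaussSmooth, if_true, mul_div_mul_left d b hr.ne']
    rw [Nat.cast_zero, zero_sub, zpow_neg_one]
    field_simp
  | succ k =>
    have e : ∀ ξ : ℝ, r * d + r * b * ξ = r * (d + b * ξ) := fun ξ => by ring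
    simp only [gaussSmooth_succ, e, deltaAntideriv_mul k hr]
    simp only [mul_assoc (r ^ k)]
    rw [MeasureTheory.integral_const_mul]
    push_cast
    rw [add_sub_cancel_right, zpow_natCast, mul_div_assoc]

/-! ### Stability of the smoothed functions -/

theorem deltaAntideriv_eq_max (k : ℕ) (x : ℝ) :
    deltaAntideriv (k + 2) x = max x 0 ^ (k + 1) / (Nat.factorial (k + 1) : ℝ) := by
  simp only [deltaAntideriv]
  split_ifs with h
  · rw [max_eq_left h]
  · rw [max_eq_right (not_le.1 h).le]; simp

theorem abs_deltaAntideriv_le (k : ℕ) (x : ℝ) : |deltaAntideriv (k + 1) x| ≤ |x| ^ k := by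
  simp only [deltaAntideriv]
  split_ifs
  · rw [abs_div, abs_pow]
    refine div_le_self (by positivity) ?_
    rw [abs_of_nonneg (by positivity)]
    exact_mod_cast Nat.factorial_pos k
  · rw [abs_zero]
    positivity

theorem measurable_deltaAntideriv (k : ℕ) : Measurable (deltaAntideriv (k + 1)) := by
  unfold deltaAntideriv
  exact Measurable.ite measurableSet_Ici (by fun_prop) (by fun_prop)

/-- Quantitative Lipschitz bound; the constant would be `1 / k!`, but `1` is enough. -/
theorem abs_deltaAntideriv_sub_le (k : ℕ) {u v B : ℝ} (hu : |u| ≤ B) (hv : |v| ≤ B) :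
    |deltaAntideriv (k + 2) u - deltaAntideriv (k + 2) v| ≤ |u - v| * B ^ k := by
  rw [deltaAntideriv_eq_max, deltaAntideriv_eq_max, ← sub_div, abs_div]
  have hB : 0 ≤ B := (abs_nonneg u).trans hu
  have hmax : ∀ {z : ℝ}, |z| ≤ B → |max z 0| ≤ B := fun {z} hz => by
    rw [abs_of_nonneg (le_max_right _ _)]
    exact max_le ((le_abs_self z).trans hz) hB
  have h1 := abs_pow_sub_pow_le (max u 0) (max v 0) (k + 1)
  have h2 : |max u 0 - max v 0| ≤ |u - v| := abs_max_sub_max_le_abs u v 0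
  have h3 : max |max u 0| |max v 0| ≤ B := max_le (hmax hu) (hmax hv)
  have h4 : ((k + 1 : ℕ) : ℝ) ≤ (Nat.factorial (k + 1) : ℝ) := by
    exact_mod_cast Nat.self_le_factorial (k + 1)
  have hf : (0 : ℝ) < (Nat.factorial (k + 1) : ℝ) := by exact_mod_cast Nat.factorial_pos (k + 1)
  rw [abs_of_pos hf, div_le_iff₀ hf]
  refine h1.trans ?_
  rw [Nat.add_sub_cancel]
  calc |max u 0 - max v 0| * ((k + 1 : ℕ) : ℝ) * max |max u 0| |max v 0| ^ k
      ≤ |u - v| * (Nat.factorial (k + 1) : ℝ) * B ^ k := by gcongr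
    _ = _ := by ring

theorem one_add_abs_pow_mul_exp_le (j : ℕ) (ξ : ℝ) :
    (1 + |ξ|) ^ j * Real.exp (-ξ ^ 2) ≤
      (Nat.factorial j : ℝ) * Real.exp (3 / 2) * Real.exp (-(1 / 2) * ξ ^ 2) := by
  calc (1 + |ξ|) ^ j * Real.exp (-ξ ^ 2)
      ≤ ((Nat.factorial j : ℝ) * Real.exp (1 + |ξ|)) * Real.exp (-ξ ^ 2) := by
        gcongr
        exact pow_le_factorial_mul_exp (by positivity) j
    _ = (Nat.factorial j : ℝ) * Real.exp (1 + |ξ| - ξ ^ 2) := by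
        rw [mul_assoc, ← Real.exp_add]; ring_nf
    _ ≤ (Nat.factorial j : ℝ) * Real.exp (3 / 2 + -(1 / 2) * ξ ^ 2) := by
        gcongr
        nlinarith [sq_nonneg (|ξ| - 1), sq_abs ξ]
    _ = _ := by rw [Real.exp_add]; ring

/-- A common bound for the integrals of `(1 + |ξ|)^j e^(-ξ²)`. -/
def momentBound (j : ℕ) : ℝ :=
  ∫ ξ : ℝ, (Nat.factorial j : ℝ) * Real.exp (3 / 2) * Real.exp (-(1 / 2) * ξ ^ 2)

theorem integrable_momentBound (j : ℕ) : MeasureTheory.Integrable fun ξ : ℝ =>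
    (Nat.factorial j : ℝ) * Real.exp (3 / 2) * Real.exp (-(1 / 2) * ξ ^ 2) :=
  (integrable_exp_neg_mul_sq (by norm_num)).const_mul _

theorem momentBound_nonneg (j : ℕ) : 0 ≤ momentBound j :=
  MeasureTheory.integral_nonneg fun ξ => by positivity

theorem one_le_sqrt_pi : 1 ≤ Real.sqrt Real.pi :=
  Real.one_le_sqrt.2 (by linarith [Real.pi_gt_three])

theorem abs_integral_div_sqrt_pi_le {f : ℝ → ℝ} {A : ℝ} {j : ℕ} (hA : 0 ≤ A)
    (hf : ∀ ξ, |f ξ| ≤ A * (1 + |ξ|) ^ j) :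
    |(∫ ξ : ℝ, f ξ * Real.exp (-ξ ^ 2)) / Real.sqrt Real.pi| ≤ A * momentBound j := by
  rw [abs_div, abs_of_pos (a := Real.sqrt Real.pi) (by linarith [one_le_sqrt_pi])]
  refine (div_le_self (abs_nonneg _) one_le_sqrt_pi).trans ?_
  rw [momentBound, ← MeasureTheory.integral_const_mul, ← Real.norm_eq_abs]
  refine MeasureTheory.norm_integral_le_of_norm_le ((integrable_momentBound j).const_mul A)
    (MeasureTheory.ae_of_all _ fun ξ => ?_)
  rw [norm_mul, Real.norm_eq_abs, Real.norm_of_nonneg (Real.exp_pos _).le]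
  calc |f ξ| * Real.exp (-ξ ^ 2) ≤ A * (1 + |ξ|) ^ j * Real.exp (-ξ ^ 2) := by
        gcongr
        exact hf ξ
    _ = A * ((1 + |ξ|) ^ j * Real.exp (-ξ ^ 2)) := by ring
    _ ≤ _ := mul_le_mul_of_nonneg_left (one_add_abs_pow_mul_exp_le j ξ) hA

theorem abs_add_mul_le {d b K : ℝ} (hd : |d| ≤ K) (hb : |b| ≤ K) (ξ : ℝ) :
    |d + b * ξ| ≤ K * (1 + |ξ|) := by
  calc |d + b * ξ| ≤ |d| + |b * ξ| := abs_add_le _ _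
    _ = |d| + |b| * |ξ| := by rw [abs_mul]
    _ ≤ K + K * |ξ| := by gcongr
    _ = _ := by ring

theorem abs_deltaAntideriv_comp_le (k : ℕ) {d b K : ℝ} (hd : |d| ≤ K) (hb : |b| ≤ K) (ξ : ℝ) :
    |deltaAntideriv (k + 1) (d + b * ξ)| ≤ K ^ k * (1 + |ξ|) ^ k := by
  refine (abs_deltaAntideriv_le k _).trans ?_
  rw [← mul_pow]
  gcongr
  exact abs_add_mul_le hd hb ξ

theorem abs_gaussSmooth_succ_le (k : ℕ) {d b K : ℝ} (hd : |d| ≤ K) (hb : |b| ≤ K) :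
    |gaussSmooth (k + 1) d b| ≤ K ^ k * momentBound k := by
  have hK : 0 ≤ K := (abs_nonneg d).trans hd
  rw [gaussSmooth_succ]
  exact abs_integral_div_sqrt_pi_le (by positivity) (abs_deltaAntideriv_comp_le k hd hb)

theorem integrable_deltaAntideriv_mul (k : ℕ) (d b : ℝ) : MeasureTheory.Integrable fun ξ : ℝ =>
    deltaAntideriv (k + 1) (d + b * ξ) * Real.exp (-ξ ^ 2) := by
  set K := max |d| |b|
  refine ((integrable_momentBound k).const_mul (K ^ k)).mono' ?_
    (MeasureTheory.ae_of_all _ fun ξ => ?_)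
  · exact (((measurable_deltaAntideriv k).comp (by fun_prop)).mul
      (by fun_prop)).aestronglyMeasurable
  · rw [norm_mul, Real.norm_eq_abs, Real.norm_of_nonneg (Real.exp_pos _).le]
    calc _ ≤ K ^ k * (1 + |ξ|) ^ k * Real.exp (-ξ ^ 2) := by
          gcongr
          exact abs_deltaAntideriv_comp_le k (le_max_left _ _) (le_max_right _ _) ξ
      _ = K ^ k * ((1 + |ξ|) ^ k * Real.exp (-ξ ^ 2)) := by ring
      _ ≤ _ := mul_le_mul_of_nonneg_left (one_add_abs_pow_mul_exp_le k ξ) (by positivity)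

theorem gaussSmooth_succ_sub (k : ℕ) (d b d' b' : ℝ) :
    gaussSmooth (k + 1) d b - gaussSmooth (k + 1) d' b' =
      (∫ ξ : ℝ, (deltaAntideriv (k + 1) (d + b * ξ) - deltaAntideriv (k + 1) (d' + b' * ξ)) *
        Real.exp (-ξ ^ 2)) / Real.sqrt Real.pi := by
  rw [gaussSmooth_succ, gaussSmooth_succ, ← sub_div,
    ← MeasureTheory.integral_sub (integrable_deltaAntideriv_mul k d b)
      (integrable_deltaAntideriv_mul k d' b')]
  simp only [sub_mul]

theorem abs_exp_neg_sq_sub_le (r r' : ℝ) :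
    |Real.exp (-r ^ 2) - Real.exp (-r' ^ 2)| ≤ |r - r'| := by
  have hd : ∀ z : ℝ, HasDerivAt (fun z : ℝ => Real.exp (-z ^ 2))
      (Real.exp (-z ^ 2) * -(2 * z)) z := fun z => by
    simpa using ((hasDerivAt_pow 2 z).neg).exp
  have hb : ∀ z ∈ Set.univ, ‖deriv (fun z : ℝ => Real.exp (-z ^ 2)) z‖ ≤ 1 := by
    intro z _
    rw [(hd z).deriv, norm_mul, norm_neg, Real.norm_of_nonneg (Real.exp_pos _).le,
      Real.norm_eq_abs, abs_mul, abs_two, Real.exp_neg, inv_mul_le_iff₀ (Real.exp_pos _), mul_one]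
    have := Real.add_one_le_exp (z ^ 2)
    nlinarith [sq_nonneg (|z| - 1), sq_abs z]
  have := convex_univ.norm_image_sub_le_of_norm_deriv_le
    (fun z _ => (hd z).differentiableAt) hb (Set.mem_univ r') (Set.mem_univ r)
  simpa using this

theorem abs_heaviside_sub_le (d b d' b' ξ : ℝ) (hb : 0 < b) (hb' : 0 < b') :
    |deltaAntideriv 1 (d + b * ξ) - deltaAntideriv 1 (d' + b' * ξ)| ≤
      Set.indicator (Set.uIcc (-(d / b)) (-(d' / b'))) (fun _ => (1 : ℝ)) ξ := by
  have hiff : ∀ {d b : ℝ}, 0 < b → (0 ≤ d + b * ξ ↔ -(d / b) ≤ ξ) := fun {d b} hb => by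
    rw [← neg_div, div_le_iff₀ hb]
    constructor <;> intro h <;> linarith
  simp only [deltaAntideriv, hiff hb, hiff hb', pow_zero, Nat.factorial_zero, Nat.cast_one,
    div_one]
  by_cases h1 : -(d / b) ≤ ξ <;> by_cases h2 : -(d' / b') ≤ ξ
  · simp only [h1, h2, if_true, sub_self, abs_zero]
    exact Set.indicator_nonneg (fun _ _ => zero_le_one) ξ
  · rw [Set.indicator_of_mem (Set.mem_uIcc.2 (Or.inl ⟨h1, (not_le.1 h2).le⟩))]
    simp [h1, h2]
  · rw [Set.indicator_of_mem (Set.mem_uIcc.2 (Or.inr ⟨h2, (not_le.1 h1).le⟩))]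
    simp [h1, h2]
  · simp only [h1, h2, if_false, sub_self, abs_zero]
    exact Set.indicator_nonneg (fun _ _ => zero_le_one) ξ

theorem abs_gaussSmooth_one_sub_le {d b d' b' : ℝ} (hb : 0 < b) (hb' : 0 < b') :
    |gaussSmooth 1 d b - gaussSmooth 1 d' b'| ≤ |d / b - d' / b'| := by
  rw [gaussSmooth_succ_sub 0, abs_div, abs_of_pos (a := Real.sqrt Real.pi) (by linarith [one_le_sqrt_pi])]
  refine (div_le_self (abs_nonneg _) one_le_sqrt_pi).trans ?_
  have hint : MeasureTheory.Integrable
      (Set.indicator (Set.uIcc (-(d / b)) (-(d' / b'))) (fun _ => (1 : ℝ))) := by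
    rw [MeasureTheory.integrable_indicator_iff measurableSet_uIcc]
    exact MeasureTheory.integrableOn_const (by simp [Set.uIcc]) (by simp)
  have h := MeasureTheory.norm_integral_le_of_norm_le hint
    (f := fun ξ => (deltaAntideriv (0 + 1) (d + b * ξ) - deltaAntideriv (0 + 1) (d' + b' * ξ)) *
        Real.exp (-ξ ^ 2)) (MeasureTheory.ae_of_all _ fun ξ => by
      rw [norm_mul, Real.norm_eq_abs, Real.norm_of_nonneg (Real.exp_pos _).le]
      refine (mul_le_of_le_one_right (abs_nonneg _) ?_).trans
        (abs_heaviside_sub_le d b d' b' ξ hb hb')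
      rw [Real.exp_le_one_iff]
      linarith [sq_nonneg ξ])
  refine h.trans (le_of_eq ?_)
  rw [MeasureTheory.integral_indicator_const _ measurableSet_uIcc, smul_eq_mul, mul_one,
    Set.uIcc, Real.volume_real_Icc, max_sub_min_eq_abs, max_eq_left (abs_nonneg _)]
  rw [neg_sub_neg]

/-- The ratio `d / b` changes by `O(ε b)` under relative perturbations of order `ε b²`. -/
theorem abs_ratio_sub_le {d d' b ρ ε D : ℝ} (hd : |d| ≤ D) (hb : 0 < b)
    (hdd : |d' - d| ≤ ε * b ^ 2) (hρ : 1 ≤ ρ) (hρ' : ρ ≤ 1 + ε * b ^ 2) :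
    |d' / (ρ * b) - d / b| ≤ ε * b * (1 + D) := by
  have hρ0 : 0 < ρ := by linarith
  have e : d' / (ρ * b) - d / b = ((d' - d) + d * (1 - ρ)) / (ρ * b) := by
    field_simp
    ring
  have hε : 0 ≤ ε * b ^ 2 := (abs_nonneg _).trans hdd
  rw [e, abs_div, abs_of_pos (by positivity : 0 < ρ * b), div_le_iff₀ (by positivity)]
  calc |d' - d + d * (1 - ρ)| ≤ |d' - d| + |d| * |1 - ρ| := by
        rw [← abs_mul]; exact abs_add_le _ _
    _ ≤ ε * b ^ 2 + D * (ε * b ^ 2) := by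
        gcongr
        · exact (abs_nonneg _).trans hd
        · rw [abs_sub_comm, abs_of_nonneg (by linarith)]; linarith
    _ = (ε * b ^ 2 * (1 + D)) * 1 := by ring
    _ ≤ (ε * b ^ 2 * (1 + D)) * ρ := by
        gcongr
        exact mul_nonneg hε (by linarith [(abs_nonneg _).trans hd])
    _ = _ := by ring

/-- The smoothed functions depend on their parameters in such a way that perturbations of order
`ε b²` change them by `O(ε)`, uniformly down to the singularity at `b = 0`. -/
theorem exists_gaussSmooth_sub_le (m : ℕ) {D : ℝ} (hD : 0 ≤ D) :
    ∃ C : ℝ, 0 ≤ C ∧ ∀ ε d d' b ρ κ : ℝ, 0 ≤ ε → ε ≤ 1 → |d| ≤ D → 0 ≤ b → (m = 0 → 0 < b) →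
      b ≤ D → |d' - d| ≤ ε * b ^ 2 → 1 ≤ ρ → ρ ≤ 1 + ε * b ^ 2 → 1 ≤ κ → κ ≤ 1 + ε * b ^ 2 →
      |κ * gaussSmooth m d' (ρ * b) - gaussSmooth m d b| ≤ C * ε := by
  set K := D + D ^ 2 + D ^ 3 with hK
  have hK0 : 0 ≤ K := by positivity
  have hbnd : ∀ {ε d d' b ρ : ℝ}, 0 ≤ ε → ε ≤ 1 → |d| ≤ D → 0 ≤ b → b ≤ D →
      |d' - d| ≤ ε * b ^ 2 → 1 ≤ ρ → ρ ≤ 1 + ε * b ^ 2 → |d'| ≤ K ∧ |ρ * b| ≤ K := by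
    intro ε d d' b ρ hε0 hε1 hd hb0 hbD hdd hρ hρ'
    have h1 : ε * b ^ 2 ≤ D ^ 2 := by
      calc ε * b ^ 2 ≤ 1 * D ^ 2 := by gcongr
        _ = _ := one_mul _
    have h3 : 0 ≤ D ^ 3 := by positivity
    have h2 : 0 ≤ D ^ 2 := by positivity
    constructor
    · calc |d'| = |d + (d' - d)| := by ring_nf
        _ ≤ |d| + |d' - d| := abs_add_le _ _
        _ ≤ K := by linarith
    · rw [abs_of_nonneg (by positivity)]
      calc ρ * b ≤ (1 + D ^ 2) * D := by
            gcongr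
            linarith
        _ ≤ K := by rw [hK]; nlinarith
  have hsplit : ∀ κ A A' : ℝ, 1 ≤ κ → |κ * A' - A| ≤ (κ - 1) * |A'| + |A' - A| := by
    intro κ A A' hκ
    calc |κ * A' - A| = |(κ - 1) * A' + (A' - A)| := by ring_nf
      _ ≤ |(κ - 1) * A'| + |A' - A| := abs_add_le _ _
      _ = _ := by rw [abs_mul, abs_of_nonneg (by linarith)]
  rcases m with _ | _ | k
  · refine ⟨1 + 3 * D, by positivity, fun ε d d' b ρ κ hε0 hε1 hd hb0 hm hbD hdd hρ hρ' hκ hκ' => ?_⟩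
    have hb : 0 < b := hm rfl
    have hρ0 : 0 < ρ := by linarith
    have hratio := abs_ratio_sub_le hd hb hdd hρ hρ'
    set f : ℝ := Real.exp (-(d / b) ^ 2) with hf
    set f' : ℝ := Real.exp (-(d' / (ρ * b)) ^ 2) with hf'
    have hf1 : f ≤ 1 := by
      rw [hf, Real.exp_le_one_iff]; linarith [sq_nonneg (d / b)]
    have hf'1 : f' ≤ 1 := by
      rw [hf', Real.exp_le_one_iff]; linarith [sq_nonneg (d' / (ρ * b))]
    have hf0 : 0 < f := Real.exp_pos _
    have hf'0 : 0 < f' := Real.exp_pos _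
    have hff : |f' - f| ≤ ε * b * (1 + D) := (abs_exp_neg_sq_sub_le _ _).trans hratio
    have hπ := one_le_sqrt_pi
    have hπ0 : 0 < Real.sqrt Real.pi := by linarith
    simp only [gaussSmooth, if_true]
    rw [← hf, ← hf']
    have e : κ * (f' / (Real.sqrt Real.pi * (ρ * b))) - f / (Real.sqrt Real.pi * b) =
        ((κ - 1) * f' + (f' - f) + f * (1 - ρ)) / (Real.sqrt Real.pi * (ρ * b)) := by
      field_simp
      ring
    rw [e, abs_div, abs_of_pos (by positivity : 0 < Real.sqrt Real.pi * (ρ * b)),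
      div_le_iff₀ (by positivity)]
    have h1 : |(κ - 1) * f' + (f' - f) + f * (1 - ρ)| ≤
        ε * b ^ 2 + ε * b * (1 + D) + ε * b ^ 2 := by
      refine (abs_add_three _ _ _).trans ?_
      rw [abs_mul, abs_mul, abs_of_pos hf0, abs_of_pos hf'0, abs_of_nonneg (by linarith : 0 ≤ κ - 1),
        abs_sub_comm 1 ρ, abs_of_nonneg (by linarith : 0 ≤ ρ - 1)]
      have i1 : (κ - 1) * f' ≤ ε * b ^ 2 := by
        calc (κ - 1) * f' ≤ (κ - 1) * 1 := by gcongr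
          _ ≤ _ := by linarith
      have i2 : f * (ρ - 1) ≤ ε * b ^ 2 := by
        calc f * (ρ - 1) ≤ 1 * (ρ - 1) := by gcongr
          _ ≤ _ := by linarith
      linarith
    refine h1.trans ?_
    calc ε * b ^ 2 + ε * b * (1 + D) + ε * b ^ 2 = ε * (1 + D + 2 * b) * (1 * (1 * b)) := by ring
      _ ≤ ε * (1 + D + 2 * D) * (Real.sqrt Real.pi * (ρ * b)) := by gcongr
      _ = _ := by ring
  · refine ⟨D ^ 2 * momentBound 0 + D * (1 + D), by have := momentBound_nonneg 0; positivity,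
      fun ε d d' b ρ κ hε0 hε1 hd hb0 _ hbD hdd hρ hρ' hκ hκ' => ?_⟩
    have hM := momentBound_nonneg 0
    obtain ⟨hd', hb'⟩ := hbnd hε0 hε1 hd hb0 hbD hdd hρ hρ'
    have h1 := abs_gaussSmooth_succ_le 0 hd' hb'
    rw [pow_zero, one_mul] at h1
    have h2 : |gaussSmooth 1 d' (ρ * b) - gaussSmooth 1 d b| ≤ D * (1 + D) * ε := by
      rcases hb0.eq_or_lt with h0 | h0
      · have : d' = d := by
          rw [← h0] at hdd
          have : |d' - d| ≤ 0 := by simpa using hdd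
          exact sub_eq_zero.1 (abs_eq_zero.1 (le_antisymm this (abs_nonneg _)))
        rw [← h0, this, mul_zero, sub_self, abs_zero]
        positivity
      · refine (abs_gaussSmooth_one_sub_le (by positivity) h0).trans
          ((abs_ratio_sub_le hd h0 hdd hρ hρ').trans ?_)
        calc ε * b * (1 + D) ≤ ε * D * (1 + D) := by gcongr
          _ = _ := by ring
    refine (hsplit κ _ _ hκ).trans ?_
    calc _ ≤ ε * D ^ 2 * momentBound 0 + D * (1 + D) * ε := by
          gcongr
          calc κ - 1 ≤ ε * b ^ 2 := by linarith
            _ ≤ _ := by gcongr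
      _ = _ := by ring
  · refine ⟨D ^ 2 * (K ^ (k + 1) * momentBound (k + 1)) +
      (D ^ 2 + D ^ 3) * K ^ k * momentBound (k + 1), by
        have := momentBound_nonneg (k + 1); positivity,
      fun ε d d' b ρ κ hε0 hε1 hd hb0 _ hbD hdd hρ hρ' hκ hκ' => ?_⟩
    have hM := momentBound_nonneg (k + 1)
    obtain ⟨hd', hb'⟩ := hbnd hε0 hε1 hd hb0 hbD hdd hρ hρ'
    have hdK : |d| ≤ K := by
      have : 0 ≤ D ^ 2 + D ^ 3 := by positivity
      linarith
    have hbK : |b| ≤ K := by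
      rw [abs_of_nonneg hb0]
      have : 0 ≤ D ^ 2 + D ^ 3 := by positivity
      linarith
    have h1 := abs_gaussSmooth_succ_le (k + 1) hd' hb'
    have h2 : |gaussSmooth (k + 2) d' (ρ * b) - gaussSmooth (k + 2) d b| ≤
        ε * (D ^ 2 + D ^ 3) * K ^ k * momentBound (k + 1) := by
      rw [gaussSmooth_succ_sub (k + 1)]
      refine abs_integral_div_sqrt_pi_le (by positivity) fun ξ => ?_
      refine (abs_deltaAntideriv_sub_le k (abs_add_mul_le hd' hb' ξ)
        (abs_add_mul_le hdK hbK ξ)).trans ?_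
      have h3 : |d' + ρ * b * ξ - (d + b * ξ)| ≤ ε * (D ^ 2 + D ^ 3) * (1 + |ξ|) := by
        have e : d' + ρ * b * ξ - (d + b * ξ) = (d' - d) + (ρ - 1) * b * ξ := by ring
        rw [e]
        refine abs_add_mul_le ?_ ?_ ξ
        · refine hdd.trans ?_
          calc ε * b ^ 2 ≤ ε * D ^ 2 := by gcongr
            _ ≤ _ := by gcongr; linarith [pow_nonneg hD 3]
        · rw [abs_of_nonneg (mul_nonneg (by linarith) hb0)]
          calc (ρ - 1) * b ≤ ε * b ^ 2 * b := by gcongr; linarith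
            _ = ε * b ^ 3 := by ring
            _ ≤ ε * D ^ 3 := by gcongr
            _ ≤ _ := by gcongr; linarith [pow_nonneg hD 2]
      calc _ ≤ ε * (D ^ 2 + D ^ 3) * (1 + |ξ|) * (K * (1 + |ξ|)) ^ k := by gcongr
        _ = _ := by rw [mul_pow]; ring
    refine (hsplit κ _ _ hκ).trans ?_
    calc _ ≤ ε * D ^ 2 * (K ^ (k + 1) * momentBound (k + 1)) +
          ε * (D ^ 2 + D ^ 3) * K ^ k * momentBound (k + 1) := by
          gcongr
          calc κ - 1 ≤ ε * b ^ 2 := by linarith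
            _ ≤ _ := by gcongr
      _ = _ := by ring

/-! ### Convergence of the heat-kernel term -/

theorem phi_scalar_identity {N : ℕ} (hN : 0 < N) {n n' : ℕ} (h : n' ≤ n) (τ : ℝ) :
    Real.exp (-(N * τ)) * (N : ℝ) ^ (((n : ℝ) - (n' : ℝ)) / 2) * (2 * (N : ℝ)) ^ (-(1 / 2) : ℝ) *
      ((2 : ℝ) ^ ((((N + n : ℕ) : ℝ) - ((N + n' : ℕ) : ℝ)) / 2) *
        Real.exp (((N + n' : ℕ) : ℝ) * τ)) * Real.exp τ =
      Real.exp (τ * (1 + n')) * Real.sqrt (2 * N) ^ (((n - n' : ℕ) : ℤ) - 1) := by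
  have hN' : (0 : ℝ) < N := by exact_mod_cast hN
  obtain ⟨L, hL⟩ : ∃ L, (N : ℝ) = Real.exp L := ⟨Real.log N, (Real.exp_log hN').symm⟩
  obtain ⟨l, hl⟩ : ∃ l, (2 : ℝ) = Real.exp l := ⟨Real.log 2, (Real.exp_log two_pos).symm⟩
  have hs : Real.sqrt (2 * N) = Real.exp ((l + L) / 2) := by
    rw [Real.sqrt_eq_iff_mul_self_eq (by positivity) (by positivity), ← Real.exp_add, hL,
      add_halves, Real.exp_add, ← hl]
  have h1 : (N : ℝ) ^ (((n : ℝ) - (n' : ℝ)) / 2) = Real.exp (L * (((n : ℝ) - (n' : ℝ)) / 2)) := by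
    rw [Real.exp_mul, ← hL]
  have h2 : (2 * (N : ℝ)) ^ (-(1 / 2) : ℝ) = Real.exp ((l + L) * (-(1 / 2))) := by
    rw [Real.exp_mul, Real.exp_add, ← hL, ← hl]
  have h3 : (2 : ℝ) ^ ((((N + n : ℕ) : ℝ) - ((N + n' : ℕ) : ℝ)) / 2) =
      Real.exp (l * (((n : ℝ) - n') / 2)) := by
    rw [Real.exp_mul, ← hl]
    congr 1
    push_cast
    ring
  rw [h1, h2, h3, hs, ← Real.rpow_intCast, ← Real.exp_mul]
  simp only [← Real.exp_add]
  congr 1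
  push_cast [h]
  ring

/-- The rescaled term `φ` of the minor process, as a smoothed antiderivative of the delta
function. -/
theorem rescaled_dbmPhi_eq (a : ℝ) {N : ℕ} (hN : 0 < N) {n n' : ℕ} (h : n' ≤ n) {x x' t t' : ℝ}
    (ht : t ≤ t') (hnt : n = n' → t < t') :
    Real.exp (-((N : ℝ) * (t' / (2 * N) - t / (2 * N)))) *
        (N : ℝ) ^ (((n : ℝ) - (n' : ℝ)) / 2) * (2 * (N : ℝ)) ^ (-(1 / 2) : ℝ) *
        dbmPhi (rescalePoint a N (n, x, t)) (rescalePoint a N (n', x', t')) =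
      Real.exp ((t' - t) / (2 * N) * (1 + n')) * gaussSmooth (n - n')
        (2 * N * a * (1 - Real.exp ((t' - t) / (2 * N))) + x - Real.exp ((t' - t) / (2 * N)) * x')
        (Real.sqrt (2 * N * (Real.exp (2 * ((t' - t) / (2 * N))) - 1))) := by
  have hN' : (0 : ℝ) < N := by exact_mod_cast hN
  have hprec : Precedes (N + n, Real.sqrt (2 * N) * a + x / Real.sqrt (2 * N), t / (2 * N))
      (N + n', Real.sqrt (2 * N) * a + x' / Real.sqrt (2 * N), t' / (2 * N)) := by
    rcases h.lt_or_eq with h0 | h0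
    · left
      change N + n' < N + n
      omega
    · right
      refine ⟨by change N + n = N + n'; omega, ?_⟩
      exact div_lt_div_of_pos_right (hnt h0.symm) (by positivity)
  have hτ : t' / (2 * N) - t / (2 * N) = (t' - t) / (2 * N) := by ring
  have hscal := phi_scalar_identity hN h ((t' - t) / (2 * N))
  simp only [rescalePoint, dbmPhi, hprec, if_true]
  rw [Nat.add_sub_add_left, hτ]
  set τ := (t' - t) / (2 * N) with hτdef
  have hτ0 : 0 ≤ τ := div_nonneg (by linarith) (by positivity)
  rw [smoothedH_ouDensity hτ0 fun h0 => div_pos (by linarith [hnt (by omega)]) (by positivity)]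
  set r := Real.sqrt (2 * N) with hr
  have hr0 : 0 < r := Real.sqrt_pos.2 (by positivity)
  have hrr : r * r = 2 * N := Real.mul_self_sqrt (by positivity)
  have hd : 2 * N * a * (1 - Real.exp τ) + x - Real.exp τ * x' =
      r * (r * a + x / r - Real.exp τ * (r * a + x' / r)) := by
    rw [← hrr]
    field_simp
    ring
  rw [hd, Real.sqrt_mul (by positivity), ← hr, gaussSmooth_scale _ hr0]
  linear_combination (gaussSmooth (n - n') (r * a + x / r - Real.exp τ * (r * a + x' / r))
    (Real.sqrt (Real.exp (2 * τ) - 1))) * hscal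

theorem beadPhi_eq (a : ℝ) {n n' : ℕ} (h : n' ≤ n) {x x' t t' : ℝ} (ht : t ≤ t')
    (hnt : n = n' → t < t') :
    beadPhi a (n, x, t) (n', x', t') =
      gaussSmooth (n - n') (x - x' - a * (t' - t)) (Real.sqrt (2 * (t' - t))) := by
  have hprec : Precedes (n, x, t) (n', x', t') := by
    rcases h.lt_or_eq with h0 | h0
    · exact Or.inl h0
    · exact Or.inr ⟨h0.symm, hnt h0.symm⟩
  simp only [beadPhi, hprec, if_true]
  rw [smoothedH_bmDensity (by linarith) fun h0 => by linarith [hnt (by omega)], ← sub_sub]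

/-- The standard deviations before and after the limit differ by a factor `ρ = 1 + O(τ)`. -/
theorem exists_sqrt_exp_eq {τ : ℝ} (hτ : 0 ≤ τ) (hτ1 : 2 * τ ≤ 1) (N : ℕ) :
    ∃ ρ : ℝ, 1 ≤ ρ ∧ ρ ≤ 1 + τ ∧
      Real.sqrt (2 * N * (Real.exp (2 * τ) - 1)) = ρ * Real.sqrt (2 * (2 * N * τ)) := by
  rcases hτ.eq_or_lt with h0 | h0
  · exact ⟨1, le_rfl, by linarith, by simp [← h0]⟩
  · refine ⟨Real.sqrt ((Real.exp (2 * τ) - 1) / (2 * τ)), ?_, ?_, ?_⟩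
    · rw [Real.one_le_sqrt, le_div_iff₀ (by positivity)]
      linarith [Real.add_one_le_exp (2 * τ)]
    · have h := (abs_le.1 (Real.abs_exp_sub_one_sub_id_le (x := 2 * τ)
        (by rwa [abs_of_pos (by positivity)]))).2
      rw [Real.sqrt_le_left (by positivity), div_le_iff₀ (by positivity)]
      nlinarith [pow_pos h0 3]
    · rw [← Real.sqrt_mul' _ (by positivity)]
      congr 1
      field_simp

theorem exists_phi_sub_le {a : ℝ} (ha : a ∈ Set.Ioo (-1 : ℝ) 1) (n n' : ℕ) {M : ℝ} (hM : 0 ≤ M) :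
    ∃ η : ℕ → ℝ, Tendsto η atTop (𝓝 0) ∧ ∀ᶠ N : ℕ in atTop, ∀ x x' t t' : ℝ, |t' - t| ≤ M →
      |x| ≤ M → |x'| ≤ M → ((n, x, t), (n', x', t')) ∈ admissible →
      |Real.exp (-((N : ℝ) * (t' / (2 * N) - t / (2 * N)))) *
        (N : ℝ) ^ (((n : ℝ) - (n' : ℝ)) / 2) * (2 * (N : ℝ)) ^ (-(1 / 2) : ℝ) *
        dbmPhi (rescalePoint a N (n, x, t)) (rescalePoint a N (n', x', t')) -
        beadPhi a (n, x, t) (n', x', t')| ≤ η N := by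
  obtain ⟨C, hC0, hC⟩ := exists_gaussSmooth_sub_le (n - n') (D := 1 + 3 * M) (by positivity)
  set A : ℝ := 3 * M + n' + 2 with hA
  have hA0 : 0 ≤ A := by positivity
  refine ⟨fun N => C * (A / N), ?_, ?_⟩
  · have h : Tendsto (fun N : ℕ => A / (N : ℝ)) atTop (𝓝 0) :=
      tendsto_const_nhds.div_atTop tendsto_natCast_atTop_atTop
    simpa using h.const_mul C
  obtain ⟨N₀, hN₀⟩ := exists_nat_ge (A + M * (1 + n'))
  filter_upwards [eventually_ge_atTop N₀, eventually_gt_atTop 0] with N hN hN0 x x' t t' ht hx hx'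
    hadm
  have hN' : (0 : ℝ) < N := by exact_mod_cast hN0
  by_cases hp : n' ≤ n ∧ t ≤ t' ∧ (n = n' → t < t')
  · obtain ⟨h, htt, hnt⟩ := hp
    rw [rescaled_dbmPhi_eq a hN0 h htt hnt, beadPhi_eq a h htt hnt]
    have hNr : A + M * (1 + n') ≤ N := hN₀.trans (by exact_mod_cast hN)
    have hn0 : (0 : ℝ) ≤ n' := Nat.cast_nonneg n'
    set s := t' - t with hs
    have hs0 : 0 ≤ s := by rw [hs]; linarith
    have hsM : s ≤ M := (le_abs_self s).trans ht
    set τ := s / (2 * N) with hτ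
    have hτ0 : 0 ≤ τ := by positivity
    have hτs : 2 * N * τ = s := by rw [hτ]; field_simp
    have hτn : τ * (1 + n') ≤ 1 := by
      have : τ * (1 + n') * N ≤ 1 * N := by nlinarith
      exact le_of_mul_le_mul_right this hN'
    have hτ1 : 2 * τ ≤ 1 := by
      have : 2 * τ * N ≤ 1 * N := by nlinarith
      exact le_of_mul_le_mul_right this hN'
    have hε1 : A / N ≤ 1 := by
      rw [div_le_one hN']
      nlinarith
    obtain ⟨ρ, hρ1, hρ2, hρ3⟩ := exists_sqrt_exp_eq hτ0 hτ1 N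
    rw [hρ3, hτs]
    have hσ : Real.sqrt (2 * s) ^ 2 = 2 * s := Real.sq_sqrt (by positivity)
    have hεσ : A / N * Real.sqrt (2 * s) ^ 2 = 4 * A * τ := by
      rw [hσ, ← hτs]
      field_simp
      ring
    have ha1 : |a| ≤ 1 := abs_le.2 ⟨ha.1.le, ha.2.le⟩
    refine hC (A / N) (x - x' - a * s) _ (Real.sqrt (2 * s)) ρ _ (by positivity) hε1 ?_
      (Real.sqrt_nonneg _) (fun h0 => ?_) ?_ ?_ hρ1 ?_ ?_ ?_
    · have e1 : |a * s| ≤ M := by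
        rw [abs_mul, abs_of_nonneg hs0]
        calc |a| * s ≤ 1 * M := by gcongr
          _ = M := one_mul M
      have e2 := abs_sub (x - x') (a * s)
      have e3 := abs_sub x x'
      linarith
    · exact Real.sqrt_pos.2 (by have := hnt (by omega); rw [hs]; linarith)
    · rw [Real.sqrt_le_left (by positivity)]
      nlinarith
    · rw [hεσ]
      have e : 2 * N * a * (1 - Real.exp τ) + x - Real.exp τ * x' - (x - x' - a * s) =
          -(2 * N * a * (Real.exp τ - 1 - τ) + (Real.exp τ - 1) * x') := by
        rw [← hτs]; ring
      have hτa : |τ| ≤ 1 := by rw [abs_of_nonneg hτ0]; linarith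
      have e1 := Real.abs_exp_sub_one_sub_id_le hτa
      have e2 := Real.abs_exp_sub_one_le hτa
      rw [abs_of_nonneg hτ0] at e2
      rw [e, abs_neg]
      have f1 : |2 * N * a * (Real.exp τ - 1 - τ)| ≤ M * τ := by
        rw [abs_mul, abs_mul, abs_of_pos (by positivity : (0 : ℝ) < 2 * N)]
        calc _ ≤ 2 * N * 1 * τ ^ 2 := by gcongr
          _ = (2 * N * τ) * τ := by ring
          _ ≤ M * τ := by rw [hτs]; gcongr
      have f2 : |(Real.exp τ - 1) * x'| ≤ 2 * τ * M := by
        rw [abs_mul]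
        gcongr
      calc _ ≤ M * τ + 2 * τ * M := (abs_add_le _ _).trans (add_le_add f1 f2)
        _ ≤ 4 * A * τ := by
          have : 3 * M ≤ 4 * A := by linarith
          nlinarith
    · rw [hεσ]
      have : 1 ≤ 4 * A := by linarith
      nlinarith
    · exact Real.one_le_exp (by positivity)
    · rw [hεσ]
      have e2 := Real.abs_exp_sub_one_le (x := τ * (1 + n')) (by rwa [abs_of_nonneg (by positivity)])
      rw [abs_of_nonneg (a := τ * (1 + n')) (by positivity)] at e2
      have e3 := (abs_le.1 e2).2
      have : 2 * (1 + n') ≤ 4 * A := by linarith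
      nlinarith
  · have hnp : ¬ Precedes (n, x, t) (n', x', t') := by
      intro hpr
      apply hp
      rcases hpr with h0 | ⟨h0, h1⟩
      · change n' < n at h0
        refine ⟨h0.le, ?_, fun h => by omega⟩
        rcases hadm with h2 | h2
        · change n ≤ n' at h2
          omega
        · exact h2
      · change n = n' at h0
        change t < t' at h1
        exact ⟨h0.ge, h1.le, fun _ => h1⟩
    have hnp' : ¬ Precedes (N + n, Real.sqrt (2 * N) * a + x / Real.sqrt (2 * N), t / (2 * N))
        (N + n', Real.sqrt (2 * N) * a + x' / Real.sqrt (2 * N), t' / (2 * N)) := by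
      intro hpr
      apply hnp
      rcases hpr with h0 | ⟨h0, h1⟩
      · change N + n' < N + n at h0
        exact Or.inl (show n' < n by omega)
      · change N + n = N + n' at h0
        change t / (2 * N) < t' / (2 * N) at h1
        exact Or.inr ⟨show n = n' by omega, (div_lt_div_iff_of_pos_right (by positivity)).1 h1⟩
    simp only [rescalePoint, dbmPhi, beadPhi, hnp, hnp', if_false, mul_zero, sub_zero, abs_zero]
    positivity

/-! ### Uniform convergence of the kernels -/

theorem exists_rescaledDbmKernel_sub_le {a : ℝ} (ha : a ∈ Set.Ioo (-1 : ℝ) 1) (n n' : ℕ) {M : ℝ}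
    (hM : 0 ≤ M) :
    ∃ η : ℕ → ℝ, Tendsto η atTop (𝓝 0) ∧ ∀ᶠ N : ℕ in atTop, ∀ x x' t t' : ℝ, |t' - t| ≤ M →
      |x| ≤ M → |x'| ≤ M → ((n, x, t), (n', x', t')) ∈ admissible →
      ‖rescaledDbmKernel a N (n, x, t) (n', x', t') - beadKernel a (n, x, t) (n', x', t')‖ ≤
        η N := by
  obtain ⟨η₁, h₁, b₁⟩ := exists_phi_sub_le ha n n' hM
  obtain ⟨η₂, h₂, b₂⟩ := exists_norm_doubleIntegral_sub_le ha n n' hM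
  obtain ⟨η₃, h₃, b₃⟩ := exists_arcIntegral_sub_le ha n n' hM
  refine ⟨fun N => η₁ N + η₂ N + η₃ N, by simpa using (h₁.add h₂).add h₃, ?_⟩
  filter_upwards [b₁, b₂, b₃, eventually_ge_atTop 2] with N c₁ c₂ c₃ hN x x' t t' ht hx hx' hadm
  specialize c₁ x x' t t' ht hx hx' hadm
  specialize c₂ (t' - t) x x' ht hx hx'
  specialize c₃ x x' t t' ht hx hx'
  rw [rescaledDbmKernel_eq a hN, beadKernel]
  set φN := Real.exp (-((N : ℝ) * (t' / (2 * N) - t / (2 * N)))) *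
    (N : ℝ) ^ (((n : ℝ) - (n' : ℝ)) / 2) * (2 * (N : ℝ)) ^ (-(1 / 2) : ℝ) *
    dbmPhi (rescalePoint a N (n, x, t)) (rescalePoint a N (n', x', t'))
  set φ := beadPhi a (n, x, t) (n', x', t')
  set I₂ := circleIntegral (fun u => circleFactor a N n x u *
    lineCauchy (lineFactor a N n' ((t' - t) / (2 * N)) x') 2 u) 0 1
  set I₁ := arcIntegral a (fun u => circleFactor a N n x u *
    lineFactor a N n' ((t' - t) / (2 * N)) x' u)
  set I₀ := arcIntegral a (beadIntegrand a (n, x, t) (n', x', t'))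
  have hpi : (Real.pi : ℂ) ≠ 0 := by exact_mod_cast Real.pi_ne_zero
  have hπ := Real.pi_gt_three
  have k₁ : ‖1 / (2 * (Real.pi : ℂ) * Complex.I)‖ ≤ 1 := by
    rw [norm_div, norm_mul, norm_mul, Complex.norm_I, Complex.norm_real,
      Real.norm_of_nonneg (by linarith)]
    norm_num
    linarith [inv_le_one_of_one_le₀ (by linarith : 1 ≤ Real.pi)]
  have k₂ : ‖1 / (2 * (Real.pi : ℂ))‖ ≤ 1 := by
    rw [norm_div, norm_mul, Complex.norm_real, Real.norm_of_nonneg (by linarith)]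
    norm_num
    linarith [inv_le_one_of_one_le₀ (by linarith : 1 ≤ Real.pi)]
  have e : -(φN : ℂ) + 1 / (2 * (Real.pi : ℂ) * Complex.I) * (1 / (2 * (Real.pi : ℂ))) * I₂ -
      (-(φ : ℂ) + 1 / (2 * (Real.pi : ℂ) * Complex.I) * I₀) =
      -((φN - φ : ℝ) : ℂ) + 1 / (2 * (Real.pi : ℂ) * Complex.I) * (1 / (2 * (Real.pi : ℂ))) *
        (I₂ - 2 * Real.pi * I₁) + 1 / (2 * (Real.pi : ℂ) * Complex.I) * (I₁ - I₀) := by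
    have h2 : 1 / (2 * (Real.pi : ℂ)) * (2 * Real.pi * I₁) = I₁ := by field_simp
    push_cast
    linear_combination (1 / (2 * (Real.pi : ℂ) * Complex.I)) * h2
  rw [e]
  refine norm_add₃_le.trans ?_
  rw [norm_neg, Complex.norm_real, Real.norm_eq_abs, norm_mul, norm_mul, norm_mul]
  have d₂ : ‖1 / (2 * (Real.pi : ℂ) * Complex.I)‖ * ‖1 / (2 * (Real.pi : ℂ))‖ *
      ‖I₂ - 2 * Real.pi * I₁‖ ≤ 1 * 1 * η₂ N := by gcongr
  have d₃ : ‖1 / (2 * (Real.pi : ℂ) * Complex.I)‖ * ‖I₁ - I₀‖ ≤ 1 * η₃ N := by gcongr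
  linarith

theorem tendstoUniformlyOn_rescaledDbmKernel {a : ℝ} (ha : a ∈ Set.Ioo (-1 : ℝ) 1)
    {C : Set (Point × Point)} (hC : IsCompact C) :
    TendstoUniformlyOn (fun (N : ℕ) (q : Point × Point) => rescaledDbmKernel a N q.1 q.2)
      (fun q : Point × Point => beadKernel a q.1 q.2) atTop (C ∩ admissible) := by
  have hB : ∀ f : Point × Point → ℝ, Continuous f → ∃ K : ℝ, ∀ q ∈ C, |f q| ≤ K :=
    fun f hf => hC.exists_bound_of_continuousOn hf.continuousOn
  obtain ⟨K₁, hK₁⟩ := hB (fun q => (q.1.1 : ℝ))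
    (continuous_of_discreteTopology.comp (continuous_fst.comp continuous_fst))
  obtain ⟨K₂, hK₂⟩ := hB (fun q => (q.2.1 : ℝ))
    (continuous_of_discreteTopology.comp (continuous_fst.comp continuous_snd))
  obtain ⟨K₃, hK₃⟩ := hB (fun q => q.1.2.1) (by fun_prop)
  obtain ⟨K₄, hK₄⟩ := hB (fun q => q.2.2.1) (by fun_prop)
  obtain ⟨K₅, hK₅⟩ := hB (fun q => q.2.2.2 - q.1.2.2) (by fun_prop)
  obtain ⟨L, hL⟩ := exists_nat_ge (max K₁ K₂)
  set M := |K₃| + |K₄| + |K₅| with hM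
  have hM0 : 0 ≤ M := by positivity
  rw [Metric.tendstoUniformlyOn_iff]
  intro ε hε
  have hfin : ∀ᶠ N : ℕ in atTop, ∀ n ∈ Finset.range (L + 1), ∀ n' ∈ Finset.range (L + 1),
      ∀ x x' t t' : ℝ, |t' - t| ≤ M → |x| ≤ M → |x'| ≤ M →
      ((n, x, t), (n', x', t')) ∈ admissible →
      ‖rescaledDbmKernel a N (n, x, t) (n', x', t') - beadKernel a (n, x, t) (n', x', t')‖ <
        ε := by
    rw [Filter.eventually_all_finset]
    intro n _
    rw [Filter.eventually_all_finset]
    intro n' _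
    obtain ⟨η, hη, hb⟩ := exists_rescaledDbmKernel_sub_le ha n n' hM0
    filter_upwards [hb, hη.eventually (gt_mem_nhds hε)] with N h1 h2 x x' t t' ht hx hx' hadm
    exact (h1 x x' t t' ht hx hx' hadm).trans_lt h2
  filter_upwards [hfin] with N hN q hq
  obtain ⟨⟨n, x, t⟩, ⟨n', x', t'⟩⟩ := q
  have q1 := hK₁ _ hq.1
  have q2 := hK₂ _ hq.1
  have q3 := hK₃ _ hq.1
  have q4 := hK₄ _ hq.1
  have q5 := hK₅ _ hq.1
  simp only at q1 q2 q3 q4 q5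
  have hn : n ∈ Finset.range (L + 1) := by
    rw [Finset.mem_range_succ_iff]
    exact_mod_cast (le_abs_self _).trans (q1.trans ((le_max_left _ _).trans hL))
  have hn' : n' ∈ Finset.range (L + 1) := by
    rw [Finset.mem_range_succ_iff]
    exact_mod_cast (le_abs_self _).trans (q2.trans ((le_max_right _ _).trans hL))
  have p3 := le_abs_self K₃
  have p4 := le_abs_self K₄
  have p5 := le_abs_self K₅
  have r3 := abs_nonneg K₃
  have r4 := abs_nonneg K₄
  have r5 := abs_nonneg K₅
  rw [dist_comm, dist_eq_norm]
  exact hN n hn n' hn' x x' t t' (by linarith) (by linarith) (by linarith) hq.2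

end DysonBead

end

theorem theorem3 (a : ℝ) (ha : a ∈ Set.Ioo (-1 : ℝ) 1) :
    -- uniform convergence on compact sets of the rescaled kernels to the Bead kernel
    (∀ C : Set (DysonBead.Point × DysonBead.Point), IsCompact C →
      TendstoUniformlyOn
        (fun (N : ℕ) (q : DysonBead.Point × DysonBead.Point) =>
          DysonBead.rescaledDbmKernel a N q.1 q.2)
        (fun q : DysonBead.Point × DysonBead.Point => DysonBead.beadKernel a q.1 q.2)
        atTop (C ∩ DysonBead.admissible)) ∧
    -- the contour is the straight line wherever that line does not meet or pass on the
    -- wrong side of a pole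
    (∀ (n n' : ℕ) (x x' t t' : ℝ), (0 < a ∨ n ≤ n') →
      DysonBead.beadKernel a (n, x, t) (n', x', t') =
        -(DysonBead.beadPhi a (n, x, t) (n', x', t') : ℂ) +
          1 / (2 * (Real.pi : ℂ) * Complex.I) *
            DysonBead.segmentIntegral a
              (DysonBead.beadIntegrand a (n, x, t) (n', x', t'))) ∧
    -- at equal times the kernel is Boutillier's bead kernel
    (∀ (n n' : ℕ) (x x' t : ℝ), (n = n' + 1 → x ≠ x') →
      ∃ J : ℂ,
        DysonBead.IsBoutillierValue a ((n' : ℤ) - (n : ℤ))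
          (Real.sqrt (1 - a ^ 2) * (x - x')) J ∧
        DysonBead.beadKernel a (n, x, t) (n', x', t) =
          ((Real.sqrt (1 - a ^ 2) * Real.exp (a * (x - x')) : ℝ) : ℂ) * J) := by
  refine ⟨fun C hC => DysonBead.tendstoUniformlyOn_rescaledDbmKernel ha hC,
    fun n n' x x' t t' h => ?_,
    fun n n' x x' t hx => DysonBead.beadKernel_eq_boutillier ha n n' x x' t hx⟩
  rw [DysonBead.beadKernel, DysonBead.arcIntegral_eq_segmentIntegral ha _ _ h]
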